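/- Let $n\ge 1$, $V=\mathbb C^n$ with coordinates $w_1,\dots,w_n$, $A_V=\mathbb C[w_1,\dots,w_n]$, and $\widetilde V=\mathbb C\times V$ with coordinates $w_0,w_1,\dots,w_n$. Let $h\in A_V$ be reduced and quasi-homogeneous of degree $d\in\mathbb N$ with respect to rational weights $p_1,\dots,p_n$, and put $\chi=\sum_{i=1}^n p_iw_i\partial_{w_i}$. Let $\delta_1,\dots,\delta_{n-1}$ be $\mathbb C$-derivations of $A_V$ with $\delta_i(h)=0$ such that $\delta_1,\dots,\delta_{n-1},\chi$ is an $A_V$-basis of $\mathrm{Der}(-\log D)=\{\delta\in \mathrm{Der}_{\mathbb C}(A_V) : \delta(h)\in (h)\}$, where $D=\{h=0\}$ (so $D$ is a free divisor). Assume the strong Koszul hypothesis: $h$ and the symbols $\sigma(\delta_1),\dots,\sigma(\delta_{n-1})$ for the order filtration form a regular sequence in $\mathrm{Gr}\,D_V=A_V[\xi_1,\dots,\xi_n]$, where $D_V$ is the ring of differential operators on $V$. Let $c\in\mathbb C\setminus\{0\}$, $\widetilde h=h-cw_0^d$ and $\widetilde\chi=\chi+w_0\partial_{w_0}$. Let $D_{\widetilde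 V}[s]$ be the ring of differential operators on $\widetilde V$ with a central variable $s$ adjoined, with the total order filtration ($w_0,\dots,w_n$ in order $0$; $\partial_{w_0},\dots,\partial_{w_n}$ and $s$ in order $1$), so that $\mathrm{Gr}\,D_{\widetilde V}[s]=\mathbb C[w_0,\dots,w_n][\xi_0,\dots,\xi_n,s]$. Let $I(s)\subset D_{\widetilde V}[s]$ be the left ideal generated by the family $$\underline r=(r_1,\dots,r_{n+1})=(\widetilde h,\ \delta_1,\dots,\delta_{n-1},\ \widetilde\chi-ds)$$ and $N(s)=D_{\widetilde V}[s]/I(s)$. Then: 1. The sum $L=\bigoplus_i \mathbb C[w_0,\dots,w_n]\,r_i\subset D_{\widetilde V}[s]$ is direct and closed under the commutator. The Spencer complex over $D_{\widetilde V}[s]$ associated with $\underline r$, with terms $D_{\widetilde V}[s]\otimes_{\mathbb C[w_0,\dots,w_n]}\bigwedge^e L$ in degree $-e$ and the left $D_{\widetilde V}[s]$-linear differential given, for $\lambda_1,\dots,\lambda_e\in L$, by $$P\otimes(\lambda_1\wedge\dots\wedge\lambda_e)\mapsto \sum_{i}(-1)^{i-1}P\lambda_i\otimes(\lambda_1\wedge\cdots\widehat{\lambda_i}\cdots\wedge\lambda_e)+\sum_{i<j}(-1)^{i+j}P\otimes([\lambda_i,\lambda_j]\wedge\lambda_1\wedge\cdots\widehat{\lambda_i}\cdots\widehat{\lambda_j}\cdots\wedge\lambda_e),$$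 is concentrated in degree $0$, and with the augmentation $P\mapsto P \bmod I(s)$ it is a free resolution of $N(s)$. 2. $\underline r$ is an involutive basis of $I(s)$: the symbols of $r_1,\dots,r_{n+1}$ generate the ideal $\sigma(I(s))\subset\mathrm{Gr}\,D_{\widetilde V}[s]$ generated by the symbols of all elements of $I(s)$. 3. The symbols of $r_1,\dots,r_{n+1}$ for the total order filtration form a regular sequence in $\mathrm{Gr}\,D_{\widetilde V}[s]$. -/

import Mathlib

open MvPolynomial

noncomputable section

/-! ### Spencer complexes

`A` is a commutative ring, `R` a ring, `ι : A →+* R`; in the application `A = ℂ[x]` and `R` is a ring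
of differential operators containing `A`. -/

/-- The left `A`-submodule `L = ∑ i, A r_i` of `R`, as a set. -/
def lieSpan {A R : Type*} [CommRing A] [Ring R] (ι : A →+* R) {m : ℕ} (r : Fin m → R) : Set R :=
  {x | ∃ a : Fin m → A, x = ∑ i, ι (a i) * r i}

/-- The sum `L = ⊕ A r_i` is direct and `L` is closed under the commutator of `R`. -/
structure IsLieRinehartFamily {A R : Type*} [CommRing A] [Ring R] (ι : A →+* R) {m : ℕ}
    (r : Fin m → R) : Prop where
  indep : ∀ a : Fin m → A, ∑ i, ι (a i) * r i = 0 → ∀ i, a i = 0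
  bracket : ∀ x ∈ lieSpan ι r, ∀ y ∈ lieSpan ι r, x * y - y * x ∈ lieSpan ι r

theorem IsLieRinehartFamily.exists_structureConst {A R : Type*} [CommRing A] [Ring R]
    {ι : A →+* R} {m : ℕ} {r : Fin m → R} (hr : IsLieRinehartFamily ι r) (i j : Fin m) :
    ∃ a : Fin m → A, r i * r j - r j * r i = ∑ k, ι (a k) * r k := by
  have hmem : ∀ i, r i ∈ lieSpan ι r := fun i =>
    ⟨Pi.single i 1, by
      rw [Finset.sum_eq_single i]
      · simp
      · intro b _ hb
        simp [Pi.single_eq_of_ne hb]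
      · simp⟩
  exact hr.bracket _ (hmem i) _ (hmem j)

/-- The (unique) coefficients in `[r_i, r_j] = ∑ k, (structureConst i j k) r_k`. -/
def structureConst {A R : Type*} [CommRing A] [Ring R] {ι : A →+* R} {m : ℕ} {r : Fin m → R}
    (hr : IsLieRinehartFamily ι r) (i j : Fin m) : Fin m → A :=
  Classical.choose (hr.exists_structureConst i j)

/-- The term of degree `-e` of the Spencer complex, `R ⊗_{U(L)} (U(L) ⊗_A ⋀^e L) = R ⊗_A ⋀^e L`.
As `L` is free on `r`, this is the free left `R`-module on the elements
`r_S = r_{s_1} ∧ ⋯ ∧ r_{s_e}`, one for each `S = {s_1 < ⋯ < s_e}`. -/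
abbrev Spencer (R : Type*) [Ring R] (m e : ℕ) : Type _ :=
  {S : Finset (Fin m) // S.card = e} →₀ R

/-- `(-1) ^ (number of elements of S that are smaller than k)`. -/
def wedgeSign {m : ℕ} (S : Finset (Fin m)) (k : Fin m) : ℤ :=
  (-1) ^ (S.filter (· < k)).card

/-- The basis element `r_S` in degree `-e` (and `0` if `S` does not have `e` elements). -/
def wedgeBasis (R : Type*) [Ring R] {m : ℕ} (e : ℕ) (S : Finset (Fin m)) : Spencer R m e :=
  if h : S.card = e then Finsupp.single ⟨S, h⟩ 1 else 0

/-- The element `r_k ∧ r_S` in degree `-e`: it is zero if `k ∈ S`, and otherwise it is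
`± r_{S ∪ {k}}`, with the sign that sorts the factors. -/
def wedgeInsert (R : Type*) [Ring R] {m : ℕ} (e : ℕ) (k : Fin m) (S : Finset (Fin m)) :
    Spencer R m e :=
  if k ∈ S then 0 else wedgeSign S k • wedgeBasis R e (insert k S)

/-- The differential of the Spencer complex over `R` associated with `r`, the left `R`-linear map with
`r_S ↦ ∑_i (-1)^(i-1) r_{s_i} ⊗ r_{S \ s_i}
  + ∑_{i<j} (-1)^(i+j) [r_{s_i}, r_{s_j}] ∧ r_{S \ {s_i, s_j}}`. -/
def spencerD {A R : Type*} [CommRing A] [Ring R] {ι : A →+* R} {m : ℕ} {r : Fin m → R}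
    (hr : IsLieRinehartFamily ι r) (e : ℕ) : Spencer R m (e + 1) →ₗ[R] Spencer R m e :=
  Finsupp.linearCombination R fun S : {S : Finset (Fin m) // S.card = e + 1} =>
    (∑ i ∈ S.1, wedgeSign S.1 i • (r i • wedgeBasis R e (S.1.erase i))) +
    ∑ i ∈ S.1, ∑ j ∈ S.1.filter (i < ·), (wedgeSign S.1 i * wedgeSign S.1 j) •
      ∑ k, ι (structureConst hr i j k) • wedgeInsert R e k ((S.1.erase i).erase j)

/-- The augmentation `P ↦ P mod I` from the term of degree `0`, which is free on `r_∅ = 1`. -/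
def spencerAug {R : Type*} [Ring R] (m : ℕ) (I : Submodule R R) :
    Spencer R m 0 →ₗ[R] R ⧸ I :=
  Finsupp.linearCombination R fun _ => I.mkQ 1

/-- `⋯ → M 2 → M 1 → M 0 → N → 0` is a complex, it is exact, and all `M e` are free. -/
structure IsFreeResolution {R : Type*} [Ring R] {M : ℕ → Type*} [∀ e, AddCommGroup (M e)]
    [∀ e, Module R (M e)] {N : Type*} [AddCommGroup N] [Module R N]
    (d : ∀ e, M (e + 1) →ₗ[R] M e) (ε : M 0 →ₗ[R] N) : Prop where
  free : ∀ e, Module.Free R (M e)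
  exact : ∀ e, Function.Exact (d (e + 1)) (d e)
  exact_zero : Function.Exact (d 0) ε
  surjective : Function.Surjective ε

/-! ### Differential operators on affine space -/

/-- The ring `A⟨∂_1, …, ∂_N⟩` of differential operators with coefficients in `A = ℂ[x_1, …, x_N]`, as
the algebra of operators on `A` generated by the multiplications and the partial derivatives. -/
def weylSubalgebra (N : ℕ) : Subalgebra ℂ (Module.End ℂ (MvPolynomial (Fin N) ℂ)) :=
  Algebra.adjoin ℂ (Set.range (fun f : MvPolynomial (Fin N) ℂ => LinearMap.mulLeft ℂ f) ∪
    Set.range (fun i : Fin N => (pderiv i).toLinearMap))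

/-- The same ring as a type. -/
def WeylAlg (N : ℕ) : Type := ↥(weylSubalgebra N)

instance (N : ℕ) : Ring (WeylAlg N) := (weylSubalgebra N).toRing

instance (N : ℕ) : Algebra ℂ (WeylAlg N) := (weylSubalgebra N).algebra

/-- `A → A⟨∂⟩`, a polynomial as an operator of order zero. -/
def mulOp (N : ℕ) : MvPolynomial (Fin N) ℂ →+* WeylAlg N :=
  (Algebra.lmul ℂ (MvPolynomial (Fin N) ℂ)).toRingHom.codRestrict (weylSubalgebra N)
    fun f => Algebra.subset_adjoin (Or.inl ⟨f, rfl⟩)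

/-- `∂_i` as an element of `A⟨∂⟩`. -/
def partialOp {N : ℕ} (i : Fin N) : WeylAlg N :=
  (⟨(pderiv i).toLinearMap, Algebra.subset_adjoin (Or.inr ⟨i, rfl⟩)⟩ : weylSubalgebra N)

/-- The ring `A⟨∂⟩[s]`, with a central variable `s`. -/
abbrev WeylAlgS (N : ℕ) : Type := Polynomial (WeylAlg N)

/-- `A → A⟨∂⟩[s]`. -/
def coeffOp (N : ℕ) : MvPolynomial (Fin N) ℂ →+* WeylAlgS N :=
  (Polynomial.C : WeylAlg N →+* WeylAlgS N).comp (mulOp N)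

/-- The graded ring of `A⟨∂⟩[s]` for the total order filtration: the polynomial ring `A[ξ, s]` with
`ξ_i = X (some i)` and `s = X none`, graded by the degree in `ξ` and `s`. -/
abbrev GrS (N : ℕ) : Type := MvPolynomial (Option (Fin N)) (MvPolynomial (Fin N) ℂ)

/-- The operator `∂_1^{β_1} ⋯ ∂_N^{β_N} s^{β_s}`. -/
def monomialOp {N : ℕ} (β : Option (Fin N) →₀ ℕ) : WeylAlgS N :=
  Polynomial.C (List.ofFn fun i => partialOp i ^ β (some i)).prod * Polynomial.X ^ β none

/-- `∑ a_β ξ^β s^j ↦ ∑ a_β ∂^β s^j`, coefficients to the left. -/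
def normalOp {N : ℕ} (p : GrS N) : WeylAlgS N :=
  ∑ β ∈ p.support, coeffOp N (p.coeff β) * monomialOp β

/-- `P` lies in `F_{k-1}` for the total order filtration (`x` in order `0`, the `∂_i` and `s` in order
`1`, `F_{-1} = 0`). -/
def HasOrderLT {N : ℕ} (k : ℕ) (P : WeylAlgS N) : Prop :=
  ∃ p : GrS N, (∀ β ∈ p.support, β.degree < k) ∧ P = normalOp p

/-- `P ∈ F_k` and `p` is the class `σ_k(P)` of `P` in `F_k / F_{k-1}`. If `p ≠ 0`, then `P` has order
`k` and `p` is the symbol of `P`. -/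
def IsSymbol {N : ℕ} (k : ℕ) (P : WeylAlgS N) (p : GrS N) : Prop :=
  p.IsHomogeneous k ∧ HasOrderLT k (P - normalOp p)

/-- The ideal `σ(S)` of the graded ring generated by the symbols of the elements of `S`. -/
def symbolIdeal {N : ℕ} (S : Set (WeylAlgS N)) : Ideal (GrS N) :=
  Ideal.span {p | ∃ P ∈ S, ∃ k, IsSymbol k P p}

/-- The `r_i` generate the left ideal `I`, and their symbols generate `σ(I)`. -/
structure IsInvolutiveBasis {N m : ℕ} (r : Fin m → WeylAlgS N)
    (I : Submodule (WeylAlgS N) (WeylAlgS N)) : Prop where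
  span_eq : Submodule.span (WeylAlgS N) (Set.range r) = I
  symbolIdeal_eq : symbolIdeal (I : Set (WeylAlgS N)) = symbolIdeal (Set.range r)

/-! ### Logarithmic vector fields -/

/-- `Der(-log D)` for the divisor `D = {h = 0}`, where `h` is a reduced equation. -/
def logDer {N : ℕ} (h : MvPolynomial (Fin N) ℂ) :
    Submodule (MvPolynomial (Fin N) ℂ)
      (Derivation ℂ (MvPolynomial (Fin N) ℂ) (MvPolynomial (Fin N) ℂ)) where
  carrier := {δ | h ∣ δ h}
  add_mem' := fun ha hb => dvd_add (α := MvPolynomial (Fin N) ℂ) ha hb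
  zero_mem' := dvd_zero h
  smul_mem' := fun c _ hδ => Dvd.dvd.mul_left (α := MvPolynomial (Fin N) ℂ) hδ c

/-- The weighted Euler vector field `χ = ∑ p_j w_j ∂_{w_j}`. -/
def eulerField {N : ℕ} (p : Fin N → ℚ) :
    Derivation ℂ (MvPolynomial (Fin N) ℂ) (MvPolynomial (Fin N) ℂ) :=
  ∑ j, (C (p j : ℂ) * X j) • pderiv j

/-- The symbol `∑ a_j ξ_j` of `δ = ∑ a_j ∂_{w_j}` in the graded ring `ℂ[w][ξ]` of the ring of
differential operators, for the filtration by order. -/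
def fieldSymbol {N : ℕ}
    (δ : Derivation ℂ (MvPolynomial (Fin N) ℂ) (MvPolynomial (Fin N) ℂ)) :
    MvPolynomial (Fin N) (MvPolynomial (Fin N) ℂ) :=
  ∑ j, C (δ (X j)) * X j

/-- The strong Koszul hypothesis: the symbols of `h, δ_1, …, δ_n` form a regular sequence. -/
def StronglyKoszul {N n : ℕ} (h : MvPolynomial (Fin N) ℂ)
    (δ : Fin n → Derivation ℂ (MvPolynomial (Fin N) ℂ) (MvPolynomial (Fin N) ℂ)) : Prop :=
  RingTheory.Sequence.IsRegular (MvPolynomial (Fin N) (MvPolynomial (Fin N) ℂ))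
    (C h :: List.ofFn fun i => fieldSymbol (δ i))

/-- The vector field `δ = ∑ a_j ∂_{w_j}` on `V = ℂ^N` as an operator on `ℂ × V`, whose coordinates are
`w_0 = X 0` followed by those of `V`. -/
def liftField {N : ℕ}
    (δ : Derivation ℂ (MvPolynomial (Fin N) ℂ) (MvPolynomial (Fin N) ℂ)) : WeylAlg (N + 1) :=
  ∑ j, mulOp (N + 1) (rename Fin.succ (δ (X j))) * partialOp j.succ

/-- `h̃ = h - c w_0^d`. -/
def hTilde {N : ℕ} (h : MvPolynomial (Fin N) ℂ) (c : ℂ) (d : ℕ) : MvPolynomial (Fin (N + 1)) ℂ :=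
  rename Fin.succ h - C c * X 0 ^ d

/-- `χ̃ = χ + w_0 ∂_{w_0}`. -/
def chiTilde {N : ℕ} (p : Fin N → ℚ) : WeylAlg (N + 1) :=
  liftField (eulerField p) + mulOp (N + 1) (X 0) * partialOp 0

/-- The family `(h̃, δ_1, …, δ_n, χ̃ - d s)`. -/
def bernsteinFamily {N n : ℕ} (p : Fin N → ℚ) (d : ℕ) (h : MvPolynomial (Fin N) ℂ) (c : ℂ)
    (δ : Fin n → Derivation ℂ (MvPolynomial (Fin N) ℂ) (MvPolynomial (Fin N) ℂ)) :
    Fin (n + 2) → WeylAlgS (N + 1) :=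
  Fin.cons (coeffOp (N + 1) (hTilde h c d))
    (Fin.snoc (fun i => Polynomial.C (liftField (δ i)) : Fin n → WeylAlgS (N + 1))
      (Polynomial.C (chiTilde p) - (d : WeylAlgS (N + 1)) * Polynomial.X) :
        Fin (n + 1) → WeylAlgS (N + 1))

/-- The left ideal `I(s)` generated by this family; `N(s)` is the quotient by it. -/
def bernsteinIdeal {N n : ℕ} (p : Fin N → ℚ) (d : ℕ) (h : MvPolynomial (Fin N) ℂ) (c : ℂ)
    (δ : Fin n → Derivation ℂ (MvPolynomial (Fin N) ℂ) (MvPolynomial (Fin N) ℂ)) :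
    Submodule (WeylAlgS (N + 1)) (WeylAlgS (N + 1)) :=
  Submodule.span _ (Set.range (bernsteinFamily p d h c δ))

end

/-! The Spencer complex is a deformation of the Koszul complex on the symbols of `r`. Filter it by
order, giving `r_S` the sum of the orders of its factors (0 for `h̃`, 1 for the others). The bracket
terms drop in this filtration, so the leading part of the differential is the Koszul differential of
the symbols (`HasHomogeneousSymbols.totalD_sub_mem`). If the symbols form a regular sequence, the
Koszul complex is exact in positive degrees (`koszul_exact`), and the leading part of a cycle can be
removed by a boundary (`HasHomogeneousSymbols.exists_lower`). Descending along the filtration gives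
exactness. The same descent gives strictness: an element of `I(s)` of order `k` is a combination of
the `r_i` without cancellation above order `k`, so its symbol lies in the ideal of the symbols of
the `r_i`. Claims 1 and 2 thus follow from claim 3, the closedness of `L` under brackets and `d² =
0`.

Regularity of the symbols. The hypothesis says that `h, σ(δ_1), …` is regular. Outside `h = 0` the
fields `δ_1, …, χ` form a frame, so there their symbols are, up to powers of `h`, a linear change of
the variables `ξ`. Hence `h` can be dropped from the front of the sequence
(`IsWeaklyRegularFamily.of_cons`). Since `c ≠ 0` and `d ≠ 0`, the polynomial `h - c w_0^d` is a
constant times a monic polynomial in the new variable `w_0` and may be put in front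
(`IsWeaklyRegularFamily.cons_polynomial`). The last symbol has the invertible coefficient `-d` at
the new variable `s` and may be put at the end.

Brackets. As `d ≠ 0`, the fields annihilating `h` are spanned by the `δ_i`. The fields `[δ_i, δ_j]`
and `[χ, δ_i]` annihilate `h`, and the lifted fields multiply `h̃` by `0` or `d`, so `L` is closed.

The relation `d² = 0` is the nilpotency of a BRST operator: with contractions and exterior
multiplications as operators, it reduces to the Jacobi identity (`brst_sq_eq_zero`). Symbols are
handled through the normal form of operators (`normalHom_injective`, `normalHom_mul`). -/

noncomputable section

/-! ### BRST operators of square zero -/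

/-- The square of `∑ sᵢ ιᵢ + ½ ∑ γᵢⱼₖ eₖ ιᵢ ιⱼ` vanishes, for operators satisfying the canonical
anticommutation relations and coefficients satisfying the relations of a Lie-Rinehart algebra. -/
theorem brst_sq_eq_zero {E ν : Type*} [Ring E] [Fintype ν] [DecidableEq ν]
    (s ι e : ν → E) (γ : ν → ν → ν → E)
    (htors : ∀ x : E, (24 : ℕ) • x = 0 → x = 0)
    (hsι : ∀ i j, s i * ι j = ι j * s i)
    (hse : ∀ i j, s i * e j = e j * s i)
    (hγι : ∀ i j k l, γ i j k * ι l = ι l * γ i j k)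
    (hγe : ∀ i j k l, γ i j k * e l = e l * γ i j k)
    (hγγ : ∀ i j k a b c, γ i j k * γ a b c = γ a b c * γ i j k)
    (hιι : ∀ i j, ι i * ι j = -(ι j * ι i))
    (hee : ∀ i j, e i * e j = -(e j * e i))
    (hιe : ∀ i k, ι i * e k = (if i = k then 1 else 0) - e k * ι i)
    (hss : ∀ i j, s j * s i - s i * s j = ∑ k, s k * γ i j k)
    (hanti : ∀ i j k, γ i j k = -γ j i k)
    (T : ν → ν → ν → ν → E)
    (hT : ∀ l i j k, T l i j k = γ i j k * s l - s l * γ i j k + ∑ a, γ i j a * γ l a k)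
    (hjac : ∀ l i j k, T l i j k + T i j l k + T j l i k = 0)
    (d : E) (hd : 2 * d = 2 * ∑ i, s i * ι i + ∑ i, ∑ j, ∑ k, γ i j k * e k * ι i * ι j) :
    d * d = 0 := by
  set Q := ∑ i, s i * ι i with hQ
  set S := ∑ i, ∑ j, ∑ k, γ i j k * e k * ι i * ι j with hS
  set X := ∑ i, ∑ j, ∑ k, s k * γ i j k * ι i * ι j with hX
  -- Adding the double sum to itself with the two indices exchanged leaves only the commutators of
  -- the `s i`, because the `ι i` anticommute.
  have h1 : 2 * (Q * Q) = -X := by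
    have hQQ : Q * Q = ∑ i, ∑ j, s i * s j * (ι i * ι j) := by
      rw [hQ, Finset.sum_mul_sum]
      refine Finset.sum_congr rfl fun i _ => Finset.sum_congr rfl fun j _ => ?_
      rw [mul_assoc, ← mul_assoc (ι i), ← hsι j i]; noncomm_ring
    have hQQ' : Q * Q = ∑ i, ∑ j, -(s j * s i * (ι i * ι j)) := by
      rw [hQQ, Finset.sum_comm]
      refine Finset.sum_congr rfl fun i _ => Finset.sum_congr rfl fun j _ => ?_
      rw [hιι j i]; noncomm_ring
    rw [two_mul]
    nth_rewrite 1 [hQQ]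
    rw [hQQ', hX, ← Finset.sum_add_distrib, ← Finset.sum_neg_distrib]
    refine Finset.sum_congr rfl fun i _ => ?_
    rw [← Finset.sum_add_distrib, ← Finset.sum_neg_distrib]
    refine Finset.sum_congr rfl fun j _ => ?_
    rw [← Finset.sum_mul, ← Finset.sum_mul, ← hss]; noncomm_ring
  set Y1 := ∑ l, ∑ i, ∑ j, ∑ k, s l * γ i j k * (e k * (ι l * ι i * ι j)) with hY1
  set Y2 := ∑ l, ∑ i, ∑ j, ∑ k, γ i j k * s l * (e k * (ι l * ι i * ι j)) with hY2
  -- Moving `e k` to the left of `ι l` leaves a Kronecker delta, whose contribution `X` will cancel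
  -- the one of `Q * Q`.
  have h2 : Q * S = X - Y1 := by
    have hX' : X = ∑ l, ∑ i, ∑ j, ∑ k, s l * γ i j k * ((if l = k then 1 else 0) * (ι i * ι j)) := by
      rw [hX, Finset.sum_comm]
      conv_rhs => rw [Finset.sum_comm, Finset.sum_comm]
      rw [Finset.sum_comm]
      conv_rhs => rw [Finset.sum_comm]
      refine Finset.sum_congr rfl fun i _ => ?_
      conv_rhs => rw [Finset.sum_comm]
      refine Finset.sum_congr rfl fun j _ => ?_
      refine Finset.sum_congr rfl fun k _ => ?_
      rw [Finset.sum_eq_single k]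
      · rw [if_pos rfl, one_mul]; noncomm_ring
      · intro b _ hb; rw [if_neg hb.symm]; noncomm_ring
      · simp
    rw [hX', hY1, hQ, Finset.sum_mul, ← Finset.sum_sub_distrib]
    refine Finset.sum_congr rfl fun l _ => ?_
    rw [hS, Finset.mul_sum, ← Finset.sum_sub_distrib]
    refine Finset.sum_congr rfl fun i _ => ?_
    rw [Finset.mul_sum, ← Finset.sum_sub_distrib]
    refine Finset.sum_congr rfl fun j _ => ?_
    rw [Finset.mul_sum, ← Finset.sum_sub_distrib]
    refine Finset.sum_congr rfl fun k _ => ?_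
    calc s l * ι l * (γ i j k * e k * ι i * ι j)
        = s l * (ι l * γ i j k) * e k * ι i * ι j := by noncomm_ring
      _ = s l * γ i j k * (ι l * e k) * ι i * ι j := by rw [← hγι]; noncomm_ring
      _ = _ := by rw [hιe]; noncomm_ring
  have h3 : S * Q = Y2 := by
    rw [hS, hQ, hY2, Finset.mul_sum]
    refine Finset.sum_congr rfl fun l _ => ?_
    rw [Finset.sum_mul]
    refine Finset.sum_congr rfl fun i _ => ?_
    rw [Finset.sum_mul]
    refine Finset.sum_congr rfl fun j _ => ?_
    rw [Finset.sum_mul]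
    refine Finset.sum_congr rfl fun k _ => ?_
    calc γ i j k * e k * ι i * ι j * (s l * ι l)
        = γ i j k * e k * ι i * (ι j * s l) * ι l := by noncomm_ring
      _ = γ i j k * e k * (ι i * s l) * ι j * ι l := by rw [← hsι]; noncomm_ring
      _ = γ i j k * (e k * s l) * ι i * (ι j * ι l) := by rw [← hsι]; noncomm_ring
      _ = γ i j k * s l * e k * -(ι i * ι l) * ι j := by rw [← hse, hιι j l]; noncomm_ring
      _ = _ := by rw [hιι i l]; noncomm_ring
  set U := ∑ i, ∑ j, ∑ k, ∑ a, ∑ b, ∑ c,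
    γ i j k * γ a b c * (e k * e c * (ι i * ι j * ι a * ι b)) with hU
  set V := ∑ l, ∑ i, ∑ j, ∑ k, ∑ a, γ i j a * γ l a k * (e k * (ι l * ι i * ι j)) with hV
  -- Exchange `(i, j, k)` with `(a, b, c)`: the coefficients commute, the pairs `ι i * ι j` and `ι a
  -- * ι b` commute, and `e k * e c` changes sign.
  have hUU : U = -U := by
    rw [hU]
    simp only [← Finset.sum_product', Finset.univ_product_univ]
    rw [← Finset.sum_neg_distrib]
    refine Fintype.sum_equiv (⟨fun x => (x.2.2.2.1, x.2.2.2.2.1, x.2.2.2.2.2, x.1, x.2.1, x.2.2.1),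
      fun x => (x.2.2.2.1, x.2.2.2.2.1, x.2.2.2.2.2, x.1, x.2.1, x.2.2.1),
      fun _ => rfl, fun _ => rfl⟩) _ _ (fun x => ?_)
    obtain ⟨i, j, k, a, b, c⟩ := x
    change γ i j k * γ a b c * (e k * e c * (ι i * ι j * ι a * ι b)) =
      -(γ a b c * γ i j k * (e c * e k * (ι a * ι b * ι i * ι j)))
    have : ι a * ι b * ι i * ι j = ι i * ι j * ι a * ι b := by
      calc ι a * ι b * ι i * ι j = ι a * (ι b * ι i) * ι j := by noncomm_ring
        _ = -((ι a * ι i) * (ι b * ι j)) := by rw [hιι b i]; noncomm_ring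
        _ = -(ι i * (ι a * ι j) * ι b) := by rw [hιι b j, hιι a i]; noncomm_ring
        _ = _ := by rw [hιι a j]; noncomm_ring
    rw [this, hγγ i j k, hee k c]; noncomm_ring
  have h4 : S * S = U + 2 * V := by
    set f : ν → ν → ν → ν → ν → ν → E := fun i j k a b c => γ i j k * γ a b c * e k with hf
    have hV1 : ∑ i, ∑ j, ∑ k, ∑ a, ∑ b, ∑ c,
        f i j k a b c * ((if j = c then 1 else 0) * ι i * ι a * ι b) = V := by
      have : ∀ i j k a b, ∑ c, f i j k a b c * ((if j = c then 1 else 0) * ι i * ι a * ι b) =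
          γ a b j * γ i j k * (e k * (ι i * ι a * ι b)) := by
        intro i j k a b
        rw [Finset.sum_eq_single j]
        · rw [if_pos rfl, hf, ← hγγ i j k]; noncomm_ring
        · intro c _ hc; rw [if_neg hc.symm]; noncomm_ring
        · simp
      simp only [this, hV]
      simp only [← Finset.sum_product', Finset.univ_product_univ]
      exact Fintype.sum_equiv (⟨fun x => (x.1, x.2.2.2.1, x.2.2.2.2, x.2.2.1, x.2.1),
        fun x => (x.1, x.2.2.2.2, x.2.2.2.1, x.2.1, x.2.2.1), fun _ => rfl, fun _ => rfl⟩) _ _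
        (fun x => rfl)
    have hV2 : ∑ i, ∑ j, ∑ k, ∑ a, ∑ b, ∑ c,
        f i j k a b c * ((if i = c then 1 else 0) * ι j * ι a * ι b) = -V := by
      rw [← hV1, Finset.sum_comm]
      simp only [← Finset.sum_neg_distrib]
      refine Finset.sum_congr rfl fun j _ => Finset.sum_congr rfl fun i _ =>
        Finset.sum_congr rfl fun k _ => Finset.sum_congr rfl fun a _ =>
        Finset.sum_congr rfl fun b _ => Finset.sum_congr rfl fun c _ => ?_
      simp only [hf]
      rw [hanti i j k]; noncomm_ring
    have : S * S = ∑ i, ∑ j, ∑ k, ∑ a, ∑ b, ∑ c,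
        (γ i j k * γ a b c * (e k * e c * (ι i * ι j * ι a * ι b))
        + f i j k a b c * ((if j = c then 1 else 0) * ι i * ι a * ι b)
        - f i j k a b c * ((if i = c then 1 else 0) * ι j * ι a * ι b)) := by
      nth_rewrite 1 [hS]
      rw [Finset.sum_mul]
      refine Finset.sum_congr rfl fun i _ => ?_
      rw [Finset.sum_mul]
      refine Finset.sum_congr rfl fun j _ => ?_
      rw [Finset.sum_mul]
      refine Finset.sum_congr rfl fun k _ => ?_
      simp only [hS, Finset.mul_sum]
      refine Finset.sum_congr rfl fun a _ =>
        Finset.sum_congr rfl fun b _ => Finset.sum_congr rfl fun c _ => ?_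
      have hx : ι i * ι j * e c = e c * ι i * ι j + (if j = c then 1 else 0) * ι i
          - (if i = c then 1 else 0) * ι j := by
        rw [mul_assoc, hιe, mul_sub, ← mul_assoc, hιe]
        split_ifs <;> noncomm_ring
      calc γ i j k * e k * ι i * ι j * (γ a b c * e c * ι a * ι b)
          = γ i j k * e k * ι i * (ι j * γ a b c) * e c * ι a * ι b := by noncomm_ring
        _ = γ i j k * e k * (ι i * γ a b c) * ι j * e c * ι a * ι b := by
          rw [← hγι]; noncomm_ring
        _ = γ i j k * (e k * γ a b c) * ι i * ι j * e c * ι a * ι b := by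
          rw [← hγι]; noncomm_ring
        _ = γ i j k * γ a b c * e k * (ι i * ι j * e c) * ι a * ι b := by
          rw [← hγe]; noncomm_ring
        _ = _ := by rw [hx, hf]; noncomm_ring
    rw [this]
    simp only [Finset.sum_add_distrib, Finset.sum_sub_distrib]
    rw [hV1, hV2, ← hU]; noncomm_ring
  -- A product of three `ι`'s is invariant under cyclic permutation, so three copies of this sum
  -- carry the cyclic sum of `T`, which vanishes by the Jacobi relation.
  have h5 : 3 * (Y2 - Y1 + V) = 0 := by
    have hZ : Y2 - Y1 + V = ∑ l, ∑ i, ∑ j, ∑ k, T l i j k * (e k * (ι l * ι i * ι j)) := by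
      rw [hY1, hY2, hV]
      simp only [← Finset.sum_add_distrib, ← Finset.sum_sub_distrib]
      refine Finset.sum_congr rfl fun l _ => Finset.sum_congr rfl fun i _ =>
        Finset.sum_congr rfl fun j _ => Finset.sum_congr rfl fun k _ => ?_
      rw [hT, ← Finset.sum_mul]; noncomm_ring
    have hι3 : ∀ l i j, ι i * ι j * ι l = ι l * ι i * ι j := by
      intro l i j
      rw [mul_assoc, hιι j l, mul_neg, ← mul_assoc, hιι i l]; noncomm_ring
    have hZ' : Y2 - Y1 + V = ∑ l, ∑ i, ∑ j, ∑ k, T i j l k * (e k * (ι l * ι i * ι j)) := by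
      rw [hZ]
      simp only [← Finset.sum_product', Finset.univ_product_univ]
      refine Fintype.sum_equiv (⟨fun x => (x.2.2.1, x.1, x.2.1, x.2.2.2),
        fun x => (x.2.1, x.2.2.1, x.1, x.2.2.2), fun _ => rfl, fun _ => rfl⟩) _ _ (fun x => ?_)
      simp only [Equiv.coe_fn_mk]
      rw [← hι3 x.2.2.1]
    have hZ'' : Y2 - Y1 + V = ∑ l, ∑ i, ∑ j, ∑ k, T j l i k * (e k * (ι l * ι i * ι j)) := by
      rw [hZ]
      simp only [← Finset.sum_product', Finset.univ_product_univ]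
      refine Fintype.sum_equiv (⟨fun x => (x.2.1, x.2.2.1, x.1, x.2.2.2),
        fun x => (x.2.2.1, x.1, x.2.1, x.2.2.2), fun _ => rfl, fun _ => rfl⟩) _ _ (fun x => ?_)
      simp only [Equiv.coe_fn_mk]
      rw [hι3 x.1]
    have : 3 * (Y2 - Y1 + V) = (Y2 - Y1 + V) + (Y2 - Y1 + V) + (Y2 - Y1 + V) := by noncomm_ring
    rw [this]
    nth_rewrite 1 [hZ]
    nth_rewrite 1 [hZ']
    rw [hZ'']
    simp only [← Finset.sum_add_distrib, ← add_mul, hjac, zero_mul, Finset.sum_const_zero]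
  apply htors
  have hU2 : 2 * U = 0 := by rw [two_mul]; nth_rewrite 2 [hUU]; simp
  have h6 : 4 * (d * d) = 2 * (Y2 - Y1 + V) + U := by
    have : 4 * (d * d) = (2 * d) * (2 * d) := by noncomm_ring
    rw [this, hd]
    have : (2 * Q + S) * (2 * Q + S) = 2 * (2 * (Q * Q)) + 2 * (Q * S + S * Q) + S * S := by
      noncomm_ring
    rw [this, h1, h2, h3, h4]; noncomm_ring
  -- The factor 4 clears the halves in `d`, and 6 is a common multiple of the 3 needed for the
  -- Jacobi sum and the 2 needed for `U`.
  have : (24 : ℕ) • (d * d) = 6 * (4 * (d * d)) := by noncomm_ring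
  rw [this, h6]
  have : 6 * (2 * (Y2 - Y1 + V) + U) = 4 * (3 * (Y2 - Y1 + V)) + 3 * (2 * U) := by noncomm_ring
  rw [this, h5, hU2]; simp

/-! ### The Spencer differential as an operator -/

theorem wedgeSign_mul_self {m : ℕ} (T : Finset (Fin m)) (i : Fin m) :
    wedgeSign T i * wedgeSign T i = 1 := by
  rw [wedgeSign, ← mul_pow]; simp

theorem wedgeSign_insert_self {m : ℕ} (T : Finset (Fin m)) (i : Fin m) :
    wedgeSign (insert i T) i = wedgeSign T i := by
  rw [wedgeSign, wedgeSign, Finset.filter_insert, if_neg (lt_irrefl _)]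

theorem wedgeSign_insert {m : ℕ} {T : Finset (Fin m)} {i : Fin m} (hi : i ∉ T) (j : Fin m) :
    wedgeSign (insert i T) j = wedgeSign T j * (if i < j then -1 else 1) := by
  rw [wedgeSign, wedgeSign, Finset.filter_insert]
  split_ifs with h
  · rw [Finset.card_insert_of_notMem (by simp [hi]), pow_succ]
  · simp

theorem wedgeSign_erase_self {m : ℕ} (T : Finset (Fin m)) (i : Fin m) :
    wedgeSign (T.erase i) i = wedgeSign T i := by
  by_cases hi : i ∈ T
  · rw [← wedgeSign_insert_self (T.erase i), Finset.insert_erase hi]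
  · rw [Finset.erase_eq_of_notMem hi]

theorem wedgeSign_erase {m : ℕ} {T : Finset (Fin m)} {i : Fin m} (hi : i ∈ T) (j : Fin m) :
    wedgeSign (T.erase i) j = wedgeSign T j * (if i < j then -1 else 1) := by
  have := wedgeSign_insert (Finset.notMem_erase i T) j
  rw [Finset.insert_erase hi] at this
  rw [this]; split_ifs <;> simp

section Operators

variable {R : Type*} [Ring R] {m : ℕ}

/-- Right multiplication of the coefficients by `r`. -/
def rightMul (r : R) : Module.End R (Finset (Fin m) → R) where
  toFun x T := x T * r
  map_add' x y := by ext T; simp [add_mul]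
  map_smul' a x := by ext T; simp [mul_assoc]

/-- The contraction `ι_i` of the exterior algebra. -/
def contract (R : Type*) [Ring R] {m : ℕ} (i : Fin m) : Module.End R (Finset (Fin m) → R) where
  toFun x T := if i ∈ T then 0 else wedgeSign T i • x (insert i T)
  map_add' x y := by ext T; simp only [Pi.add_apply]; split_ifs <;> simp
  map_smul' a x := by
    ext T; simp only [Pi.smul_apply]; split_ifs <;> simp [-zsmul_eq_mul]

/-- The exterior multiplication by the `k`-th basis vector. -/
def extMul (R : Type*) [Ring R] {m : ℕ} (k : Fin m) : Module.End R (Finset (Fin m) → R) where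
  toFun x T := if k ∈ T then wedgeSign T k • x (T.erase k) else 0
  map_add' x y := by ext T; simp only [Pi.add_apply]; split_ifs <;> simp
  map_smul' a x := by
    ext T; simp only [Pi.smul_apply]; split_ifs <;> simp [-zsmul_eq_mul]

theorem rightMul_apply (r : R) (x : Finset (Fin m) → R) (T : Finset (Fin m)) :
    rightMul r x T = x T * r := rfl

theorem contract_apply (i : Fin m) (x : Finset (Fin m) → R) (T : Finset (Fin m)) :
    contract R i x T = if i ∈ T then 0 else wedgeSign T i • x (insert i T) := rfl

theorem extMul_apply (k : Fin m) (x : Finset (Fin m) → R) (T : Finset (Fin m)) :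
    extMul R k x T = if k ∈ T then wedgeSign T k • x (T.erase k) else 0 := rfl

theorem rightMul_mul (r s : R) :
    (rightMul (r * s) : Module.End R (Finset (Fin m) → R)) = rightMul s * rightMul r := by
  ext x T; simp [rightMul_apply, mul_assoc]

theorem rightMul_sub (r s : R) :
    (rightMul (r - s) : Module.End R (Finset (Fin m) → R)) = rightMul r - rightMul s := by
  ext x T; simp [rightMul_apply, mul_sub]

theorem rightMul_add (r s : R) :
    (rightMul (r + s) : Module.End R (Finset (Fin m) → R)) = rightMul r + rightMul s := by
  ext x T; simp [rightMul_apply, mul_add]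

theorem rightMul_zero : (rightMul 0 : Module.End R (Finset (Fin m) → R)) = 0 := by
  ext x T; simp [rightMul_apply]

theorem rightMul_neg (r : R) :
    (rightMul (-r) : Module.End R (Finset (Fin m) → R)) = -rightMul r := by
  ext x T; simp [rightMul_apply]

theorem rightMul_sum {κ : Type*} (s : Finset κ) (f : κ → R) :
    (rightMul (∑ k ∈ s, f k) : Module.End R (Finset (Fin m) → R)) = ∑ k ∈ s, rightMul (f k) := by
  ext x T; simp [rightMul_apply, Finset.mul_sum]

theorem rightMul_mul_contract (r : R) (i : Fin m) :
    rightMul r * contract R i = contract R i * rightMul r := by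
  refine LinearMap.ext fun x => funext fun T => ?_
  simp only [Module.End.mul_apply, rightMul_apply, contract_apply]
  split_ifs <;> simp [-zsmul_eq_mul]

theorem rightMul_mul_extMul (r : R) (i : Fin m) :
    rightMul r * extMul R i = extMul R i * rightMul r := by
  refine LinearMap.ext fun x => funext fun T => ?_
  simp only [Module.End.mul_apply, rightMul_apply, extMul_apply]
  split_ifs <;> simp [-zsmul_eq_mul]

theorem contract_mul_contract (i j : Fin m) :
    contract R i * contract R j = -(contract R j * contract R i) := by
  refine LinearMap.ext fun x => funext fun T => ?_
  simp only [Module.End.mul_apply, LinearMap.neg_apply, Pi.neg_apply, contract_apply]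
  by_cases hij : i = j
  · subst hij; simp
  by_cases hi : i ∈ T
  · simp [hi]
  by_cases hj : j ∈ T
  · simp [hj]
  have hij' : j ≠ i := fun h => hij h.symm
  simp only [hi, hj, hij, hij', Finset.mem_insert, or_self, if_false, smul_smul]
  rw [wedgeSign_insert hi, wedgeSign_insert hj, Finset.insert_comm i j, ← neg_smul]
  congr 1
  rcases lt_or_gt_of_ne hij with h | h <;> simp [h, h.not_gt] <;> ring

theorem extMul_mul_extMul (i j : Fin m) :
    extMul R i * extMul R j = -(extMul R j * extMul R i) := by
  refine LinearMap.ext fun x => funext fun T => ?_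
  simp only [Module.End.mul_apply, LinearMap.neg_apply, Pi.neg_apply, extMul_apply]
  by_cases hij : i = j
  · subst hij; simp
  by_cases hi : i ∈ T
  swap
  · simp [hi]
  by_cases hj : j ∈ T
  swap
  · simp [hj]
  have hij' : j ≠ i := fun h => hij h.symm
  simp only [hi, hj, Finset.mem_erase, hij, hij', ne_eq, not_false_eq_true, true_and, if_true,
    smul_smul]
  rw [wedgeSign_erase hi, wedgeSign_erase hj, Finset.erase_right_comm, ← neg_smul]
  congr 1
  rcases lt_or_gt_of_ne hij with h | h <;> simp [h, h.not_gt] <;> ring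

theorem contract_mul_extMul (i k : Fin m) :
    contract R i * extMul R k = (if i = k then 1 else 0) - extMul R k * contract R i := by
  refine LinearMap.ext fun x => funext fun T => ?_
  by_cases hik : i = k
  · subst hik
    rw [if_pos rfl]
    simp only [Module.End.mul_apply, LinearMap.sub_apply, Pi.sub_apply, Module.End.one_apply,
      contract_apply, extMul_apply]
    by_cases hi : i ∈ T
    · simp only [hi, if_true, Finset.notMem_erase, if_false, smul_smul, wedgeSign_erase_self,
        wedgeSign_mul_self, Finset.insert_erase hi]
      simp
    · simp [-zsmul_eq_mul, hi, smul_smul, wedgeSign_insert_self, wedgeSign_mul_self]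
  · rw [if_neg hik]
    simp only [Module.End.mul_apply, LinearMap.sub_apply, Pi.sub_apply, LinearMap.zero_apply,
      Pi.zero_apply, contract_apply, extMul_apply]
    have hki : k ≠ i := fun h => hik h.symm
    by_cases hi : i ∈ T
    · simp [hi, hik]
    by_cases hk : k ∈ T
    · simp only [hi, hk, Finset.mem_insert, Finset.mem_erase, hki, if_true, if_false, or_true,
        and_false, smul_smul, zero_sub]
      rw [wedgeSign_insert hi, wedgeSign_erase hk, Finset.erase_insert_of_ne hik, ← neg_smul]
      congr 1
      rcases lt_or_gt_of_ne hik with h | h <;> simp [h, h.not_gt] <;> ring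
    · simp [hi, hk, hki]

/-- The differential `∑ rᵢ ιᵢ + ∑_{i<j} cᵢⱼᵏ eₖ ιᵢ ιⱼ` on the sum of all terms of the Spencer
complex. -/
def totalD (r : Fin m → R) (c : Fin m → Fin m → Fin m → R) : Module.End R (Finset (Fin m) → R) :=
  ∑ i, rightMul (r i) * contract R i +
    ∑ i, ∑ j ∈ Finset.univ.filter (i < ·), ∑ k,
      rightMul (c i j k) * extMul R k * contract R i * contract R j

/-- Since the differential is left linear, the `r i` and `c i j k` act by right multiplication,
which reverses products. This explains the order of the factors in the hypotheses of
`brst_sq_eq_zero`. -/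
theorem totalD_mul_self (htors : ∀ x : R, (24 : ℕ) • x = 0 → x = 0)
    (r : Fin m → R) (c : Fin m → Fin m → Fin m → R)
    (hcc : ∀ i j k a b d, c i j k * c a b d = c a b d * c i j k)
    (hanti : ∀ i j k, c i j k = -c j i k)
    (hbr : ∀ i j, r i * r j - r j * r i = ∑ k, c i j k * r k)
    (hjac : ∀ l i j k,
      (r l * c i j k - c i j k * r l + ∑ a, c i j a * c l a k) +
      (r i * c j l k - c j l k * r i + ∑ a, c j l a * c i a k) +
      (r j * c l i k - c l i k * r j + ∑ a, c l i a * c j a k) = 0) :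
    totalD r c * totalD r c = 0 := by
  set T : Fin m → Fin m → Fin m → Fin m → R := fun l i j k =>
    r l * c i j k - c i j k * r l + ∑ a, c i j a * c l a k with hT
  refine brst_sq_eq_zero (fun i => rightMul (r i)) (contract R) (extMul R)
    (fun i j k => rightMul (c i j k)) ?_ (fun i j => rightMul_mul_contract _ _)
    (fun i j => rightMul_mul_extMul _ _) (fun i j k l => rightMul_mul_contract _ _)
    (fun i j k l => rightMul_mul_extMul _ _)
    (fun i j k a b d => by rw [← rightMul_mul, hcc, rightMul_mul])
    contract_mul_contract extMul_mul_extMul contract_mul_extMul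
    (fun i j => by simp only [← rightMul_mul, ← rightMul_sub, hbr, rightMul_sum])
    (fun i j k => by rw [hanti, rightMul_neg])
    (fun l i j k => rightMul (T l i j k)) (fun l i j k => ?_)
    (fun l i j k => by rw [← rightMul_add, ← rightMul_add, hT]; simp only [hjac, rightMul_zero])
    _ ?_
  · intro x hx
    refine LinearMap.ext fun y => funext fun S => htors _ ?_
    exact congrFun (LinearMap.congr_fun hx y) S
  · simp only [hT, rightMul_add, rightMul_sub, rightMul_mul, rightMul_sum]
    congr 1
    refine Finset.sum_congr rfl fun a _ => ?_
    rw [← rightMul_mul, hcc, rightMul_mul]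
  · rw [totalD, mul_add]
    congr 1
    set F : Fin m → Fin m → Module.End R (Finset (Fin m) → R) := fun i j =>
      ∑ k, rightMul (c i j k) * extMul R k * contract R i * contract R j with hF
    -- Both the coefficients and the products of contractions are antisymmetric. Hence twice the sum
    -- over `i < j` is the full double sum that `brst_sq_eq_zero` expects.
    have hsymm : ∀ i j, F i j = F j i := by
      intro i j
      simp only [hF]
      refine Finset.sum_congr rfl fun k _ => ?_
      have key : ∀ {E : Type _} [Ring E] (a b c d : E), -a * b * -(c * d) = a * b * c * d := by
        intros; noncomm_ring
      rw [mul_assoc, contract_mul_contract, hanti, rightMul_neg]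
      exact key _ _ _ _
    have hdiag : ∀ i, F i i = 0 := by
      intro i
      simp only [hF]
      refine Finset.sum_eq_zero fun k _ => ?_
      have : contract R i * contract R i = 0 := by
        refine LinearMap.ext fun x => funext fun T => ?_
        simp [contract_apply]
      rw [mul_assoc, this, mul_zero]
    change 2 * ∑ i, ∑ j ∈ Finset.univ.filter (i < ·), F i j = ∑ i, ∑ j, F i j
    have hsplit : ∀ i, ∑ j, F i j = ∑ j ∈ Finset.univ.filter (i < ·), F i j +
        ∑ j ∈ Finset.univ.filter (· < i), F i j := by
      intro i
      simp only [Finset.sum_filter, ← Finset.sum_add_distrib]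
      refine Finset.sum_congr rfl fun j _ => ?_
      rcases lt_trichotomy i j with h | h | h
      · simp [h, h.not_gt]
      · subst h; simp [hdiag]
      · simp [h, h.not_gt]
    simp only [hsplit, Finset.sum_add_distrib, two_mul]
    congr 1
    simp only [Finset.sum_filter]
    rw [Finset.sum_comm]
    exact Finset.sum_congr rfl fun i _ => Finset.sum_congr rfl fun j _ => by rw [hsymm]

/-- A term of the Spencer complex as a subspace of the sum of all terms. -/
def spencerEmb (R : Type*) [Ring R] (m e : ℕ) : Spencer R m e →ₗ[R] (Finset (Fin m) → R) where
  toFun x S := if h : S.card = e then x ⟨S, h⟩ else 0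
  map_add' x y := by ext S; simp only [Pi.add_apply]; split_ifs <;> simp
  map_smul' a x := by ext S; simp only [Pi.smul_apply]; split_ifs <;> simp

theorem spencerEmb_apply {e : ℕ} (x : Spencer R m e) (S : Finset (Fin m)) :
    spencerEmb R m e x S = if h : S.card = e then x ⟨S, h⟩ else 0 := rfl

theorem spencerEmb_injective (e : ℕ) : Function.Injective (spencerEmb R m e) := by
  intro x y h
  ext ⟨S, hS⟩
  simpa [spencerEmb_apply, hS] using congrFun h S

theorem exists_spencerEmb_eq {e : ℕ} {y : Finset (Fin m) → R} (hy : ∀ S, S.card ≠ e → y S = 0) :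
    ∃ x, spencerEmb R m e x = y := by
  refine ⟨Finsupp.equivFunOnFinite.symm fun S => y S.1, funext fun S => ?_⟩
  rw [spencerEmb_apply]
  split_ifs with h
  · rfl
  · exact (hy S h).symm

theorem spencerEmb_wedgeBasis {e : ℕ} {S : Finset (Fin m)} (hS : S.card = e) :
    spencerEmb R m e (wedgeBasis R e S) = Pi.single S 1 := by
  funext T
  rw [spencerEmb_apply, wedgeBasis, dif_pos hS]
  by_cases h : T = S
  · subst h; simp [hS]
  · have : (⟨S, hS⟩ : {S : Finset (Fin m) // S.card = e}).1 ≠ T := fun h' => h h'.symm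
    rw [Pi.single_eq_of_ne h]
    split_ifs with h2
    · rw [Finsupp.single_apply, if_neg]
      exact fun h' => h (congrArg Subtype.val h').symm
    · rfl

theorem contract_single (i : Fin m) (S : Finset (Fin m)) :
    contract R i (Pi.single S 1) =
      if i ∈ S then wedgeSign S i • Pi.single (S.erase i) (1 : R) else 0 := by
  funext T
  rw [contract_apply]
  by_cases hi : i ∈ S
  · rw [if_pos hi]
    by_cases hT : T = S.erase i
    · subst hT
      simp [Finset.insert_erase hi, wedgeSign_erase_self]
    · rw [Pi.smul_apply, Pi.single_eq_of_ne hT, smul_zero]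
      split_ifs with h
      · rfl
      · rw [Pi.single_eq_of_ne, smul_zero]
        rintro rfl
        exact hT (Finset.erase_insert h).symm
  · rw [if_neg hi]
    split_ifs with h
    · rfl
    · rw [Pi.single_eq_of_ne, smul_zero, Pi.zero_apply]
      rintro rfl
      exact hi (Finset.mem_insert_self _ _)

theorem extMul_single (k : Fin m) (S : Finset (Fin m)) :
    extMul R k (Pi.single S 1) =
      if k ∈ S then 0 else wedgeSign S k • Pi.single (insert k S) (1 : R) := by
  funext T
  rw [extMul_apply]
  by_cases hk : k ∈ S
  · rw [if_pos hk]
    split_ifs with h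
    · rw [Pi.single_eq_of_ne, smul_zero, Pi.zero_apply]
      rintro rfl
      exact Finset.notMem_erase _ _ hk
    · rfl
  · rw [if_neg hk]
    by_cases hT : T = insert k S
    · subst hT
      simp [Finset.erase_insert hk, wedgeSign_insert_self]
    · rw [Pi.smul_apply, Pi.single_eq_of_ne hT, smul_zero]
      split_ifs with h
      · rw [Pi.single_eq_of_ne, smul_zero]
        rintro rfl
        exact hT (Finset.insert_erase h).symm
      · rfl

theorem spencerEmb_wedgeInsert {e : ℕ} (k : Fin m) {S : Finset (Fin m)} (hS : S.card + 1 = e) :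
    spencerEmb R m e (wedgeInsert R e k S) = extMul R k (Pi.single S 1) := by
  rw [extMul_single, wedgeInsert]
  split_ifs with h
  · simp
  · rw [map_zsmul, spencerEmb_wedgeBasis]
    rw [Finset.card_insert_of_notMem h, hS]

theorem rightMul_single (r : R) (S : Finset (Fin m)) :
    rightMul r (Pi.single S 1) = r • Pi.single S (1 : R) := by
  funext T
  rw [rightMul_apply, Pi.smul_apply]
  by_cases h : T = S
  · subst h; simp
  · simp [Pi.single_eq_of_ne h]

/-- The bridge between the differential prescribed on the basis `r_S` and the operator `totalD`, for
which the relation `d² = 0` and the Koszul argument are available. -/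
theorem spencerEmb_spencerD {A : Type*} [CommRing A] {ι : A →+* R} {r : Fin m → R}
    (hr : IsLieRinehartFamily ι r) (e : ℕ) (x : Spencer R m (e + 1)) :
    spencerEmb R m e (spencerD hr e x) =
      totalD r (fun i j k => ι (structureConst hr i j k)) (spencerEmb R m (e + 1) x) := by
  rw [← LinearMap.comp_apply, ← LinearMap.comp_apply]
  congr 1
  refine Finsupp.lhom_ext' fun ⟨S, hS⟩ => LinearMap.ext_ring ?_
  have hb : Finsupp.single (⟨S, hS⟩ : {S : Finset (Fin m) // S.card = e + 1}) (1 : R) =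
      wedgeBasis R (e + 1) S := by rw [wedgeBasis, dif_pos hS]
  simp only [LinearMap.comp_apply, Finsupp.lsingle_apply]
  rw [spencerD, Finsupp.linearCombination_single, one_smul, hb, spencerEmb_wedgeBasis hS]
  simp only [totalD, LinearMap.add_apply, LinearMap.sum_apply, Module.End.mul_apply, map_add,
    map_sum]
  congr 1
  · rw [← Finset.sum_subset (Finset.subset_univ S)]
    · refine Finset.sum_congr rfl fun i hi => ?_
      rw [contract_single, if_pos hi, map_zsmul, map_zsmul, map_smul, spencerEmb_wedgeBasis,
        rightMul_single]
      rw [Finset.card_erase_of_mem hi, hS]; rfl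
    · intro i _ hi
      rw [contract_single, if_neg hi, map_zero]
  · rw [← Finset.sum_subset (Finset.subset_univ S)]
    · refine Finset.sum_congr rfl fun i hi => ?_
      simp only [Finset.sum_filter]
      rw [← Finset.sum_subset (Finset.subset_univ S)]
      · refine Finset.sum_congr rfl fun j hj => ?_
        split_ifs with hij
        · rw [map_zsmul, map_sum, Finset.smul_sum]
          refine Finset.sum_congr rfl fun k _ => ?_
          have hi' : i ∈ S.erase j := Finset.mem_erase.2 ⟨hij.ne, hi⟩
          have hj' : j ∈ S.erase i := Finset.mem_erase.2 ⟨hij.ne', hj⟩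
          -- The larger index `j` is removed first, which does not change the sign of `i`; the total
          -- sign is therefore the product of the two signs in `S`.
          rw [map_smul, spencerEmb_wedgeInsert, contract_single, if_pos hj, map_zsmul,
            contract_single, if_pos hi', wedgeSign_erase hj, if_neg hij.not_gt, mul_one,
            smul_smul, map_zsmul, map_zsmul, mul_comm, Finset.erase_right_comm]
          · congr 1
            rw [← Module.End.mul_apply, rightMul_mul_extMul, Module.End.mul_apply, rightMul_single,
              map_smul]
          · rw [Finset.card_erase_of_mem hj', Finset.card_erase_of_mem hi, hS]
            have := Finset.card_pos.2 ⟨j, hj'⟩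
            rw [Finset.card_erase_of_mem hi, hS] at this
            omega
        · rfl
      · intro j _ hj
        split_ifs
        · refine Finset.sum_eq_zero fun k _ => ?_
          rw [contract_single, if_neg hj, map_zero, map_zero, map_zero]
        · rfl
    · intro i _ hi
      refine Finset.sum_eq_zero fun j _ => Finset.sum_eq_zero fun k _ => ?_
      rw [contract_single]
      split_ifs with hj
      · rw [map_zsmul, contract_single, if_neg]
        · simp
        · exact fun h => hi (Finset.mem_of_mem_erase h)
      · simp

end Operators

/-! ### Exactness of the Koszul complex of a regular sequence -/

/-- Each `fᵢ` is a nonzerodivisor modulo the preceding elements. -/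
def IsWeaklyRegularFamily {G : Type*} [CommRing G] {m : ℕ} (f : Fin m → G) : Prop :=
  ∀ i x, f i * x ∈ Ideal.span (f '' Set.Iio i) → x ∈ Ideal.span (f '' Set.Iio i)

section Koszul

variable {G : Type*} [CommRing G] {m : ℕ}

theorem totalD_zero (f : Fin m → G) : totalD f 0 = ∑ i, rightMul (f i) * contract G i := by
  simp [totalD, rightMul_zero]

theorem totalD_zero_apply (f : Fin m → G) (x : Finset (Fin m) → G) (T : Finset (Fin m)) :
    totalD f 0 x T = ∑ i, if i ∈ T then 0 else wedgeSign T i • x (insert i T) * f i := by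
  rw [totalD_zero]
  simp only [LinearMap.sum_apply, Finset.sum_apply, Module.End.mul_apply, rightMul_apply,
    contract_apply]
  refine Finset.sum_congr rfl fun i _ => ?_
  split_ifs <;> simp

theorem totalD_zero_mul_self (htors : ∀ x : G, (24 : ℕ) • x = 0 → x = 0) (f : Fin m → G) :
    totalD f 0 * totalD f 0 = 0 :=
  totalD_mul_self htors f 0 (by simp) (by simp) (by simp [mul_comm]) (by simp)

theorem contract_mul_totalD_zero (f : Fin m → G) (q : Fin m) :
    contract G q * totalD f 0 = -(totalD f 0 * contract G q) := by
  rw [totalD_zero, Finset.mul_sum, Finset.sum_mul, ← Finset.sum_neg_distrib]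
  refine Finset.sum_congr rfl fun i _ => ?_
  have key : ∀ {E : Type _} [Ring E] (a b : E), a * -b = -(a * b) := fun a b => mul_neg a b
  rw [← mul_assoc, ← rightMul_mul_contract, mul_assoc, contract_mul_contract, mul_assoc]
  exact key _ _

/-- Exterior multiplication by the `q`-th vector is a homotopy between multiplication by `f q` and
zero. -/
theorem totalD_zero_mul_extMul (f : Fin m → G) (q : Fin m) :
    totalD f 0 * extMul G q = rightMul (f q) - extMul G q * totalD f 0 := by
  have : rightMul (f q) = ∑ i, rightMul (f i) * (if i = q then 1 else 0 :
      Module.End G (Finset (Fin m) → G)) := by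
    rw [Finset.sum_eq_single q]
    · simp
    · intro b _ hb; simp [hb]
    · simp
  rw [this, totalD_zero, Finset.mul_sum, Finset.sum_mul, ← Finset.sum_sub_distrib]
  refine Finset.sum_congr rfl fun i _ => ?_
  rw [mul_assoc, contract_mul_extMul, mul_sub, ← mul_assoc, ← mul_assoc, rightMul_mul_extMul]

/-- Induction on the number `j` of elements in use: chains are supported on subsets of the first `j`
indices. All positive exterior degrees are treated at once, and `x ∅ = 0` expresses that there is no
part of degree 0. The preimage is also kept without a part of degree 0, since in the induction step
a multiple of such a preimage must again satisfy this condition. -/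
theorem koszul_exact_aux (htors : ∀ x : G, (24 : ℕ) • x = 0 → x = 0) {f : Fin m → G}
    (hf : IsWeaklyRegularFamily f) (j : ℕ) (hj : j ≤ m) :
    ∀ x : Finset (Fin m) → G, (∀ S, ∀ i ∈ S, j ≤ i.val → x S = 0) → x ∅ = 0 →
      totalD f 0 x = 0 →
      ∃ y : Finset (Fin m) → G, (∀ S, ∀ i ∈ S, j ≤ i.val → y S = 0) ∧ y ∅ = 0 ∧
        totalD f 0 y = x := by
  induction j with
  | zero =>
    intro x hx h0 _
    refine ⟨0, by simp, rfl, ?_⟩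
    rw [map_zero]
    funext S
    rcases S.eq_empty_or_nonempty with rfl | ⟨i, hi⟩
    · exact h0.symm
    · exact (hx S i hi (Nat.zero_le _)).symm
  | succ j ih =>
    intro x hx h0 hdx
    have ih := ih (by omega)
    set κ := totalD f 0 with hκ
    set q : Fin m := ⟨j, hj⟩ with hq
    have hκκ : ∀ y, κ (κ y) = 0 := fun y =>
      LinearMap.congr_fun (totalD_zero_mul_self htors f) y
    set u := contract G q x with hu
    have huS : ∀ S, ∀ i ∈ S, j ≤ i.val → u S = 0 := by
      intro S i hi hij
      rw [hu, contract_apply]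
      split_ifs with hqS
      · rfl
      · rw [hx _ i (Finset.mem_insert_of_mem hi), smul_zero]
        refine Nat.lt_of_le_of_ne hij fun h => hqS ?_
        have : i = q := Fin.ext h.symm
        exact this ▸ hi
    have hκu : κ u = 0 := by
      have := LinearMap.congr_fun (contract_mul_totalD_zero f q) x
      rw [Module.End.mul_apply, hdx, map_zero] at this
      exact neg_eq_zero.1 this.symm
    have hκe : ∀ y, κ (extMul G q y) = rightMul (f q) y - extMul G q (κ y) := fun y =>
      LinearMap.congr_fun (totalD_zero_mul_extMul f q) y
    -- Decomposition `x = x' + e_q ∧ u` in which neither `x'` nor `u` involves the index `q`.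
    set x' := x - extMul G q u with hx'
    have hx'S : ∀ S, ∀ i ∈ S, j ≤ i.val → x' S = 0 := by
      intro S i hi hij
      rw [hx', Pi.sub_apply, extMul_apply]
      by_cases hqS : q ∈ S
      · rw [if_pos hqS, hu, contract_apply, if_neg (Finset.notMem_erase _ _),
          Finset.insert_erase hqS, smul_smul, wedgeSign_erase_self, wedgeSign_mul_self, one_smul,
          sub_self]
      · rw [if_neg hqS, sub_zero]
        refine hx S i hi (Nat.lt_of_le_of_ne hij fun h => hqS ?_)
        have : i = q := Fin.ext h.symm
        exact this ▸ hi
    have hx'0 : x' ∅ = 0 := by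
      rw [hx', Pi.sub_apply, extMul_apply, if_neg (Finset.notMem_empty _), h0, sub_zero]
    have hκx' : κ x' = -rightMul (f q) u := by
      rw [hx', map_sub, hdx, hκe, hκu, map_zero, sub_zero, zero_sub]
    -- The only place where regularity enters: the part of degree 0 of `κ x' = -f_q u` shows that
    -- `f_q u(∅)` lies in the ideal of the preceding elements.
    have hu0 : u ∅ ∈ Ideal.span (f '' Set.Iio q) := by
      refine hf q _ ?_
      have h1 := congrFun hκx' ∅
      rw [Pi.neg_apply, rightMul_apply, hκ, totalD_zero_apply] at h1
      rw [mul_comm, ← neg_mem_iff, ← h1]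
      refine sum_mem fun i _ => ?_
      rw [if_neg (Finset.notMem_empty _)]
      rcases lt_or_ge i q with hi | hi
      · exact Ideal.mul_mem_left _ _ (Ideal.subset_span ⟨i, hi, rfl⟩)
      · rw [hx'S _ i (Finset.mem_insert_self _ _) hi]; simp
    obtain ⟨a, ha, ha'⟩ := (Finsupp.mem_span_image_iff_linearCombination G).1 hu0
    have ha0 : ∀ i, q ≤ i → a i = 0 := by
      intro i hi
      by_contra h
      exact absurd ((Finsupp.mem_supported G a).1 ha (Finsupp.mem_support_iff.2 h)) (not_lt.2 hi)
    -- A chain of degree 1 whose boundary has the same value at `∅` as `u`, so that the induction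
    -- hypothesis applies to the difference.
    set α : Finset (Fin m) → G := ∑ i, a i • Pi.single {i} 1 with hα
    have hα0 : α ∅ = 0 := by
      rw [hα, Finset.sum_apply]
      refine Finset.sum_eq_zero fun i _ => ?_
      rw [Pi.smul_apply, Pi.single_eq_of_ne (Finset.singleton_ne_empty i).symm, smul_zero]
    have hαS : ∀ S, ∀ i ∈ S, j ≤ i.val → α S = 0 := by
      intro S i hi hij
      rw [hα, Finset.sum_apply]
      refine Finset.sum_eq_zero fun k _ => ?_
      rw [Pi.smul_apply]
      by_cases hS : S = {k}
      · subst hS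
        rw [Finset.mem_singleton] at hi
        subst hi
        rw [ha0 _ hij, zero_smul]
      · rw [Pi.single_eq_of_ne hS, smul_zero]
    have hκα : κ α ∅ = u ∅ := by
      rw [hκ, totalD_zero_apply, ← ha', Finsupp.linearCombination_apply, Finsupp.sum_fintype _ _
        (by simp)]
      refine Finset.sum_congr rfl fun i _ => ?_
      rw [if_neg (Finset.notMem_empty _), insert_empty_eq, hα, Finset.sum_apply,
        Finset.sum_eq_single i]
      · simp [wedgeSign]
      · intro k _ hk
        rw [Pi.smul_apply, Pi.single_eq_of_ne, smul_zero]
        exact fun h => hk (Finset.singleton_injective h).symm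
      · simp
    have hκS : ∀ y : Finset (Fin m) → G, (∀ S, ∀ i ∈ S, j ≤ i.val → y S = 0) →
        ∀ S, ∀ i ∈ S, j ≤ i.val → κ y S = 0 := by
      intro y hy S i hi hij
      rw [hκ, totalD_zero_apply]
      refine Finset.sum_eq_zero fun k _ => ?_
      rw [hy _ i (Finset.mem_insert_of_mem hi) hij]
      simp
    obtain ⟨w, hwS, hw0, hw⟩ := ih (u - κ α)
      (fun S i hi hij => by rw [Pi.sub_apply, huS S i hi hij, hκS α hαS S i hi hij, sub_zero])
      (by rw [Pi.sub_apply, hκα, sub_self])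
      (by rw [map_sub, hκu, hκκ, sub_zero])
    set y := w + α with hy
    have hyS : ∀ S, ∀ i ∈ S, j ≤ i.val → y S = 0 := fun S i hi hij => by
      rw [hy, Pi.add_apply, hwS S i hi hij, hαS S i hi hij, add_zero]
    have hy0 : y ∅ = 0 := by rw [hy, Pi.add_apply, hw0, hα0, add_zero]
    have hκy : κ y = u := by rw [hy, map_add, hw, sub_add_cancel]
    -- Since `κ y = u`, adding the boundary of `e_q ∧ y` removes the index `q` from `x`.
    have hxy : x + κ (extMul G q y) = x' + rightMul (f q) y := by
      rw [hκe, hκy, hx']; abel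
    obtain ⟨v, hvS, hv0, hv⟩ := ih (x + κ (extMul G q y))
      (fun S i hi hij => by
        rw [hxy, Pi.add_apply, hx'S S i hi hij, rightMul_apply, hyS S i hi hij, zero_mul, add_zero])
      (by rw [hxy, Pi.add_apply, hx'0, rightMul_apply, hy0, zero_mul, add_zero])
      (by rw [map_add, hdx, hκκ, add_zero])
    refine ⟨v - extMul G q y, fun S i hi hij => ?_, ?_, ?_⟩
    · rw [Pi.sub_apply, hvS S i hi (by omega), extMul_apply]
      split_ifs with hqS
      · rw [hyS _ i _ (by omega), smul_zero, sub_zero]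
        refine Finset.mem_erase.2 ⟨?_, hi⟩
        rintro rfl
        exact absurd hij (by simp [hq])
      · exact sub_zero _
    · rw [Pi.sub_apply, hv0, extMul_apply, if_neg (Finset.notMem_empty _), sub_zero]
    · rw [map_sub, hv, add_sub_cancel_right]

theorem koszul_exact (htors : ∀ x : G, (24 : ℕ) • x = 0 → x = 0) {f : Fin m → G}
    (hf : IsWeaklyRegularFamily f) {x : Finset (Fin m) → G} (h0 : x ∅ = 0)
    (hx : totalD f 0 x = 0) : ∃ y, totalD f 0 y = x := by
  obtain ⟨y, -, -, hy⟩ := koszul_exact_aux htors hf m le_rfl x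
    (fun S i _ hi => absurd i.isLt (not_lt.2 hi)) h0 hx
  exact ⟨y, hy⟩

end Koszul

/-! ### The normal form of a differential operator -/

section NormalForm

variable {N : ℕ}

theorem Finsupp.nat_induction_single {τ : Type*} {motive : (τ →₀ ℕ) → Prop} (zero : motive 0)
    (add_single : ∀ β o, motive β → motive (β + Finsupp.single o 1)) (β : τ →₀ ℕ) : motive β := by
  classical
  induction h : β.degree generalizing β with
  | zero => rw [(Finsupp.degree_eq_zero_iff β).1 h]; exact zero
  | succ k ih =>
    have hne : β ≠ 0 := by rintro rfl; simp at h
    obtain ⟨o, ho⟩ := Finsupp.ne_iff.1 hne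
    have hle : Finsupp.single o 1 ≤ β := by
      rw [Finsupp.single_le_iff]; exact Nat.one_le_iff_ne_zero.2 ho
    have hβ := tsub_add_cancel_of_le hle
    rw [← hβ]
    refine add_single _ _ (ih _ ?_)
    rw [← hβ, map_add, Finsupp.degree_single] at h
    omega

theorem List.prod_ofFn_eq_mul {M : Type*} [Monoid M] {K : ℕ} (f g : Fin K → M) (k : Fin K) (a : M)
    (hk : g k = a * f k) (hne : ∀ i, i ≠ k → g i = f i) (ha : ∀ i, a * f i = f i * a) :
    (List.ofFn g).prod = a * (List.ofFn f).prod := by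
  induction K with
  | zero => exact k.elim0
  | succ K ih =>
    rw [List.ofFn_succ, List.ofFn_succ, List.prod_cons, List.prod_cons]
    refine Fin.cases ?_ (fun k => ?_) k (motive := fun k => g k = a * f k →
      (∀ i, i ≠ k → g i = f i) → _) hk hne
    · intro hk hne
      rw [hk, mul_assoc]
      congr 3
      exact List.ofFn_inj.2 (funext fun i => hne _ (Fin.succ_ne_zero i))
    · intro hk hne
      rw [ih (fun i => f i.succ) (fun i => g i.succ) k hk
        (fun i hi => hne _ fun h => hi (Fin.succ_injective _ h)) (fun i => ha _),
        hne 0 (Fin.succ_ne_zero k).symm, ← mul_assoc, ← ha, mul_assoc]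

theorem WeylAlg.ext_apply {P Q : WeylAlg N} (h : ∀ f, P.1 f = Q.1 f) : P = Q :=
  Subtype.ext (LinearMap.ext h)

theorem mulOp_apply (a f : MvPolynomial (Fin N) ℂ) : (mulOp N a).1 f = a * f := rfl

theorem partialOp_apply (i : Fin N) (f : MvPolynomial (Fin N) ℂ) :
    (partialOp i).1 f = pderiv i f := rfl

theorem WeylAlg.mul_apply (P Q : WeylAlg N) (f : MvPolynomial (Fin N) ℂ) :
    (P * Q).1 f = P.1 (Q.1 f) := rfl

theorem WeylAlg.add_apply (P Q : WeylAlg N) (f : MvPolynomial (Fin N) ℂ) :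
    (P + Q).1 f = P.1 f + Q.1 f := rfl

theorem WeylAlg.induction {motive : WeylAlg N → Prop} (mulOp : ∀ f, motive (mulOp N f))
    (partialOp : ∀ i, motive (partialOp i)) (add : ∀ P Q, motive P → motive Q → motive (P + Q))
    (mul : ∀ P Q, motive P → motive Q → motive (P * Q)) (P : WeylAlg N) : motive P := by
  obtain ⟨w, hw⟩ := P
  refine Algebra.adjoin_induction (p := fun x hx => motive (⟨x, hx⟩ : weylSubalgebra N))
    ?_ ?_ ?_ ?_ hw
  · rintro _ (⟨f, rfl⟩ | ⟨i, rfl⟩)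
    · exact mulOp f
    · exact partialOp i
  · intro c
    have h := mulOp (C c)
    have e : (⟨algebraMap ℂ (Module.End ℂ (MvPolynomial (Fin N) ℂ)) c, algebraMap_mem _ c⟩ :
        WeylAlg N) = _root_.mulOp N (C c) := WeylAlg.ext_apply fun f => smul_eq_C_mul f c
    exact e ▸ h
  · exact fun x y hx hy h1 h2 => add _ _ h1 h2
  · exact fun x y hx hy h1 h2 => mul _ _ h1 h2

theorem mulOp_injective : Function.Injective (mulOp N) := by
  intro a b h
  have : (mulOp N a).1 1 = (mulOp N b).1 1 := by rw [h]
  simpa [mulOp_apply] using this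

theorem partialOp_mul_mulOp (i : Fin N) (a : MvPolynomial (Fin N) ℂ) :
    partialOp i * mulOp N a = mulOp N a * partialOp i + mulOp N (pderiv i a) := by
  refine WeylAlg.ext_apply fun f => ?_
  simp only [WeylAlg.mul_apply, WeylAlg.add_apply, mulOp_apply, partialOp_apply, pderiv_mul]
  ring

theorem partialOp_comm (i j : Fin N) :
    (partialOp i * partialOp j : WeylAlg N) = partialOp j * partialOp i := by
  refine WeylAlg.ext_apply fun f => ?_
  simp only [WeylAlg.mul_apply, partialOp_apply]
  have h : ⁅(pderiv i : Derivation ℂ (MvPolynomial (Fin N) ℂ) (MvPolynomial (Fin N) ℂ)),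
      (pderiv j : Derivation ℂ (MvPolynomial (Fin N) ℂ) (MvPolynomial (Fin N) ℂ))⁆ = 0 := by
    refine derivation_ext fun k => ?_
    rw [Derivation.commutator_apply, pderiv_X, pderiv_X]
    by_cases h1 : j = k <;> by_cases h2 : i = k <;> simp [h1, h2]
  have := DFunLike.congr_fun h f
  rwa [Derivation.commutator_apply, Derivation.zero_apply, sub_eq_zero] at this

/-- The generators `∂_i` and `s`. -/
def genOp : Option (Fin N) → WeylAlgS N
  | none => Polynomial.X
  | some i => Polynomial.C (partialOp i)

theorem genOp_mul_coeffOp (o : Option (Fin N)) (a : MvPolynomial (Fin N) ℂ) :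
    ∃ b, genOp o * coeffOp N a = coeffOp N a * genOp o + coeffOp N b := by
  cases o with
  | none => exact ⟨0, by simp [genOp, coeffOp, Polynomial.X_mul_C]⟩
  | some i =>
    refine ⟨pderiv i a, ?_⟩
    simp only [genOp, coeffOp, RingHom.comp_apply, ← Polynomial.C_mul, ← Polynomial.C_add,
      partialOp_mul_mulOp]

theorem genOp_mul_coeffOp_X (o : Option (Fin N)) (i : Fin N) :
    genOp o * coeffOp N (X i) = coeffOp N (X i) * genOp o + if o = some i then 1 else 0 := by
  cases o with
  | none => simp [genOp, coeffOp, Polynomial.X_mul_C]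
  | some j =>
    simp only [genOp, coeffOp, RingHom.comp_apply, ← Polynomial.C_mul, partialOp_mul_mulOp,
      Polynomial.C_add, pderiv_X, Option.some.injEq]
    by_cases h : j = i
    · subst h; simp
    · have h' : i ≠ j := fun e => h e.symm
      simp [h, h']

theorem monomialOp_zero : monomialOp (0 : Option (Fin N) →₀ ℕ) = 1 := by
  simp [monomialOp]

theorem monomialOp_add_single (β : Option (Fin N) →₀ ℕ) (o : Option (Fin N)) :
    monomialOp (β + Finsupp.single o 1) = genOp o * monomialOp β := by
  cases o with
  | none =>
    have : ∀ i : Fin N, (β + (Finsupp.single none 1 : Option (Fin N) →₀ ℕ)) (some i) =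
        β (some i) := by intro i; simp
    have hn : (β + (Finsupp.single none 1 : Option (Fin N) →₀ ℕ)) none = β none + 1 := by simp
    simp only [monomialOp, genOp, this, hn]
    rw [pow_succ', ← mul_assoc, ← mul_assoc, Polynomial.X_mul_C]
  | some i =>
    have hn : (β + (Finsupp.single (some i) 1 : Option (Fin N) →₀ ℕ)) none = β none := by simp
    simp only [monomialOp, genOp, hn]
    rw [← mul_assoc, ← Polynomial.C_mul]
    congr 2
    refine List.prod_ofFn_eq_mul _ _ i _ ?_ ?_ ?_
    · simp [pow_succ']
    · intro j hj
      have : some i ≠ some j := fun h => hj (Option.some_injective _ h).symm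
      simp [this]
    · intro j
      exact (Commute.pow_right (partialOp_comm i j) _)

theorem normalOp_eq_sum (p : GrS N) {s : Finset (Option (Fin N) →₀ ℕ)} (hs : p.support ⊆ s) :
    normalOp p = ∑ β ∈ s, coeffOp N (p.coeff β) * monomialOp β := by
  refine Finset.sum_subset hs fun β _ hβ => ?_
  rw [notMem_support_iff.1 hβ, map_zero, zero_mul]

theorem normalOp_add (p q : GrS N) : normalOp (p + q) = normalOp p + normalOp q := by
  classical
  rw [normalOp_eq_sum (p + q) support_add, normalOp_eq_sum p Finset.subset_union_left,
    normalOp_eq_sum q Finset.subset_union_right, ← Finset.sum_add_distrib]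
  refine Finset.sum_congr rfl fun β _ => ?_
  rw [coeff_add, map_add, add_mul]

/-- `normalOp` as a homomorphism of groups. -/
def normalHom (N : ℕ) : GrS N →+ WeylAlgS N where
  toFun := normalOp
  map_zero' := by simp [normalOp]
  map_add' := normalOp_add

theorem normalHom_apply (p : GrS N) : normalHom N p = normalOp p := rfl

theorem normalHom_C_mul (a : MvPolynomial (Fin N) ℂ) (p : GrS N) :
    normalHom N (C a * p) = coeffOp N a * normalHom N p := by
  have hs : (C a * p).support ⊆ p.support := by
    intro β hβ
    rw [mem_support_iff, coeff_C_mul] at hβ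
    exact mem_support_iff.2 fun h => hβ (by rw [h, mul_zero])
  rw [normalHom_apply, normalHom_apply, normalOp_eq_sum _ hs, normalOp, Finset.mul_sum]
  refine Finset.sum_congr rfl fun β _ => ?_
  rw [coeff_C_mul, map_mul, mul_assoc]

theorem normalHom_monomial (β : Option (Fin N) →₀ ℕ) (a : MvPolynomial (Fin N) ℂ) :
    normalHom N (monomial β a) = coeffOp N a * monomialOp β := by
  rw [normalHom_apply, normalOp_eq_sum _ support_monomial_subset, Finset.sum_singleton,
    coeff_monomial, if_pos rfl]

theorem normalHom_C (a : MvPolynomial (Fin N) ℂ) : normalHom N (C a) = coeffOp N a := by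
  have := normalHom_monomial (0 : Option (Fin N) →₀ ℕ) a
  rwa [monomialOp_zero, mul_one] at this

theorem normalHom_X (o : Option (Fin N)) : normalHom N (X o) = genOp o := by
  have := monomialOp_add_single (0 : Option (Fin N) →₀ ℕ) o
  rw [monomialOp_zero, mul_one, zero_add] at this
  rw [X, normalHom_monomial, this, map_one, one_mul]

/-- The elements of degree less than `k` of the graded ring. -/
def lowDegree (N k : ℕ) : Submodule (MvPolynomial (Fin N) ℂ) (GrS N) where
  carrier := {p | ∀ β, k ≤ β.degree → coeff β p = 0}
  add_mem' hp hq β hβ := by rw [coeff_add, hp β hβ, hq β hβ, add_zero]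
  zero_mem' β _ := coeff_zero β
  smul_mem' a p hp β hβ := by rw [coeff_smul, hp β hβ, smul_zero]

theorem lowDegree_mono {k l : ℕ} (h : k ≤ l) : lowDegree N k ≤ lowDegree N l :=
  fun _ hp β hβ => hp β (h.trans hβ)

theorem eq_zero_of_mem_lowDegree_zero {p : GrS N} (hp : p ∈ lowDegree N 0) : p = 0 :=
  MvPolynomial.ext _ _ fun β => by rw [hp β (Nat.zero_le _), coeff_zero]

theorem exists_mem_lowDegree (p : GrS N) : ∃ k, p ∈ lowDegree N (k + 1) := by
  refine ⟨p.totalDegree, fun β hβ => ?_⟩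
  by_contra h
  have := le_totalDegree (mem_support_iff.2 h)
  have h2 : β.degree = β.sum fun _ e => e := rfl
  omega

/-- Here `a + 1` encodes degree at most `a`; shifting one of the two strict bounds avoids a
truncated subtraction in the bound of the product. -/
theorem mul_mem_lowDegree {a b : ℕ} {p q : GrS N} (hp : p ∈ lowDegree N (a + 1))
    (hq : q ∈ lowDegree N b) : p * q ∈ lowDegree N (a + b) := by
  classical
  intro β hβ
  rw [coeff_mul]
  refine Finset.sum_eq_zero fun x hx => ?_
  replace hx := Finset.HasAntidiagonal.mem_antidiagonal.1 hx
  rw [← hx, map_add] at hβ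
  by_cases h : a + 1 ≤ x.1.degree
  · rw [hp _ h, zero_mul]
  · rw [hq x.2 (by omega), mul_zero]

theorem C_mul_mem_lowDegree {k : ℕ} (a : MvPolynomial (Fin N) ℂ) {p : GrS N}
    (hp : p ∈ lowDegree N k) : C a * p ∈ lowDegree N k := by
  rw [← smul_eq_C_mul]; exact Submodule.smul_mem _ _ hp

theorem monomial_mem_lowDegree {β : Option (Fin N) →₀ ℕ} {k : ℕ} (h : β.degree < k)
    (a : MvPolynomial (Fin N) ℂ) : monomial β a ∈ lowDegree N k := by
  classical
  intro γ hγ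
  rw [coeff_monomial, if_neg]
  rintro rfl
  omega

theorem MvPolynomial.IsHomogeneous.mem_lowDegree {k : ℕ} {p : GrS N} (hp : p.IsHomogeneous k) :
    p ∈ lowDegree N (k + 1) := fun β hβ =>
  hp.coeff_eq_zero (by omega)

theorem hasOrderLT_normalHom_iff {k : ℕ} {P : WeylAlgS N} :
    HasOrderLT k P ↔ ∃ p ∈ lowDegree N k, P = normalHom N p := by
  refine exists_congr fun p => and_congr ?_ Iff.rfl
  refine forall_congr' fun β => ?_
  rw [mem_support_iff, ← not_lt]
  exact not_imp_comm

/-- Membership of a product in a linear condition may be tested on the terms of a factor. -/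
theorem exists_normalHom_of_terms {k : ℕ} {F : GrS N →+ WeylAlgS N} {L : GrS N →+ GrS N}
    (p : GrS N) (h : ∀ β ∈ p.support, ∃ q ∈ lowDegree N k,
      F (monomial β (coeff β p)) = normalHom N (L (monomial β (coeff β p)) + q)) :
    ∃ q ∈ lowDegree N k, F p = normalHom N (L p + q) := by
  choose! q hq hF using h
  refine ⟨∑ β ∈ p.support, q β, Submodule.sum_mem _ hq, ?_⟩
  have h1 : F p = ∑ β ∈ p.support, F (monomial β (coeff β p)) := by
    rw [← map_sum, support_sum_monomial_coeff]
  have h2 : L p = ∑ β ∈ p.support, L (monomial β (coeff β p)) := by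
    rw [← map_sum, support_sum_monomial_coeff]
  rw [h1, h2, map_add, map_sum, map_sum, ← Finset.sum_add_distrib]
  refine Finset.sum_congr rfl fun β hβ => ?_
  rw [hF β hβ, map_add]

/-- Moving a generator past a coefficient costs a term without the generator, hence only a
correction that respects the degree bound of `q`. -/
theorem genOp_mul_normalHom (o : Option (Fin N)) {l : ℕ} {q : GrS N} (hq : q ∈ lowDegree N l) :
    ∃ q' ∈ lowDegree N l, genOp o * normalHom N q = normalHom N (X o * q + q') := by
  refine exists_normalHom_of_terms (F := (AddMonoidHom.mulLeft (genOp o)).comp (normalHom N))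
    (L := AddMonoidHom.mulLeft (X o)) q fun β hβ => ?_
  obtain ⟨b, hb⟩ := genOp_mul_coeffOp o (coeff β q)
  refine ⟨monomial β b, monomial_mem_lowDegree ?_ _, ?_⟩
  · by_contra h
    exact mem_support_iff.1 hβ (hq β (not_lt.1 h))
  · simp only [AddMonoidHom.comp_apply, AddMonoidHom.coe_mulLeft, map_add]
    have : X o * monomial β (coeff β q) = monomial (β + Finsupp.single o 1) (coeff β q) := by
      rw [monomial_add_single, pow_one, mul_comm]
    rw [this, normalHom_monomial, normalHom_monomial, normalHom_monomial, monomialOp_add_single,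
      ← mul_assoc, hb, add_mul, mul_assoc]

theorem monomialOp_mul_normalHom (β : Option (Fin N) →₀ ℕ) {b : ℕ} {q : GrS N}
    (hq : q ∈ lowDegree N (b + 1)) : ∃ q' ∈ lowDegree N (β.degree + b),
      monomialOp β * normalHom N q = normalHom N (monomial β 1 * q + q') := by
  induction β using Finsupp.nat_induction_single with
  | zero =>
    refine ⟨0, Submodule.zero_mem _, ?_⟩
    rw [monomialOp_zero, one_mul, add_zero]
    exact congrArg (normalHom N) (one_mul q).symm
  | add_single β o ih =>
    obtain ⟨q₁, hq₁, h₁⟩ := ih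
    have hβ : monomial β (1 : MvPolynomial (Fin N) ℂ) ∈ lowDegree N (β.degree + 1) :=
      monomial_mem_lowDegree (Nat.lt_succ_self _) _
    have hsum : monomial β 1 * q + q₁ ∈ lowDegree N (β.degree + b + 1) :=
      Submodule.add_mem _ (mul_mem_lowDegree hβ hq : _ ∈ lowDegree N (β.degree + (b + 1)))
        (lowDegree_mono (Nat.le_succ _) hq₁)
    obtain ⟨q₂, hq₂, h₂⟩ := genOp_mul_normalHom o hsum
    have hX : (X o : GrS N) ∈ lowDegree N (1 + 1) := by
      refine monomial_mem_lowDegree ?_ _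
      rw [Finsupp.degree_single]; norm_num
    rw [map_add, Finsupp.degree_single]
    refine ⟨X o * q₁ + q₂, Submodule.add_mem _ ?_ ?_, ?_⟩
    · have h3 := mul_mem_lowDegree hX hq₁
      have h4 : 1 + (β.degree + b) ≤ β.degree + 1 + b := by omega
      exact lowDegree_mono h4 h3
    · have h4 : β.degree + b + 1 ≤ β.degree + 1 + b := by omega
      exact lowDegree_mono h4 hq₂
    · rw [monomialOp_add_single, mul_assoc, h₁, h₂]
      refine congrArg (normalHom N) ?_
      rw [monomial_add_single, pow_one]
      ring

/-- Normal forms multiply like commuting polynomials up to lower order. This makes `GrS N` the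
graded ring of the filtration by order. -/
theorem normalHom_mul {a b : ℕ} {p q : GrS N} (hp : p ∈ lowDegree N (a + 1))
    (hq : q ∈ lowDegree N (b + 1)) : ∃ q' ∈ lowDegree N (a + b),
      normalHom N p * normalHom N q = normalHom N (p * q + q') := by
  refine exists_normalHom_of_terms
    (F := (AddMonoidHom.mulRight (normalHom N q)).comp (normalHom N))
    (L := AddMonoidHom.mulRight q) p fun β hβ => ?_
  obtain ⟨q₁, hq₁, h₁⟩ := monomialOp_mul_normalHom β hq
  have hdeg : β.degree ≤ a := by
    by_contra h
    exact mem_support_iff.1 hβ (hp β (by omega))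
  refine ⟨C (coeff β p) * q₁, C_mul_mem_lowDegree _ (lowDegree_mono (by omega) hq₁), ?_⟩
  simp only [AddMonoidHom.comp_apply, AddMonoidHom.coe_mulRight]
  rw [normalHom_monomial, mul_assoc, h₁, ← normalHom_C_mul]
  congr 1
  have : monomial β (coeff β p) = C (coeff β p) * monomial β 1 := by
    rw [C_mul_monomial, mul_one]
  rw [this]
  ring

/-- The operators with a normal form are closed under left multiplication by coefficients and by the
generators, hence by the whole Weyl algebra, and they contain the powers of `s`. -/
theorem normalHom_surjective : Function.Surjective (normalHom N) := by
  have hgen : ∀ o (P : GrS N), genOp o * normalHom N P ∈ (normalHom N).range := by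
    intro o P
    obtain ⟨k, hk⟩ := exists_mem_lowDegree P
    obtain ⟨q, -, h⟩ := genOp_mul_normalHom o hk
    exact ⟨_, h.symm⟩
  have hW : ∀ w : WeylAlg N, ∀ P ∈ (normalHom N).range,
      Polynomial.C w * P ∈ (normalHom N).range := by
    refine WeylAlg.induction ?_ ?_ ?_ ?_
    · rintro f _ ⟨P, rfl⟩
      exact ⟨C f * P, normalHom_C_mul f P⟩
    · rintro i _ ⟨P, rfl⟩
      exact hgen (some i) P
    · intro x y hx hy P hP
      rw [Polynomial.C_add, add_mul]
      exact add_mem (hx P hP) (hy P hP)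
    · intro x y hx hy P hP
      rw [Polynomial.C_mul, mul_assoc]
      exact hx _ (hy P hP)
  have hX : ∀ k, (Polynomial.X ^ k : WeylAlgS N) ∈ (normalHom N).range := by
    intro k
    induction k with
    | zero => exact ⟨C 1, by rw [normalHom_C, map_one, pow_zero]⟩
    | succ k ih =>
      obtain ⟨P, hP⟩ := ih
      rw [pow_succ', ← hP]
      exact hgen none P
  intro P
  change P ∈ (normalHom N).range
  rw [← Polynomial.sum_C_mul_X_pow_eq P]
  exact sum_mem fun k _ => hW _ _ (hX k)

theorem monomialOp_mul_coeffOp_X (β : Option (Fin N) →₀ ℕ) (i : Fin N) :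
    monomialOp β * coeffOp N (X i) = coeffOp N (X i) * monomialOp β +
      β (some i) • monomialOp (β - Finsupp.single (some i) 1) := by
  induction β using Finsupp.nat_induction_single with
  | zero => simp [monomialOp_zero]
  | add_single β o ih =>
    rw [monomialOp_add_single, mul_assoc, ih, mul_add, ← mul_assoc, genOp_mul_coeffOp_X, add_mul,
      mul_assoc, add_assoc, mul_smul_comm, ← monomialOp_add_single, ← monomialOp_add_single]
    congr 1
    by_cases h : o = some i
    · subst h
      rw [if_pos rfl, one_mul, add_tsub_cancel_right, Finsupp.add_apply, Finsupp.single_eq_same,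
        add_smul, one_smul, add_comm]
      congr 1
      rcases Nat.eq_zero_or_pos (β (some i)) with h0 | h0
      · rw [h0, zero_smul, zero_smul]
      · rw [tsub_add_cancel_of_le]
        rw [Finsupp.single_le_iff]; exact h0
    · rw [if_neg h, zero_mul, zero_add, Finsupp.add_apply, Finsupp.single_eq_of_ne' h, add_zero]
      rcases Nat.eq_zero_or_pos (β (some i)) with h0 | h0
      · rw [h0, zero_smul, zero_smul]
      · rw [tsub_add_eq_add_tsub]
        rw [Finsupp.single_le_iff]; exact h0

/-- The commutator with a coordinate differentiates the normal form in the dual variable `ξ_i`;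
injectivity rests on this. -/
theorem normalHom_mul_coeffOp_X (p : GrS N) (i : Fin N) :
    normalHom N p * coeffOp N (X i) = coeffOp N (X i) * normalHom N p +
      normalHom N (pderiv (some i) p) := by
  rw [← normalHom_C_mul, ← map_add]
  induction p using MvPolynomial.induction_on' with
  | add p q hp hq => rw [map_add, add_mul, hp, hq, ← map_add, map_add (pderiv _)]; congr 1; ring
  | monomial β a =>
  rw [map_add, normalHom_C_mul, pderiv_monomial, normalHom_monomial, normalHom_monomial, mul_assoc,
    monomialOp_mul_coeffOp_X, mul_add, ← mul_assoc, ← mul_assoc, ← map_mul, ← map_mul,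
    mul_comm a (X i), map_mul _ a, map_natCast, mul_assoc (coeffOp N a), nsmul_eq_mul]

/-- Induction on the degree. If the operator is zero, so are its commutators with the coordinates;
by induction all derivatives of `p` in the `ξ_i` vanish, and in characteristic zero `p` involves `s`
only. -/
theorem normalHom_injective : Function.Injective (normalHom N) := by
  rw [injective_iff_map_eq_zero]
  suffices h : ∀ k, ∀ p ∈ lowDegree N k, normalHom N p = 0 → p = 0 by
    intro p hp
    obtain ⟨k, hk⟩ := exists_mem_lowDegree p
    exact h _ p hk hp
  intro k
  induction k with
  | zero => exact fun p hp _ => eq_zero_of_mem_lowDegree_zero hp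
  | succ k ih =>
    intro p hp h0
    have hd : ∀ i, pderiv (some i) p = 0 := by
      intro i
      refine ih _ (fun β hβ => ?_) ?_
      · rw [coeff_pderiv, hp, zero_mul]
        rw [map_add, Finsupp.degree_single]; omega
      · have := normalHom_mul_coeffOp_X p i
        rwa [h0, zero_mul, mul_zero, zero_add, eq_comm] at this
    have hsupp : ∀ β i, β (some i) ≠ 0 → coeff β p = 0 := by
      intro β i hβ
      have h1 := coeff_pderiv (i := some i) p (β - Finsupp.single (some i) 1)
      rw [hd, coeff_zero, tsub_add_cancel_of_le
        (Finsupp.single_le_iff.2 (Nat.one_le_iff_ne_zero.2 hβ))] at h1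
      rcases mul_eq_zero.1 h1.symm with h | h
      · exact h
      · exact absurd h (Nat.cast_add_one_ne_zero _)
    ext1 β
    rw [coeff_zero]
    by_cases hβ : ∃ i, β (some i) ≠ 0
    · obtain ⟨i, hi⟩ := hβ
      exact hsupp β i hi
    -- The operator is now a polynomial in `s` whose coefficients are multiplication operators, so
    -- the coefficients of `p` can be read off.
    have hmon : ∀ γ ∈ p.support, monomialOp γ = Polynomial.X ^ γ none := by
      intro γ hγ
      have h1 : ∀ i, γ (some i) = 0 := fun i => by
        by_contra h
        exact mem_support_iff.1 hγ (hsupp γ i h)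
      simp only [monomialOp, h1, pow_zero]
      simp
    by_contra hne
    have h1 : (normalHom N p).coeff (β none) = mulOp N (coeff β p) := by
      rw [normalHom_apply, normalOp, Polynomial.finsetSum_coeff,
        Finset.sum_eq_single_of_mem β (mem_support_iff.2 hne)]
      · rw [hmon β (mem_support_iff.2 hne)]
        simp [coeffOp]
      · intro γ hγ hγβ
        rw [hmon γ hγ]
        simp only [coeffOp, RingHom.comp_apply, Polynomial.coeff_C_mul, Polynomial.coeff_X_pow]
        rw [if_neg, mul_zero]
        intro h
        refine hγβ (Finsupp.ext fun o => ?_)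
        cases o with
        | none => exact h.symm
        | some i =>
          have h2 : γ (some i) = 0 := by
            by_contra h
            exact mem_support_iff.1 hγ (hsupp γ i h)
          have h3 : β (some i) = 0 := by
            by_contra h
            exact hβ ⟨i, h⟩
          rw [h2, h3]
    rw [h0, Polynomial.coeff_zero] at h1
    exact hne (mulOp_injective (by rw [← h1, map_zero]))

/-- The normal form of an operator. -/
def normalEquiv (N : ℕ) : GrS N ≃+ WeylAlgS N :=
  AddEquiv.ofBijective (normalHom N) ⟨normalHom_injective, normalHom_surjective⟩

end NormalForm

/-! ### Exactness of a filtered Spencer complex -/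

theorem MvPolynomial.IsHomogeneous.homogeneousComponent_mul {τ A : Type*} [CommSemiring A]
    {f : MvPolynomial τ A} {v : ℕ} (hf : f.IsHomogeneous v) (p : MvPolynomial τ A) (n : ℕ) :
    homogeneousComponent (n + v) (p * f) = homogeneousComponent n p * f := by
  conv_lhs => rw [← sum_homogeneousComponent p, Finset.sum_mul, map_sum]
  have h : ∀ i, homogeneousComponent (n + v) (homogeneousComponent i p * f) =
      if n = i then homogeneousComponent i p * f else 0 := by
    intro i
    rw [homogeneousComponent_of_mem ((homogeneousComponent_isHomogeneous i p).mul hf)]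
    simp
  simp only [h]
  rw [Finset.sum_ite_eq]
  split_ifs with hn
  · rfl
  · rw [homogeneousComponent_eq_zero _ _ (by simpa using hn), zero_mul]

theorem totalD_apply_eq_zero {R : Type*} [Ring R] {m e : ℕ} {r : Fin m → R}
    {c : Fin m → Fin m → Fin m → R} {y : Finset (Fin m) → R}
    (hy : ∀ S, S.card ≠ e + 1 → y S = 0) (S : Finset (Fin m)) (hS : S.card ≠ e) :
    totalD r c y S = 0 := by
  rw [totalD]
  simp only [LinearMap.add_apply, Pi.add_apply, LinearMap.sum_apply, Finset.sum_apply,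
    Module.End.mul_apply, rightMul_apply, extMul_apply, contract_apply]
  rw [Finset.sum_eq_zero, Finset.sum_eq_zero, add_zero]
  · refine fun i _ => Finset.sum_eq_zero fun j hij => Finset.sum_eq_zero fun k _ => ?_
    have hij := (Finset.mem_filter.1 hij).2
    split_ifs with h1 h2 h3
    · simp
    · simp
    · rw [hy]
      · simp
      · have c1 := Finset.card_erase_add_one h1
        have c2 := Finset.card_insert_of_notMem h2
        have c3 := Finset.card_insert_of_notMem h3
        omega
    · simp
  · intro i _
    split_ifs with h1
    · simp
    · rw [hy]
      · simp
      · have c1 := Finset.card_insert_of_notMem h1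
        omega

theorem totalD_apply_empty {R : Type*} [Ring R] {m : ℕ} (r : Fin m → R)
    (c : Fin m → Fin m → Fin m → R) (x : Finset (Fin m) → R) :
    totalD r c x ∅ = ∑ i, x {i} * r i := by
  rw [totalD]
  simp only [LinearMap.add_apply, Pi.add_apply, LinearMap.sum_apply, Finset.sum_apply,
    Module.End.mul_apply, rightMul_apply, extMul_apply, contract_apply, Finset.notMem_empty,
    if_false, zero_mul, Finset.sum_const_zero, add_zero]
  refine Finset.sum_congr rfl fun i _ => ?_
  simp [wedgeSign]

section Filtered

variable {N m : ℕ}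

/-- The normal form of an operator, as a polynomial. -/
def normalForm : WeylAlgS N →+ GrS N := (normalEquiv N).symm.toAddMonoidHom

theorem normalForm_normalHom (p : GrS N) : normalForm (normalHom N p) = p :=
  (normalEquiv N).symm_apply_apply p

theorem normalHom_normalForm (P : WeylAlgS N) : normalHom N (normalForm P) = P :=
  (normalEquiv N).apply_symm_apply P

theorem normalForm_injective : Function.Injective (normalForm (N := N)) :=
  (normalEquiv N).symm.injective

theorem normalForm_mul_sub_mem {a b : ℕ} {P Q : WeylAlgS N}
    (hP : normalForm P ∈ lowDegree N (a + 1))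
    (hQ : normalForm Q ∈ lowDegree N (b + 1)) :
    normalForm (P * Q) - normalForm P * normalForm Q ∈ lowDegree N (a + b) := by
  obtain ⟨q, hq, h⟩ := normalHom_mul hP hQ
  rw [normalHom_normalForm, normalHom_normalForm] at h
  rwa [h, normalForm_normalHom, add_sub_cancel_left]

theorem eq_zero_of_normalForm_mem_zero {P : WeylAlgS N} (hP : normalForm P ∈ lowDegree N 0) :
    P = 0 :=
  normalForm_injective (by rw [eq_zero_of_mem_lowDegree_zero hP, map_zero])

theorem normalForm_mul_mem {a b : ℕ} {P Q : WeylAlgS N} (hP : normalForm P ∈ lowDegree N a)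
    (hQ : normalForm Q ∈ lowDegree N (b + 1)) : normalForm (P * Q) ∈ lowDegree N (a + b) := by
  cases a with
  | zero => rw [eq_zero_of_normalForm_mem_zero hP, zero_mul, map_zero]; exact Submodule.zero_mem _
  | succ a =>
    have h1 := lowDegree_mono (show a + b ≤ a + 1 + b by omega) (normalForm_mul_sub_mem hP hQ)
    have h2 : normalForm P * normalForm Q ∈ lowDegree N (a + (b + 1)) := mul_mem_lowDegree hP hQ
    have h3 := lowDegree_mono (show a + (b + 1) ≤ a + 1 + b by omega) h2
    simpa using Submodule.add_mem _ h1 h3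

theorem normalForm_mul_coeffOp_mem {a : ℕ} {P : WeylAlgS N} (hP : normalForm P ∈ lowDegree N a)
    (c : MvPolynomial (Fin N) ℂ) : normalForm (P * coeffOp N c) ∈ lowDegree N a := by
  refine normalForm_mul_mem (b := 0) hP ?_
  rw [← normalHom_C, normalForm_normalHom]
  exact (isHomogeneous_C _ _).mem_lowDegree

theorem sub_homogeneousComponent_mem {k : ℕ} {p : GrS N} (hp : p ∈ lowDegree N (k + 1)) :
    p - homogeneousComponent k p ∈ lowDegree N k := by
  intro β hβ
  rw [coeff_sub, coeff_homogeneousComponent]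
  split_ifs with h
  · exact sub_self _
  · rw [hp β (by omega), sub_zero]

theorem MvPolynomial.IsHomogeneous.zsmul {τ A : Type*} [CommRing A] {p : MvPolynomial τ A} {k : ℕ}
    (hp : p.IsHomogeneous k) (z : ℤ) : (z • p).IsHomogeneous k := by
  rw [zsmul_eq_mul, ← map_intCast (C : A →+* MvPolynomial τ A)]
  simpa using (isHomogeneous_C τ (z : A)).mul hp

theorem MvPolynomial.IsHomogeneous.eq_zero_of_mem_lowDegree {k : ℕ} {p : GrS N}
    (hp : p.IsHomogeneous k) (hp' : p ∈ lowDegree N k) : p = 0 := by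
  ext1 β
  rw [coeff_zero]
  by_cases h : β.degree = k
  · exact hp' β h.ge
  · exact hp.coeff_eq_zero h

theorem zsmul_mem_lowDegree {k : ℕ} (z : ℤ) {p : GrS N} (hp : p ∈ lowDegree N k) :
    z • p ∈ lowDegree N k := (lowDegree N k).toAddSubgroup.zsmul_mem hp z

/-- The operators `r_i` are the normal forms of homogeneous polynomials `σ_i` of degree `wt i`, and
the degrees drop in the brackets `[r_i, r_j] = ∑ c_{ij}^k r_k`. -/
structure HasHomogeneousSymbols (r : Fin m → WeylAlgS N)
    (c : Fin m → Fin m → Fin m → MvPolynomial (Fin N) ℂ) (σ : Fin m → GrS N)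
    (wt : Fin m → ℕ) : Prop where
  eq_normalHom : ∀ i, r i = normalHom N (σ i)
  homogeneous : ∀ i, (σ i).IsHomogeneous (wt i)
  bracket : ∀ i j k, i < j → c i j k ≠ 0 → wt k + 1 ≤ wt i + wt j

/-- The filtration of the Spencer complex, where `r_S` has degree `∑ i ∈ S, wt i`. -/
def spencerFilt (wt : Fin m → ℕ) (K : ℕ) (x : Finset (Fin m) → WeylAlgS N) : Prop :=
  ∀ S, normalForm (x S) ∈ lowDegree N (K - ∑ i ∈ S, wt i)

/-- The class of an element of `spencerFilt wt (K + 1)` modulo `spencerFilt wt K`. -/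
def spencerSymbol (wt : Fin m → ℕ) (K : ℕ) (x : Finset (Fin m) → WeylAlgS N) :
    Finset (Fin m) → GrS N :=
  fun S => homogeneousComponent (K - ∑ i ∈ S, wt i) (normalForm (x S))

variable {wt : Fin m → ℕ}

theorem spencerFilt.mono {K L : ℕ} (h : K ≤ L) {x : Finset (Fin m) → WeylAlgS N}
    (hx : spencerFilt wt K x) : spencerFilt wt L x :=
  fun S => lowDegree_mono (Nat.sub_le_sub_right h _) (hx S)

theorem exists_spencerFilt (wt : Fin m → ℕ) (x : Finset (Fin m) → WeylAlgS N) :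
    ∃ K, spencerFilt wt K x := by
  choose k hk using fun S => exists_mem_lowDegree (normalForm (x S))
  refine ⟨(∑ S, (k S + 1)) + ∑ i, wt i, fun S => lowDegree_mono ?_ (hk S)⟩
  have h1 : k S + 1 ≤ ∑ S, (k S + 1) :=
    Finset.single_le_sum (f := fun S => k S + 1) (fun _ _ => Nat.zero_le _) (Finset.mem_univ S)
  have h2 : ∑ i ∈ S, wt i ≤ ∑ i, wt i := Finset.sum_le_sum_of_subset (Finset.subset_univ S)
  omega

/-- The subtraction in `spencerFilt` truncates exactly when the bound would be zero or negative, and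
then the component has to vanish. The truncation is thus harmless. -/
theorem spencerFilt.eq_zero {K : ℕ} {x : Finset (Fin m) → WeylAlgS N}
    (hx : spencerFilt wt K x) {S : Finset (Fin m)} (hS : K ≤ ∑ i ∈ S, wt i) : x S = 0 := by
  have := hx S
  rw [Nat.sub_eq_zero_of_le hS] at this
  exact eq_zero_of_normalForm_mem_zero this

theorem spencerFilt.contract {L : ℕ} {x : Finset (Fin m) → WeylAlgS N} (hx : spencerFilt wt L x)
    (i : Fin m) : spencerFilt wt (L - wt i) (contract (WeylAlgS N) i x) := by
  intro T
  rw [contract_apply]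
  split_ifs with h
  · rw [map_zero]; exact Submodule.zero_mem _
  · rw [map_zsmul]
    have := hx (insert i T)
    rw [Finset.sum_insert h, ← Nat.sub_sub] at this
    exact zsmul_mem_lowDegree _ this

theorem spencerFilt.extMul {L v K : ℕ} {x : Finset (Fin m) → WeylAlgS N}
    (hx : spencerFilt wt (L - v) x) (k : Fin m) (h : L + wt k ≤ v + K) :
    spencerFilt wt K (extMul (WeylAlgS N) k x) := by
  intro T
  rw [extMul_apply]
  split_ifs with hk
  · rw [map_zsmul]
    refine zsmul_mem_lowDegree _ (lowDegree_mono ?_ (hx (T.erase k)))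
    have := Finset.add_sum_erase T wt hk
    omega
  · rw [map_zero]; exact Submodule.zero_mem _

theorem sub_spencerSymbol_mem {K : ℕ} {x : Finset (Fin m) → WeylAlgS N}
    (hx : spencerFilt wt (K + 1) x) (S : Finset (Fin m)) :
    normalForm (x S) - spencerSymbol wt K x S ∈ lowDegree N (K - ∑ i ∈ S, wt i) := by
  rw [spencerSymbol]
  rcases le_or_gt (∑ i ∈ S, wt i) K with h | h
  · refine sub_homogeneousComponent_mem ?_
    have := hx S
    rwa [Nat.sub_add_comm h] at this
  · rw [hx.eq_zero h, map_zero, map_zero, sub_zero]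
    exact Submodule.zero_mem _

variable {r : Fin m → WeylAlgS N} {c : Fin m → Fin m → Fin m → MvPolynomial (Fin N) ℂ}
  {σ : Fin m → GrS N}

/-- On the associated graded modules the Spencer differential induces the Koszul differential of the
symbols: right multiplication by `r i` acts on leading terms as multiplication by `σ i`, and the
bracket terms are of lower filtration. -/
theorem HasHomogeneousSymbols.totalD_sub_mem (H : HasHomogeneousSymbols r c σ wt) {K : ℕ}
    {x : Finset (Fin m) → WeylAlgS N} (hx : spencerFilt wt (K + 1) x) (T : Finset (Fin m)) :
    normalForm (totalD r (fun i j k => coeffOp N (c i j k)) x T) -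
      totalD σ 0 (spencerSymbol wt K x) T ∈ lowDegree N (K - ∑ i ∈ T, wt i) := by
  rw [totalD, LinearMap.add_apply, Pi.add_apply, map_add, add_sub_right_comm]
  refine Submodule.add_mem _ ?_ ?_
  · rw [totalD_zero_apply]
    simp only [LinearMap.sum_apply, Finset.sum_apply, map_sum, Module.End.mul_apply,
      rightMul_apply, contract_apply]
    rw [← Finset.sum_sub_distrib]
    refine Submodule.sum_mem _ fun i _ => ?_
    split_ifs with hi
    · rw [zero_mul, map_zero, sub_zero]; exact Submodule.zero_mem _
    rw [smul_mul_assoc, map_zsmul, smul_mul_assoc, ← smul_sub]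
    refine zsmul_mem_lowDegree _ ?_
    have hsum := Finset.sum_insert hi (f := wt)
    rcases le_or_gt (∑ k ∈ insert i T, wt k) K with h | h
    · have h1 := hx (insert i T)
      rw [Nat.sub_add_comm h] at h1
      have h2 : normalForm (r i) ∈ lowDegree N (wt i + 1) := by
        rw [H.eq_normalHom, normalForm_normalHom]
        exact (H.homogeneous i).mem_lowDegree
      have h3 := normalForm_mul_sub_mem h1 h2
      rw [H.eq_normalHom i, normalForm_normalHom] at h3
      have h4 := mul_mem_lowDegree (H.homogeneous i).mem_lowDegree
        (sub_spencerSymbol_mem hx (insert i T))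
      have h5 : K - ∑ k ∈ insert i T, wt k + wt i = K - ∑ k ∈ T, wt k := by omega
      rw [h5] at h3
      rw [add_comm, h5] at h4
      rw [H.eq_normalHom i]
      have := Submodule.add_mem _ h3 h4
      rw [mul_comm (σ i), sub_mul, sub_add_sub_cancel] at this
      exact this
    · rw [spencerSymbol, hx.eq_zero h]
      simp only [zero_mul, map_zero, sub_zero]
      exact Submodule.zero_mem _
  -- The two contractions lower the bound by `wt i + wt j` and the exterior multiplication raises it
  -- by `wt k`, so the inequality on the brackets gains at least one step. Coefficients on the right
  -- do not raise the order.
  · simp only [LinearMap.sum_apply, Finset.sum_apply, map_sum]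
    refine Submodule.sum_mem _ fun i _ => Submodule.sum_mem _ fun j hij =>
      Submodule.sum_mem _ fun k _ => ?_
    simp only [Module.End.mul_apply]
    rw [← Module.End.mul_apply, ← Module.End.mul_apply, mul_assoc, Module.End.mul_apply,
      rightMul_apply]
    by_cases h0 : c i j k = 0
    · rw [h0, map_zero, mul_zero, map_zero]; exact Submodule.zero_mem _
    have hw := H.bracket i j k (Finset.mem_filter.1 hij).2 h0
    refine normalForm_mul_coeffOp_mem ?_ _
    have h1 := (hx.contract j).contract i
    rw [Nat.sub_sub] at h1
    exact h1.extMul k (by omega) T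

theorem HasHomogeneousSymbols.totalD_spencerSymbol_eq_zero (H : HasHomogeneousSymbols r c σ wt)
    {K : ℕ} {x : Finset (Fin m) → WeylAlgS N} (hx : spencerFilt wt (K + 1) x)
    {T : Finset (Fin m)} (hT : normalForm (totalD r (fun i j k => coeffOp N (c i j k)) x T) ∈
      lowDegree N (K - ∑ i ∈ T, wt i)) :
    totalD σ 0 (spencerSymbol wt K x) T = 0 := by
  refine IsHomogeneous.eq_zero_of_mem_lowDegree (k := K - ∑ i ∈ T, wt i) ?_ ?_
  · rw [totalD_zero_apply]
    refine IsHomogeneous.sum _ _ _ fun i _ => ?_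
    split_ifs with hi
    · exact isHomogeneous_zero _ _ _
    rw [smul_mul_assoc]
    refine IsHomogeneous.zsmul ?_ _
    have hsum := Finset.sum_insert hi (f := wt)
    rcases le_or_gt (∑ k ∈ insert i T, wt k) K with h | h
    · have h5 : K - ∑ k ∈ T, wt k = K - ∑ k ∈ insert i T, wt k + wt i := by omega
      rw [h5]
      exact (homogeneousComponent_isHomogeneous _ _).mul (H.homogeneous i)
    · rw [spencerSymbol, hx.eq_zero h, map_zero, map_zero, zero_mul]
      exact isHomogeneous_zero _ _ _
  · have := Submodule.sub_mem _ hT (H.totalD_sub_mem hx T)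
    rwa [sub_sub_cancel] at this

theorem grS_torsion (x : GrS N) (hx : (24 : ℕ) • x = 0) : x = 0 := by
  rw [nsmul_eq_mul] at hx
  rcases mul_eq_zero.1 hx with h | h
  · have h' : ((24 : ℕ) : GrS N) = C (C (24 : ℂ)) := by
      rw [← map_natCast (C : _ →+* GrS N), ← map_natCast (C : ℂ →+* _)]; norm_num
    rw [h', map_eq_zero_iff _ (C_injective _ _), map_eq_zero_iff _ (C_injective _ _)] at h
    norm_num at h
  · exact h

/-- The leading part of `x` is a Koszul cycle, hence a Koszul boundary. Lifting a preimage through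
the normal form gives a chain whose Spencer boundary has the same leading part as `x`. -/
theorem HasHomogeneousSymbols.exists_lower (H : HasHomogeneousSymbols r c σ wt)
    (hσ : IsWeaklyRegularFamily σ) {K e : ℕ} {x : Finset (Fin m) → WeylAlgS N}
    (hx : spencerFilt wt (K + 1) x) (hxe : ∀ S, S.card ≠ e + 1 → x S = 0)
    (hdx : spencerFilt wt K (totalD r (fun i j k => coeffOp N (c i j k)) x)) :
    ∃ y : Finset (Fin m) → WeylAlgS N, (∀ S, S.card ≠ e + 2 → y S = 0) ∧
      spencerFilt wt K (x - totalD r (fun i j k => coeffOp N (c i j k)) y) := by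
  set u := spencerSymbol wt K x with hu
  have hue : ∀ S, S.card ≠ e + 1 → u S = 0 := fun S hS => by
    rw [hu, spencerSymbol, hxe S hS, map_zero, map_zero]
  obtain ⟨v, hv⟩ := koszul_exact grS_torsion hσ (x := u) (hue ∅ (by simp))
    (funext fun T => H.totalD_spencerSymbol_eq_zero hx (hdx T))
  -- A Koszul preimage need be neither of a single exterior degree nor homogeneous. Only its
  -- components of the expected bidegree matter, and they alone already have boundary `u`.
  set w : Finset (Fin m) → GrS N := fun U =>
    if U.card = e + 2 ∧ ∑ i ∈ U, wt i ≤ K then homogeneousComponent (K - ∑ i ∈ U, wt i) (v U)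
    else 0 with hw
  set y : Finset (Fin m) → WeylAlgS N := fun U => normalHom N (w U) with hy
  have hyF : spencerFilt wt (K + 1) y := by
    intro U
    simp only [hy, normalForm_normalHom, hw]
    split_ifs with h
    · rw [Nat.sub_add_comm h.2]
      exact (homogeneousComponent_isHomogeneous _ _).mem_lowDegree
    · exact Submodule.zero_mem _
  have hyw : spencerSymbol wt K y = w := by
    funext U
    simp only [spencerSymbol, hy, normalForm_normalHom, hw]
    split_ifs with h
    · exact homogeneousComponent_eq_self (homogeneousComponent_isHomogeneous _ _)
    · exact map_zero _
  have hwu : totalD σ 0 w = u := by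
    funext T
    rw [totalD_zero_apply]
    by_cases hT : T.card = e + 1 ∧ ∑ i ∈ T, wt i ≤ K
    · have h1 : u T = homogeneousComponent (K - ∑ i ∈ T, wt i) (u T) :=
        (homogeneousComponent_eq_self (homogeneousComponent_isHomogeneous _ _)).symm
      rw [h1, ← hv, totalD_zero_apply, map_sum]
      refine Finset.sum_congr rfl fun i _ => ?_
      split_ifs with hi
      · exact (map_zero _).symm
      rw [smul_mul_assoc, smul_mul_assoc, map_zsmul]
      congr 1
      have hsum := Finset.sum_insert hi (f := wt)
      have hcard := Finset.card_insert_of_notMem hi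
      simp only [hw]
      split_ifs with hU
      · have h5 : K - ∑ k ∈ T, wt k = K - ∑ k ∈ insert i T, wt k + wt i := by omega
        rw [h5, (H.homogeneous i).homogeneousComponent_mul]
      -- The part of `v` discarded here contributes nothing: a multiple of `σ i` has no component of
      -- degree below `wt i`.
      · have hU' : K - ∑ k ∈ T, wt k < wt i := by
          by_contra h
          exact hU ⟨by omega, by omega⟩
        rw [zero_mul]
        ext1 β
        rw [coeff_zero, coeff_homogeneousComponent]
        split_ifs with hβ
        · classical
          rw [coeff_mul]
          refine (Finset.sum_eq_zero fun z hz => ?_).symm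
          replace hz := Finset.HasAntidiagonal.mem_antidiagonal.1 hz
          rw [(H.homogeneous i).coeff_eq_zero, mul_zero]
          rw [← hz, map_add] at hβ
          omega
        · rfl
    · have h1 : u T = 0 := by
        by_cases hTe : T.card = e + 1
        · rw [hu, spencerSymbol, hx.eq_zero, map_zero, map_zero]
          by_contra h
          exact hT ⟨hTe, by omega⟩
        · exact hue T hTe
      rw [h1]
      refine Finset.sum_eq_zero fun i _ => ?_
      split_ifs with hi
      · rfl
      have hsum := Finset.sum_insert hi (f := wt)
      have hcard := Finset.card_insert_of_notMem hi
      simp only [hw]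
      rw [if_neg, smul_zero, zero_mul]
      rintro ⟨h2, h3⟩
      exact hT ⟨by omega, by omega⟩
  refine ⟨y, fun S hS => ?_, fun T => ?_⟩
  · simp only [hy, hw]
    rw [if_neg (fun h => hS h.1), map_zero]
  · have h1 := sub_spencerSymbol_mem hx T
    have h2 := H.totalD_sub_mem hyF T
    rw [hyw, hwu] at h2
    have := Submodule.sub_mem _ h1 h2
    rwa [sub_sub_sub_cancel_right, ← map_sub] at this

/-- Descent with `exists_lower`: each step changes the cycle by a boundary and lowers its filtration
by one, and filtration 0 means zero. -/
theorem HasHomogeneousSymbols.exact (H : HasHomogeneousSymbols r c σ wt)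
    (hσ : IsWeaklyRegularFamily σ)
    (hsq : totalD r (fun i j k => coeffOp N (c i j k)) *
      totalD r (fun i j k => coeffOp N (c i j k)) = 0)
    {e : ℕ} {x : Finset (Fin m) → WeylAlgS N} (hxe : ∀ S, S.card ≠ e + 1 → x S = 0)
    (hdx : totalD r (fun i j k => coeffOp N (c i j k)) x = 0) :
    ∃ y : Finset (Fin m) → WeylAlgS N, (∀ S, S.card ≠ e + 2 → y S = 0) ∧
      totalD r (fun i j k => coeffOp N (c i j k)) y = x := by
  set D := totalD r (fun i j k => coeffOp N (c i j k)) with hD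
  obtain ⟨K, hK⟩ := exists_spencerFilt wt x
  have hDD : ∀ y, D (D y) = 0 := fun y => LinearMap.congr_fun hsq y
  induction K generalizing x with
  | zero => exact ⟨0, fun _ _ => rfl, by
      rw [map_zero]; exact (funext fun S => hK.eq_zero (Nat.zero_le _)).symm⟩
  | succ K ih =>
    obtain ⟨y, hy, hyK⟩ := H.exists_lower hσ hK hxe
      (by rw [← hD, hdx]; intro S; rw [Pi.zero_apply, map_zero]; exact Submodule.zero_mem _)
    obtain ⟨z, hz, hzx⟩ := ih (x := x - D y)
      (fun S hS => by rw [Pi.sub_apply, hxe S hS, totalD_apply_eq_zero hy S hS, sub_zero])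
      (by rw [map_sub, hdx, hDD, sub_zero]) hyK
    exact ⟨z + y, fun S hS => by rw [Pi.add_apply, hz S hS, hy S hS, add_zero],
      by rw [map_add, hzx, sub_add_cancel]⟩

/-- Strictness of the differential. While the chain lies higher than its boundary, its leading part
is a cycle and can be removed without changing the boundary. -/
theorem HasHomogeneousSymbols.exists_strict (H : HasHomogeneousSymbols r c σ wt)
    (hσ : IsWeaklyRegularFamily σ)
    (hsq : totalD r (fun i j k => coeffOp N (c i j k)) *
      totalD r (fun i j k => coeffOp N (c i j k)) = 0)
    {e k : ℕ} {x : Finset (Fin m) → WeylAlgS N} (hxe : ∀ S, S.card ≠ e + 1 → x S = 0)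
    (hdx : spencerFilt wt k (totalD r (fun i j k => coeffOp N (c i j k)) x)) :
    ∃ x', spencerFilt wt k x' ∧ totalD r (fun i j k => coeffOp N (c i j k)) x' =
      totalD r (fun i j k => coeffOp N (c i j k)) x := by
  set D := totalD r (fun i j k => coeffOp N (c i j k)) with hD
  obtain ⟨K, hK⟩ := exists_spencerFilt wt x
  have hDD : ∀ y, D (D y) = 0 := fun y => LinearMap.congr_fun hsq y
  induction K generalizing x with
  | zero => exact ⟨x, hK.mono (Nat.zero_le _), rfl⟩
  | succ K ih =>
    rcases le_or_gt (K + 1) k with hk | hk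
    · exact ⟨x, hK.mono hk, rfl⟩
    obtain ⟨y, hy, hyK⟩ := H.exists_lower hσ hK hxe (hdx.mono (by omega))
    have h1 : D (x - D y) = D x := by rw [map_sub, hDD, sub_zero]
    obtain ⟨x', hx', h2⟩ := ih (x := x - D y)
      (fun S hS => by rw [Pi.sub_apply, hxe S hS, totalD_apply_eq_zero hy S hS, sub_zero])
      (by rwa [h1]) hyK
    exact ⟨x', hx', by rw [h2, h1]⟩

/-- By strictness `P` is a combination of the `r i` in which no term exceeds the order of `P`;
comparing the parts of degree `k` expresses `p` through the `σ i`. -/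
theorem HasHomogeneousSymbols.mem_span_of_isSymbol (H : HasHomogeneousSymbols r c σ wt)
    (hσ : IsWeaklyRegularFamily σ)
    (hsq : totalD r (fun i j k => coeffOp N (c i j k)) *
      totalD r (fun i j k => coeffOp N (c i j k)) = 0)
    {k : ℕ} {P : WeylAlgS N} {p : GrS N} (hP : P ∈ Submodule.span (WeylAlgS N) (Set.range r))
    (hp : IsSymbol k P p) : p ∈ Ideal.span (Set.range σ) := by
  obtain ⟨a, rfl⟩ := (Submodule.mem_span_range_iff_exists_fun _).1 hP
  set D := totalD r (fun i j k => coeffOp N (c i j k)) with hD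
  set P := ∑ i, a i • r i with hPdef
  -- The coefficients of `P` as a chain of degree 1, with `P` as the value of its boundary at `∅`.
  set x : Finset (Fin m) → WeylAlgS N := fun S => if S.card = 1 then ∑ i ∈ S, a i else 0 with hx
  have hx1 : ∀ S, S.card ≠ 0 + 1 → x S = 0 := fun S hS => if_neg hS
  have hDx : D x ∅ = P := by
    rw [hD, totalD_apply_empty]
    exact Finset.sum_congr rfl fun i _ => by simp [hx]
  obtain ⟨q, hq, hPq⟩ := hasOrderLT_normalHom_iff.1 hp.2
  have hPk : normalForm P - p ∈ lowDegree N k := by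
    rw [← normalHom_apply] at hPq
    have := congrArg normalForm hPq
    rw [map_sub, normalForm_normalHom, normalForm_normalHom] at this
    rwa [this]
  obtain ⟨x', hx', hDx'⟩ := H.exists_strict hσ hsq (k := k + 1) hx1 (by
    intro S
    rw [← hD]
    by_cases hS : S = ∅
    · subst hS
      rw [hDx, Finset.sum_empty, Nat.sub_zero]
      have := Submodule.add_mem _ (lowDegree_mono (Nat.le_succ k) hPk) hp.1.mem_lowDegree
      rwa [sub_add_cancel] at this
    · rw [hD, totalD_apply_eq_zero hx1 S (by rwa [ne_eq, Finset.card_eq_zero]), map_zero]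
      exact Submodule.zero_mem _)
  have h1 := H.totalD_sub_mem hx' ∅
  rw [hDx', ← hD, hDx, Finset.sum_empty, Nat.sub_zero, totalD_apply_empty] at h1
  set f := ∑ i, spencerSymbol wt k x' {i} * σ i with hf
  have hfk : f.IsHomogeneous k := by
    refine IsHomogeneous.sum _ _ _ fun i _ => ?_
    rw [spencerSymbol, Finset.sum_singleton]
    rcases le_or_gt (wt i) k with h | h
    · have := (homogeneousComponent_isHomogeneous (k - wt i) (normalForm (x' {i}))).mul
        (H.homogeneous i)
      rwa [Nat.sub_add_cancel h] at this
    · rw [hx'.eq_zero (by rw [Finset.sum_singleton]; exact h), map_zero, map_zero, zero_mul]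
      exact isHomogeneous_zero _ _ _
  have hpf : p - f = 0 := by
    refine IsHomogeneous.eq_zero_of_mem_lowDegree (hp.1.sub hfk) ?_
    have := Submodule.sub_mem _ h1 hPk
    rwa [sub_sub_sub_cancel_left] at this
  rw [sub_eq_zero.1 hpf]
  exact sum_mem fun i _ => Ideal.mul_mem_left _ _ (Ideal.subset_span ⟨i, rfl⟩)

end Filtered

/-! ### Regular sequences -/

section Regular

theorem cons_image_Iio_zero {E : Type*} {n : ℕ} (a : E) (f : Fin n → E) :
    (Fin.cons a f : Fin (n + 1) → E) '' Set.Iio 0 = ∅ := by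
  ext x; simp

theorem cons_image_Iio_succ {E : Type*} {n : ℕ} (a : E) (f : Fin n → E) (i : Fin n) :
    (Fin.cons a f : Fin (n + 1) → E) '' Set.Iio i.succ = insert a (f '' Set.Iio i) := by
  ext x
  simp only [Set.mem_image, Set.mem_Iio, Set.mem_insert_iff]
  constructor
  · rintro ⟨j, hj, rfl⟩
    induction j using Fin.cases with
    | zero => exact Or.inl rfl
    | succ j => exact Or.inr ⟨j, Fin.succ_lt_succ_iff.1 hj, rfl⟩
  · rintro (rfl | ⟨j, hj, rfl⟩)
    · exact ⟨0, Fin.succ_pos i, rfl⟩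
    · exact ⟨j.succ, Fin.succ_lt_succ_iff.2 hj, rfl⟩

theorem snoc_image_Iio_castSucc {E : Type*} {n : ℕ} (f : Fin n → E) (a : E) (i : Fin n) :
    (Fin.snoc f a : Fin (n + 1) → E) '' Set.Iio i.castSucc = f '' Set.Iio i := by
  ext x
  simp only [Set.mem_image, Set.mem_Iio]
  constructor
  · rintro ⟨j, hj, rfl⟩
    induction j using Fin.lastCases with
    | last => exact absurd hj (not_lt.2 (Fin.le_last _))
    | cast j => exact ⟨j, Fin.castSucc_lt_castSucc_iff.1 hj, by rw [Fin.snoc_castSucc]⟩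
  · rintro ⟨j, hj, rfl⟩
    exact ⟨j.castSucc, Fin.castSucc_lt_castSucc_iff.2 hj, Fin.snoc_castSucc ..⟩

theorem snoc_image_Iio_last {E : Type*} {n : ℕ} (f : Fin n → E) (a : E) :
    (Fin.snoc f a : Fin (n + 1) → E) '' Set.Iio (Fin.last n) = Set.range f := by
  ext x
  simp only [Set.mem_image, Set.mem_Iio, Set.mem_range]
  constructor
  · rintro ⟨j, hj, rfl⟩
    induction j using Fin.lastCases with
    | last => exact absurd hj (lt_irrefl _)
    | cast j => exact ⟨j, by rw [Fin.snoc_castSucc]⟩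
  · rintro ⟨j, rfl⟩
    exact ⟨j.castSucc, Fin.castSucc_lt_last j, Fin.snoc_castSucc ..⟩

theorem isWeaklyRegular_ofFn_iff {G : Type*} [CommRing G] {m : ℕ} {f : Fin m → G} :
    RingTheory.Sequence.IsWeaklyRegular G (List.ofFn f) ↔ IsWeaklyRegularFamily f := by
  have key : ∀ (i : ℕ) (h : i < m),
      Ideal.ofList ((List.ofFn f).take i) • (⊤ : Submodule G G) =
        Ideal.span (f '' Set.Iio ⟨i, h⟩) := by
    intro i h
    rw [smul_eq_mul, Ideal.mul_top, Ideal.ofList]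
    congr 1
    ext x
    simp only [Set.mem_ofPred_eq, List.mem_take_iff_getElem, Set.mem_image, Set.mem_Iio,
      List.getElem_ofFn, List.length_ofFn]
    constructor
    · rintro ⟨j, hj, rfl⟩
      exact ⟨⟨j, by omega⟩, Fin.mk_lt_mk.2 (by omega), rfl⟩
    · rintro ⟨j, hj, rfl⟩
      exact ⟨j, by have := Fin.lt_def.1 hj; simp at this; omega, rfl⟩
  constructor
  · intro hf i x hx
    have := hf.regular_mod_prev i (by simp)
    rw [isSMulRegular_quotient_iff_mem_of_smul_mem, key i i.isLt] at this
    refine this x ?_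
    simpa using hx
  · intro hf
    refine ⟨fun i hi => ?_⟩
    rw [List.length_ofFn] at hi
    rw [isSMulRegular_quotient_iff_mem_of_smul_mem, key i hi]
    intro x hx
    refine hf ⟨i, hi⟩ x ?_
    simpa using hx

theorem IsWeaklyRegularFamily.map_ringEquiv {E G : Type*} [CommRing E] [CommRing G] {m : ℕ}
    {f : Fin m → E} (hf : IsWeaklyRegularFamily f) (e : E ≃+* G) :
    IsWeaklyRegularFamily fun i => e (f i) := by
  intro i x hx
  obtain ⟨x, rfl⟩ := e.surjective x
  have himg : ∀ s : Set (Fin m), Ideal.span ((fun i => e (f i)) '' s) =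
      (Ideal.span (f '' s)).map (e : E →+* G) := by
    intro s; rw [Ideal.map_span, Set.image_image]; rfl
  have hmem : ∀ (I : Ideal E) y, e y ∈ I.map (e : E →+* G) ↔ y ∈ I := by
    intro I y
    change (e : E →+* G) y ∈ _ ↔ _
    rw [← Ideal.mem_comap, Ideal.comap_map_of_bijective (e : E →+* G) e.bijective]
  rw [himg, ← map_mul, hmem] at hx
  rw [himg, hmem]
  exact hf i x hx

/-- For a weakly regular sequence `a, f_1, …` the element `a` stays a nonzerodivisor modulo `f_1, …,
f_i` for every `i`, with no local or graded hypothesis. Regularity of the `f i` can therefore be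
tested after inverting `a`. -/
theorem IsWeaklyRegularFamily.of_cons {E : Type*} [CommRing E] {n : ℕ} {a : E} {f : Fin n → E}
    (hf : IsWeaklyRegularFamily (Fin.cons a f : Fin (n + 1) → E))
    (hloc : ∀ i x, f i * x ∈ Ideal.span (f '' Set.Iio i) →
      ∃ k : ℕ, a ^ k * x ∈ Ideal.span (f '' Set.Iio i)) : IsWeaklyRegularFamily f := by
  set J : ℕ → Ideal E := fun i => Ideal.span (f '' {j | j.val < i}) with hJ
  have hJi : ∀ i : Fin n, Ideal.span (f '' Set.Iio i) = J i := fun i => rfl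
  have hpow : ∀ i, (∀ x, a * x ∈ J i → x ∈ J i) → ∀ (k : ℕ) x, a ^ k * x ∈ J i → x ∈ J i := by
    intro i h k
    induction k with
    | zero => intro x hx; simpa using hx
    | succ k ih => intro x hx; rw [pow_succ', mul_assoc] at hx; exact ih x (h _ hx)
  have hJs : ∀ i : Fin n, J (i + 1) = Ideal.span {f i} ⊔ J i := by
    intro i
    rw [hJ]
    simp only
    rw [← Ideal.span_union]
    congr 1
    ext x
    simp only [Set.mem_image, Set.mem_ofPred_eq, Set.singleton_union, Set.mem_insert_iff]
    constructor
    · rintro ⟨j, hj, rfl⟩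
      rcases Nat.lt_succ_iff_lt_or_eq.1 hj with h | h
      · exact Or.inr ⟨j, h, rfl⟩
      · exact Or.inl (congrArg f (Fin.ext h))
    · rintro (rfl | ⟨j, hj, rfl⟩)
      · exact ⟨i, Nat.lt_succ_self _, rfl⟩
      · exact ⟨j, Nat.lt_succ_of_lt hj, rfl⟩
  -- If `a x = y f_i + z` with `z ∈ J i`, regularity of `f_i` modulo `a` and `J i` gives `y = y' a +
  -- w`, and then `a (x - y' f_i) ∈ J i`, so the previous case applies.
  have hmain : ∀ i ≤ n, ∀ x, a * x ∈ J i → x ∈ J i := by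
    intro i
    induction i with
    | zero =>
      intro _ x hx
      have h0 : J 0 = ⊥ := by simp [hJ]
      have := hf 0 x
      rw [cons_image_Iio_zero, Ideal.span_empty, Fin.cons_zero] at this
      rw [h0] at hx ⊢
      exact this hx
    | succ i ih =>
      intro hi x hx
      have ih := ih (by omega)
      set i' : Fin n := ⟨i, hi⟩
      have hs : J (i + 1) = Ideal.span {f i'} ⊔ J i := hJs i'
      rw [hs, Ideal.mem_span_singleton_sup] at hx ⊢
      obtain ⟨y, z, hz, hyz⟩ := hx
      have h1 := hf i'.succ y
      rw [cons_image_Iio_succ, Fin.cons_succ, Ideal.span_insert, hJi] at h1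
      have h2 : y ∈ Ideal.span {a} ⊔ J i := by
        refine h1 (Ideal.mem_span_singleton_sup.2 ⟨x, -z, neg_mem hz, ?_⟩)
        linear_combination -hyz
      obtain ⟨y', w, hw, hyw⟩ := Ideal.mem_span_singleton_sup.1 h2
      refine ⟨y', x - y' * f i', ih _ ?_, by ring⟩
      have : a * (x - y' * f i') = z + f i' * w := by
        linear_combination -hyz - f i' * hyw
      rw [this]
      exact add_mem hz (Ideal.mul_mem_left _ _ hw)
  intro i x hx
  obtain ⟨k, hk⟩ := hloc i x hx
  exact hpow i (hmain i i.isLt.le) k x hk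

theorem span_C_image {E : Type*} [CommRing E] {ν : Type*} (f : ν → E) (s : Set ν) :
    Ideal.span ((fun i => (Polynomial.C (f i) : Polynomial E)) '' s) =
      (Ideal.span (f '' s)).map Polynomial.C := by
  rw [Ideal.map_span, Set.image_image]

theorem IsWeaklyRegularFamily.polynomial {E : Type*} [CommRing E] {n : ℕ} {f : Fin n → E}
    (hf : IsWeaklyRegularFamily f) :
    IsWeaklyRegularFamily fun i => (Polynomial.C (f i) : Polynomial E) := by
  intro i x hx
  rw [span_C_image, Ideal.mem_map_C_iff] at hx ⊢
  intro k
  refine hf i _ ?_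
  have := hx k
  rwa [Polynomial.coeff_C_mul] at this

theorem mem_map_C_iff_map_eq_zero {E : Type*} [CommRing E] {J : Ideal E} {x : Polynomial E} :
    x ∈ J.map Polynomial.C ↔ x.map (Ideal.Quotient.mk J) = 0 := by
  rw [Ideal.mem_map_C_iff, Polynomial.ext_iff]
  simp [Ideal.Quotient.eq_zero_iff_mem]

/-- A monic polynomial remains monic, hence a nonzerodivisor, modulo any ideal of the coefficients;
so does any factor `g` of it remain a nonzerodivisor. -/
theorem mem_of_monic_mul_mem {E : Type*} [CommRing E] {J : Ideal E} {g v : Polynomial E}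
    (hg : (v * g).Monic) {x : Polynomial E} (hx : g * x ∈ J.map Polynomial.C) :
    x ∈ J.map Polynomial.C := by
  rw [mem_map_C_iff_map_eq_zero] at hx ⊢
  refine ((hg.map (Ideal.Quotient.mk J)).mul_right_eq_zero_iff).1 ?_
  rw [Polynomial.map_mul, mul_assoc, ← Polynomial.map_mul, hx, mul_zero]

theorem IsWeaklyRegularFamily.snoc_polynomial {E : Type*} [CommRing E] {n : ℕ} {f : Fin n → E}
    (hf : IsWeaklyRegularFamily f) {g v : Polynomial E} (hg : (v * g).Monic) :
    IsWeaklyRegularFamily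
      (Fin.snoc (fun i => Polynomial.C (f i)) g : Fin (n + 1) → Polynomial E) := by
  intro i x hx
  induction i using Fin.lastCases with
  | last =>
    rw [snoc_image_Iio_last, Fin.snoc_last, ← Set.image_univ, span_C_image] at hx
    rw [snoc_image_Iio_last, ← Set.image_univ, span_C_image]
    exact mem_of_monic_mul_mem hg hx
  | cast i =>
    rw [snoc_image_Iio_castSucc, Fin.snoc_castSucc] at hx
    rw [snoc_image_Iio_castSucc]
    exact hf.polynomial i x hx

/-- The remainder modulo a monic polynomial is linear over the coefficients, so a nonzerodivisor `a`
can be cancelled in it coefficientwise. -/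
theorem Polynomial.Monic.dvd_of_dvd_C_mul {E : Type*} [CommRing E] {g x : Polynomial E}
    (hg : g.Monic) {a : E} (ha : ∀ y, a * y = 0 → y = 0) (h : g ∣ Polynomial.C a * x) : g ∣ x := by
  rw [← Polynomial.modByMonic_eq_zero_iff_dvd hg] at h ⊢
  rw [← Polynomial.smul_eq_C_mul, Polynomial.smul_modByMonic] at h
  ext k
  have := congrArg (fun p => Polynomial.coeff p k) h
  rw [Polynomial.coeff_smul, smul_eq_mul] at this
  exact ha _ this

/-- Modulo a monic polynomial, a polynomial ring is free over its coefficients, so a regular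
sequence of coefficients stays regular there. The unit `v` serves to make `g` monic without changing
the ideal it generates. -/
theorem IsWeaklyRegularFamily.cons_polynomial {E : Type*} [CommRing E] {n : ℕ} {f : Fin n → E}
    (hf : IsWeaklyRegularFamily f) {g v : Polynomial E} (hv : IsUnit v) (hg : (v * g).Monic) :
    IsWeaklyRegularFamily
      (Fin.cons g (fun i => Polynomial.C (f i)) : Fin (n + 1) → Polynomial E) := by
  intro i x hx
  induction i using Fin.cases with
  | zero =>
    rw [cons_image_Iio_zero, Ideal.span_empty, Fin.cons_zero, ← Ideal.map_bot (f := Polynomial.C)]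
      at hx
    rw [cons_image_Iio_zero, Ideal.span_empty, ← Ideal.map_bot (f := Polynomial.C)]
    exact mem_of_monic_mul_mem hg hx
  | succ i =>
    rw [cons_image_Iio_succ, Fin.cons_succ, Ideal.span_insert, span_C_image,
      Ideal.mem_span_singleton_sup] at hx
    rw [cons_image_Iio_succ, Ideal.span_insert, span_C_image, Ideal.mem_span_singleton_sup]
    set J := Ideal.span (f '' Set.Iio i) with hJ
    set π := Ideal.Quotient.mk J with hπ
    obtain ⟨y, z, hz, hyz⟩ := hx
    rw [mem_map_C_iff_map_eq_zero] at hz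
    obtain ⟨u, hu⟩ := hv.exists_left_inv
    have hdvd : (v * g).map π ∣ Polynomial.C (π (f i)) * x.map π := by
      refine ⟨(y * u).map π, ?_⟩
      rw [← Polynomial.map_C, ← Polynomial.map_mul, ← hyz, Polynomial.map_add, hz, add_zero,
        ← Polynomial.map_mul]
      congr 1
      linear_combination (-y * g) * hu
    have hreg : ∀ w, π (f i) * w = 0 → w = 0 := by
      intro w hw
      obtain ⟨w, rfl⟩ := Ideal.Quotient.mk_surjective w
      rw [← map_mul, Ideal.Quotient.eq_zero_iff_mem] at hw
      exact Ideal.Quotient.eq_zero_iff_mem.2 (hf i w hw)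
    obtain ⟨q, hq⟩ := (hg.map π).dvd_of_dvd_C_mul hreg hdvd
    obtain ⟨q, rfl⟩ := Polynomial.map_surjective π Ideal.Quotient.mk_surjective q
    refine ⟨q * v, x - v * g * q, ?_, by ring⟩
    rw [mem_map_C_iff_map_eq_zero, Polynomial.map_sub, hq, ← Polynomial.map_mul, sub_self]

end Regular

/-! ### Symbols of vector fields -/

section FieldSymbol

variable {N : ℕ}

theorem fieldSymbol_isHomogeneous
    (δ : Derivation ℂ (MvPolynomial (Fin N) ℂ) (MvPolynomial (Fin N) ℂ)) :
    (fieldSymbol δ).IsHomogeneous 1 :=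
  IsHomogeneous.sum _ _ _ fun j _ => by
    simpa using (isHomogeneous_C _ _).mul (isHomogeneous_X _ j)

theorem derivation_sum_apply {κ : Type*} (s : Finset κ)
    (δ : κ → Derivation ℂ (MvPolynomial (Fin N) ℂ) (MvPolynomial (Fin N) ℂ))
    (f : MvPolynomial (Fin N) ℂ) : (∑ i ∈ s, δ i) f = ∑ i ∈ s, δ i f := by
  have := congrFun (map_sum (Derivation.coeFnAddMonoidHom (R := ℂ) (A := MvPolynomial (Fin N) ℂ)
    (M := MvPolynomial (Fin N) ℂ)) δ s) f
  rwa [Finset.sum_apply] at this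

theorem fieldSymbol_sum_smul {κ : Type*} (s : Finset κ) (a : κ → MvPolynomial (Fin N) ℂ)
    (δ : κ → Derivation ℂ (MvPolynomial (Fin N) ℂ) (MvPolynomial (Fin N) ℂ)) :
    fieldSymbol (∑ i ∈ s, a i • δ i) = ∑ i ∈ s, C (a i) * fieldSymbol (δ i) := by
  simp only [fieldSymbol, Finset.mul_sum]
  rw [Finset.sum_comm]
  refine Finset.sum_congr rfl fun j _ => ?_
  rw [derivation_sum_apply, map_sum, Finset.sum_mul]
  refine Finset.sum_congr rfl fun i _ => ?_
  rw [Derivation.smul_apply, smul_eq_mul, map_mul, mul_assoc]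

theorem fieldSymbol_smul_pderiv (a : MvPolynomial (Fin N) ℂ) (j : Fin N) :
    fieldSymbol (a • pderiv j) = C a * X j := by
  rw [fieldSymbol, Finset.sum_eq_single j]
  · simp
  · intro k _ hk
    rw [Derivation.smul_apply, pderiv_X_of_ne hk]; simp
  · simp

theorem Derivation.eq_sum_smul_pderiv
    (δ : Derivation ℂ (MvPolynomial (Fin N) ℂ) (MvPolynomial (Fin N) ℂ)) :
    δ = ∑ j, δ (X j) • pderiv j := by
  refine derivation_ext fun k => ?_
  rw [derivation_sum_apply, Finset.sum_eq_single k]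
  · simp
  · intro j _ hj
    rw [Derivation.smul_apply, pderiv_X_of_ne hj.symm, smul_zero]
  · simp

theorem homogeneousComponent_aeval_C_mul_X {A : Type*} [CommRing A] (h : A)
    (x : MvPolynomial (Fin N) A) (k : ℕ) :
    homogeneousComponent k (aeval (fun j => C h * X j : Fin N → MvPolynomial (Fin N) A) x) =
      C (h ^ k) * homogeneousComponent k x := by
  induction x using MvPolynomial.induction_on' with
  | add p q hp hq => rw [map_add, map_add, map_add, hp, hq, mul_add]
  | monomial β a =>
    have h1 : aeval (fun j => C h * X j : Fin N → MvPolynomial (Fin N) A) (monomial β a) =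
        C (h ^ β.degree) * monomial β a := by
      rw [aeval_monomial, Finsupp.prod_fintype _ _ (by simp)]
      simp only [mul_pow, Finset.prod_mul_distrib, Finset.prod_pow_eq_pow_sum]
      rw [monomial_eq, Finsupp.prod_fintype _ _ (by simp), Finsupp.degree_eq_sum, map_pow,
        algebraMap_eq]
      ring
    rw [h1, homogeneousComponent_C_mul,
      homogeneousComponent_of_mem (isHomogeneous_monomial a rfl)]
    split_ifs with hk
    · rw [hk]
    · rw [mul_zero, mul_zero]

/-- If `h ∂_j = ∑ c_{jk} D_k` for a family `D` of vector fields which is linearly independent, then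
the matrix of `D` times `c` is `h` as well. -/
theorem exists_dual_coefficients {h : MvPolynomial (Fin N) ℂ}
    {D : Fin N → Derivation ℂ (MvPolynomial (Fin N) ℂ) (MvPolynomial (Fin N) ℂ)}
    (hD : LinearIndependent (MvPolynomial (Fin N) ℂ) D)
    (hspan : ∀ j, h • (pderiv j : Derivation ℂ (MvPolynomial (Fin N) ℂ) (MvPolynomial (Fin N) ℂ)) ∈
      Submodule.span (MvPolynomial (Fin N) ℂ) (Set.range D)) :
    ∃ c : Fin N → Fin N → MvPolynomial (Fin N) ℂ,
      (∀ j, ∑ k, c j k • D k = h • pderiv j) ∧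
      ∀ i k, ∑ j, D i (X j) * c j k = if k = i then h else 0 := by
  choose c hc using fun j => (Submodule.mem_span_range_iff_exists_fun _).1 (hspan j)
  refine ⟨c, hc, fun i k => ?_⟩
  -- Both sides equal `∑ j, D_i(X_j) h ∂_j`; the coefficients are then compared by the independence
  -- of `D`.
  have h1 : ∑ k, (∑ j, D i (X j) * c j k) • D k = h • D i := by
    conv_rhs => rw [Derivation.eq_sum_smul_pderiv (D i), Finset.smul_sum]
    simp only [Finset.sum_smul]
    rw [Finset.sum_comm]
    refine Finset.sum_congr rfl fun j _ => ?_
    rw [smul_comm, ← hc, Finset.smul_sum]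
    exact Finset.sum_congr rfl fun k _ => by rw [smul_smul]
  refine congrFun (linearIndependent_iff_injective_fintypeLinearCombination.1 hD
    (a₁ := fun k => ∑ j, D i (X j) * c j k) (a₂ := fun k => if k = i then h else 0) ?_) k
  rw [Fintype.linearCombination_apply, Fintype.linearCombination_apply, h1]
  simp only [ite_smul, zero_smul]
  rw [Finset.sum_ite_eq', if_pos (Finset.mem_univ i)]

/-- Vector fields which form a basis outside `h = 0` have a regular sequence of symbols there. -/
theorem exists_pow_mul_mem_of_fieldSymbol_mul_mem {h : MvPolynomial (Fin N) ℂ} (h0 : h ≠ 0)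
    {D : Fin N → Derivation ℂ (MvPolynomial (Fin N) ℂ) (MvPolynomial (Fin N) ℂ)}
    (hD : LinearIndependent (MvPolynomial (Fin N) ℂ) D)
    (hspan : ∀ j, h • (pderiv j : Derivation ℂ (MvPolynomial (Fin N) ℂ) (MvPolynomial (Fin N) ℂ)) ∈
      Submodule.span (MvPolynomial (Fin N) ℂ) (Set.range D)) (i : Fin N)
    (x : MvPolynomial (Fin N) (MvPolynomial (Fin N) ℂ))
    (hx : fieldSymbol (D i) * x ∈ Ideal.span ((fun i => fieldSymbol (D i)) '' Set.Iio i)) :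
    ∃ k : ℕ, C h ^ k * x ∈ Ideal.span ((fun i => fieldSymbol (D i)) '' Set.Iio i) := by
  obtain ⟨c, hc, hdual⟩ := exists_dual_coefficients hD hspan
  set τ := fun i => fieldSymbol (D i) with hτ
  set J := Ideal.span (τ '' Set.Iio i) with hJ
  set φ : MvPolynomial (Fin N) (MvPolynomial (Fin N) ℂ) →ₐ[MvPolynomial (Fin N) ℂ]
    MvPolynomial (Fin N) (MvPolynomial (Fin N) ℂ) := aeval τ with hφ
  set ψ : MvPolynomial (Fin N) (MvPolynomial (Fin N) ℂ) →ₐ[MvPolynomial (Fin N) ℂ]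
    MvPolynomial (Fin N) (MvPolynomial (Fin N) ℂ) := aeval fun j => ∑ k, C (c j k) * X k with hψ
  -- The substitutions `φ` and `ψ` are inverse to each other up to the scaling `ξ ↦ h ξ`.
  have hφψ : ∀ y, φ (ψ y) = aeval (fun j => C h * X j) y := by
    suffices hcomp : φ.comp ψ = aeval fun j => C h * X j from fun y => DFunLike.congr_fun hcomp y
    refine MvPolynomial.algHom_ext fun j => ?_
    rw [AlgHom.comp_apply, hψ, aeval_X, aeval_X, map_sum, ← fieldSymbol_smul_pderiv, ← hc,
      fieldSymbol_sum_smul]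
    refine Finset.sum_congr rfl fun k _ => ?_
    rw [map_mul, hφ, aeval_X, ← algebraMap_eq, AlgHom.commutes]
  have hψτ : ∀ i, ψ (τ i) = C h * X i := by
    intro i
    calc ψ (τ i) = ∑ j, ∑ k, C (D i (X j) * c j k) * X k := by
          rw [hτ]
          simp only [fieldSymbol, map_sum, map_mul]
          refine Finset.sum_congr rfl fun j _ => ?_
          rw [← algebraMap_eq, AlgHom.commutes, hψ, aeval_X, Finset.mul_sum, algebraMap_eq]
          exact Finset.sum_congr rfl fun k _ => by rw [mul_assoc]
      _ = ∑ k, C (∑ j, D i (X j) * c j k) * X k := by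
          rw [Finset.sum_comm]
          refine Finset.sum_congr rfl fun k _ => ?_
          rw [map_sum, Finset.sum_mul]
      _ = C h * X i := by
          simp only [hdual]
          rw [Finset.sum_eq_single i] <;> simp +contextual
  -- The map `ψ` turns the symbols into `h` times the variables. For the variables regularity is
  -- read off from monomials, as `h ≠ 0` is a coefficient in a domain.
  have hψx : ψ x ∈ Ideal.span (X '' Set.Iio i) := by
    have h1 : C h * (X i * ψ x) ∈ Ideal.span (X '' Set.Iio i) := by
      rw [← mul_assoc, ← hψτ, ← map_mul]
      have h2 := Ideal.mem_map_of_mem ψ hx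
      rw [Ideal.map_span] at h2
      refine Ideal.span_le.2 ?_ h2
      rintro _ ⟨_, ⟨k, hk, rfl⟩, rfl⟩
      rw [hψτ]
      exact Ideal.mul_mem_left _ _ (Ideal.subset_span ⟨k, hk, rfl⟩)
    rw [mem_ideal_span_X_image] at h1 ⊢
    intro β hβ
    obtain ⟨k, hk, hne⟩ := h1 (Finsupp.single i 1 + β) (by
      rw [mem_support_iff] at hβ ⊢
      rw [coeff_C_mul, coeff_X_mul]
      exact mul_ne_zero h0 hβ)
    refine ⟨k, hk, ?_⟩
    rwa [Finsupp.add_apply, Finsupp.single_eq_of_ne (ne_of_lt hk), zero_add] at hne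
  have hθ : aeval (fun j => C h * X j) x ∈ J := by
    rw [← hφψ]
    have h2 := Ideal.mem_map_of_mem φ hψx
    rw [Ideal.map_span] at h2
    refine Ideal.span_le.2 ?_ h2
    rintro _ ⟨_, ⟨k, hk, rfl⟩, rfl⟩
    rw [hφ, aeval_X]
    exact Ideal.subset_span ⟨k, hk, rfl⟩
  -- The ideal `J` is generated by linear forms in `ξ`, hence it contains the homogeneous components
  -- of `x(h ξ)`, which are `h ^ k` times those of `x`.
  have hcomp : ∀ k, C (h ^ k) * homogeneousComponent k x ∈ J := by
    intro k
    rw [← homogeneousComponent_aeval_C_mul_X]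
    let _ := MvPolynomial.gradedAlgebra (σ := Fin N) (R := MvPolynomial (Fin N) ℂ)
    refine homogeneousComponent_mem_of_mem (Ideal.homogeneous_span _ _ ?_) hθ k
    rintro _ ⟨l, -, rfl⟩
    exact ⟨1, fieldSymbol_isHomogeneous (D l)⟩
  -- This power of `h` is divisible by the `h ^ k` needed for each component of `x`.
  refine ⟨x.totalDegree, ?_⟩
  rw [← sum_homogeneousComponent x, Finset.mul_sum, sum_homogeneousComponent x]
  refine sum_mem fun k hk => ?_
  have hk' : k ≤ x.totalDegree := Nat.lt_succ_iff.1 (Finset.mem_range.1 hk)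
  rw [← Nat.sub_add_cancel hk', pow_add, mul_assoc, ← map_pow C h k]
  exact Ideal.mul_mem_left _ _ (hcomp k)

end FieldSymbol

/-! ### The symbols of the family -/

section Symbols

variable {N : ℕ}

/-- The inclusion of the graded ring of differential operators on `V` into that on `ℂ × V`. -/
def grExtend (N : ℕ) : MvPolynomial (Fin N) (MvPolynomial (Fin N) ℂ) →+* GrS (N + 1) :=
  eval₂Hom ((C : MvPolynomial (Fin (N + 1)) ℂ →+* GrS (N + 1)).comp
    (rename Fin.succ : MvPolynomial (Fin N) ℂ →ₐ[ℂ] MvPolynomial (Fin (N + 1)) ℂ).toRingHom)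
    fun j => X (some j.succ)

theorem grExtend_C (a : MvPolynomial (Fin N) ℂ) : grExtend N (C a) = C (rename Fin.succ a) :=
  eval₂Hom_C _ _ _

theorem grExtend_X (j : Fin N) : grExtend N (X j) = X (some j.succ) :=
  eval₂Hom_X' _ _ _

/-! ### The graded ring as an iterated polynomial ring -/

section

variable {B : Type*} [CommRing B] (φ : MvPolynomial (Fin N) (MvPolynomial (Fin N) ℂ) ≃+* B)

/-- The inclusion of the graded ring of operators on `V` into the polynomial ring over it in `ξ_0`,
`w_0` and `s` (in this order). -/
def grPolyC :
    MvPolynomial (Fin N) (MvPolynomial (Fin N) ℂ) →+* Polynomial (Polynomial (Polynomial B)) :=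
  (Polynomial.C : Polynomial (Polynomial B) →+* Polynomial (Polynomial (Polynomial B))).comp
    (Polynomial.C.comp (Polynomial.C.comp φ.toRingHom))

/-- The variables `w_0, …, w_N`. -/
def grPolyCoord : Fin (N + 1) → Polynomial (Polynomial (Polynomial B)) :=
  Fin.cons (Polynomial.C Polynomial.X) fun j => grPolyC φ (C (X j))

/-- The variables `ξ_0, …, ξ_N`. -/
def grPolyXi : Fin (N + 1) → Polynomial (Polynomial (Polynomial B)) :=
  Fin.cons (Polynomial.C (Polynomial.C Polynomial.X)) fun j => grPolyC φ (X j)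

/-- The map to `GrPoly` of the coefficients of the graded ring. -/
def grPolyCoeff : MvPolynomial (Fin (N + 1)) ℂ →+* Polynomial (Polynomial (Polynomial B)) :=
  eval₂Hom ((grPolyC φ).comp ((C : MvPolynomial (Fin N) ℂ →+* _).comp C)) (grPolyCoord φ)

/-- The graded ring, written as a polynomial ring in `ξ_0`, `w_0` and `s`. -/
def grToPoly : GrS (N + 1) →+* Polynomial (Polynomial (Polynomial B)) :=
  eval₂Hom (grPolyCoeff φ) fun o => Option.elim o Polynomial.X (grPolyXi φ)

/-- The evaluation of a polynomial in `ξ_0`, `w_0` and `s`. -/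
def grOfPoly : Polynomial (Polynomial (Polynomial B)) →+* GrS (N + 1) :=
  Polynomial.eval₂RingHom (Polynomial.eval₂RingHom (Polynomial.eval₂RingHom ((grExtend N).comp
    φ.symm.toRingHom) (X (some 0))) (C (X 0))) (X none)

theorem grOfPoly_grPolyC (b : MvPolynomial (Fin N) (MvPolynomial (Fin N) ℂ)) :
    grOfPoly φ (grPolyC φ b) = grExtend N b := by
  simp [grOfPoly, grPolyC]

theorem grOfPoly_X : grOfPoly φ Polynomial.X = X none := by simp [grOfPoly]

theorem grOfPoly_C_X : grOfPoly φ (Polynomial.C Polynomial.X) = C (X 0) := by simp [grOfPoly]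

theorem grOfPoly_C_C_X :
    grOfPoly φ (Polynomial.C (Polynomial.C Polynomial.X)) = X (some 0) := by
  simp [grOfPoly]

theorem grToPoly_C (a : MvPolynomial (Fin (N + 1)) ℂ) : grToPoly φ (C a) = grPolyCoeff φ a :=
  eval₂Hom_C _ _ _

theorem grToPoly_X_none : grToPoly φ (X none) = Polynomial.X := eval₂Hom_X' _ _ _

theorem grToPoly_X_some (i : Fin (N + 1)) : grToPoly φ (X (some i)) = grPolyXi φ i :=
  eval₂Hom_X' _ _ _

theorem grPolyCoeff_C (a : ℂ) : grPolyCoeff φ (C a) = grPolyC φ (C (C a)) := eval₂Hom_C _ _ _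

theorem grPolyCoeff_X (i : Fin (N + 1)) : grPolyCoeff φ (X i) = grPolyCoord φ i :=
  eval₂Hom_X' _ _ _

theorem grOfPoly_comp_grToPoly : (grOfPoly φ).comp (grToPoly φ) = RingHom.id _ := by
  refine MvPolynomial.ringHom_ext (fun a => ?_) fun o => ?_
  · rw [RingHom.comp_apply, RingHom.id_apply, grToPoly_C]
    induction a using MvPolynomial.induction_on with
    | C c => rw [grPolyCoeff_C, grOfPoly_grPolyC, grExtend_C, rename_C]
    | add p q hp hq => rw [map_add, map_add, map_add, hp, hq]
    | mul_X p i hp =>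
      rw [map_mul, map_mul, map_mul, hp, grPolyCoeff_X]
      congr 1
      induction i using Fin.cases with
      | zero => exact grOfPoly_C_X φ
      | succ j => rw [grPolyCoord, Fin.cons_succ, grOfPoly_grPolyC, grExtend_C, rename_X]
  · rw [RingHom.comp_apply, RingHom.id_apply]
    cases o with
    | none => rw [grToPoly_X_none, grOfPoly_X]
    | some i =>
      rw [grToPoly_X_some]
      induction i using Fin.cases with
      | zero => exact grOfPoly_C_C_X φ
      | succ j => rw [grPolyXi, Fin.cons_succ, grOfPoly_grPolyC, grExtend_X]

theorem grToPoly_grExtend (b : MvPolynomial (Fin N) (MvPolynomial (Fin N) ℂ)) :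
    grToPoly φ (grExtend N b) = grPolyC φ b := by
  refine RingHom.congr_fun (f := (grToPoly φ).comp (grExtend N)) (g := grPolyC φ)
    (MvPolynomial.ringHom_ext (fun a => ?_) fun j => ?_) b
  · rw [RingHom.comp_apply, grExtend_C, grToPoly_C]
    induction a using MvPolynomial.induction_on with
    | C c => rw [rename_C, grPolyCoeff_C]
    | add p q hp hq => rw [map_add, map_add, map_add, map_add, hp, hq]
    | mul_X p i hp =>
      rw [map_mul, map_mul, map_mul, map_mul, hp, rename_X, grPolyCoeff_X, grPolyCoord,
        Fin.cons_succ]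
  · rw [RingHom.comp_apply, grExtend_X, grToPoly_X_some, grPolyXi, Fin.cons_succ]

theorem grToPoly_comp_grOfPoly : (grToPoly φ).comp (grOfPoly φ) = RingHom.id _ := by
  refine Polynomial.ringHom_ext' (Polynomial.ringHom_ext' (Polynomial.ringHom_ext'
    (RingHom.ext fun b => ?_) ?_) ?_) ?_
  · obtain ⟨b, rfl⟩ := φ.surjective b
    exact (congrArg _ (grOfPoly_grPolyC φ b)).trans (grToPoly_grExtend φ b)
  · exact (congrArg _ (grOfPoly_C_C_X φ)).trans (grToPoly_X_some φ 0)
  · exact (congrArg _ (grOfPoly_C_X φ)).trans ((grToPoly_C φ _).trans (grPolyCoeff_X φ 0))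
  · exact (congrArg _ (grOfPoly_X φ)).trans (grToPoly_X_none φ)

/-- The graded ring as a polynomial ring in `ξ_0`, `w_0` and `s`. -/
def grEquiv : Polynomial (Polynomial (Polynomial B)) ≃+* GrS (N + 1) :=
  RingEquiv.ofRingHom (grOfPoly φ) (grToPoly φ) (grOfPoly_comp_grToPoly φ)
    (grToPoly_comp_grOfPoly φ)

theorem grEquiv_C_C_C (b : MvPolynomial (Fin N) (MvPolynomial (Fin N) ℂ)) :
    grEquiv φ (Polynomial.C (Polynomial.C (Polynomial.C (φ b)))) = grExtend N b :=
  grOfPoly_grPolyC φ b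

theorem grEquiv_X : grEquiv φ Polynomial.X = X none := grOfPoly_X φ

theorem grEquiv_C_X : grEquiv φ (Polynomial.C Polynomial.X) = C (X 0) := grOfPoly_C_X φ

theorem grEquiv_C_C_X : grEquiv φ (Polynomial.C (Polynomial.C Polynomial.X)) = X (some 0) :=
  grOfPoly_C_C_X φ

end

/-- The symbol of a vector field on `V` as an operator on `ℂ × V`. -/
def liftSymbol (δ : Derivation ℂ (MvPolynomial (Fin N) ℂ) (MvPolynomial (Fin N) ℂ)) :
    GrS (N + 1) :=
  ∑ j, C (rename Fin.succ (δ (X j))) * X (some j.succ)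

theorem grExtend_fieldSymbol
    (δ : Derivation ℂ (MvPolynomial (Fin N) ℂ) (MvPolynomial (Fin N) ℂ)) :
    grExtend N (fieldSymbol δ) = liftSymbol δ := by
  simp only [fieldSymbol, liftSymbol, map_sum, map_mul, grExtend_C, grExtend_X]

/-- The symbols of the family `(h̃, δ_1, …, δ_n, χ̃ - d s)`. -/
def bernsteinSymbol {n : ℕ} (p : Fin N → ℚ) (d : ℕ) (h : MvPolynomial (Fin N) ℂ) (c : ℂ)
    (δ : Fin n → Derivation ℂ (MvPolynomial (Fin N) ℂ) (MvPolynomial (Fin N) ℂ)) :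
    Fin (n + 2) → GrS (N + 1) :=
  Fin.cons (C (hTilde h c d))
    (Fin.snoc (fun i => liftSymbol (δ i) : Fin n → GrS (N + 1))
      (liftSymbol (eulerField p) + C (X 0) * X (some 0) - (d : GrS (N + 1)) * X none) :
        Fin (n + 1) → GrS (N + 1))

theorem Polynomial.monic_C_mul_C_sub_C_mul_X {E : Type*} [CommRing E] {u v : E} (h : u * v = -1)
    (b : E) : (Polynomial.C u * (Polynomial.C b - Polynomial.C v * Polynomial.X)).Monic := by
  have : Polynomial.C u * (Polynomial.C b - Polynomial.C v * Polynomial.X) =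
      Polynomial.X + Polynomial.C (u * b) := by
    have h1 : (Polynomial.C u * Polynomial.C v : Polynomial E) = -1 := by
      rw [← map_mul, h, map_neg, map_one]
    rw [map_mul]
    linear_combination -Polynomial.X * h1
  rw [this]
  exact Polynomial.monic_X_add_C _

theorem RingEquiv.map_C_sub_C_mul_X {E G : Type*} [CommRing E] [CommRing G]
    (e : Polynomial E ≃+* G) (a b : E) :
    e (Polynomial.C a - Polynomial.C b * Polynomial.X) =
      e (Polynomial.C a) - e (Polynomial.C b) * e Polynomial.X := by
  rw [map_sub, map_mul]

theorem RingEquiv.map_C_C_add_X_mul_C {E G : Type*} [CommRing E] [CommRing G]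
    (e : Polynomial (Polynomial E) ≃+* G) (a b : E) :
    e (Polynomial.C (Polynomial.C a + Polynomial.X * Polynomial.C b)) =
      e (Polynomial.C (Polynomial.C a)) +
        e (Polynomial.C Polynomial.X) * e (Polynomial.C (Polynomial.C b)) := by
  rw [map_add, map_mul, map_add, map_mul]

/-- The three variables are `ξ_0`, `w_0` and `s`, from the inside out. The first entry is a constant
times a monic polynomial in `w_0`, so it may precede the `f i`; the last one is linear in `s` with
the invertible coefficient `-d`, so it may follow them whatever `b` is. -/
theorem IsWeaklyRegularFamily.adjoin_three {B : Type*} [CommRing B] {n d : ℕ} {f : Fin n → B}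
    (hf : IsWeaklyRegularFamily f) (κ : ℂ →+* B) {c : ℂ} (hd : d ≠ 0) (hc : c ≠ 0) (a b : B) :
    IsWeaklyRegularFamily
      (Fin.snoc (Fin.cons (Polynomial.C (Polynomial.C (Polynomial.C a) -
          Polynomial.C (Polynomial.C (κ c)) * Polynomial.X ^ d))
        fun i => Polynomial.C (Polynomial.C (Polynomial.C (f i))))
        (Polynomial.C (Polynomial.C (Polynomial.C b) + Polynomial.X * Polynomial.C Polynomial.X) -
          Polynomial.C (Polynomial.C (Polynomial.C (κ d))) * Polynomial.X) :
        Fin (n + 2) → Polynomial (Polynomial (Polynomial B))) := by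
  set g : Polynomial (Polynomial B) := Polynomial.C (Polynomial.C a) -
    Polynomial.C (Polynomial.C (κ c)) * Polynomial.X ^ d with hg
  set b' : Polynomial (Polynomial B) := Polynomial.C (Polynomial.C b) +
    Polynomial.X * Polynomial.C Polynomial.X
  have hgm : (Polynomial.C (Polynomial.C (κ (-c⁻¹))) * g).Monic := by
    have : Polynomial.C (Polynomial.C (κ (-c⁻¹))) * g =
        Polynomial.X ^ d - Polynomial.C (Polynomial.C (κ c⁻¹ * a)) := by
      have h1 : (Polynomial.C (Polynomial.C (κ c⁻¹)) * Polynomial.C (Polynomial.C (κ c)) :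
          Polynomial (Polynomial B)) = 1 := by
        rw [← map_mul, ← map_mul, ← map_mul, inv_mul_cancel₀ hc, map_one, map_one, map_one]
      rw [hg, map_neg, map_neg, map_neg, map_mul, map_mul]
      linear_combination Polynomial.X ^ d * h1
    rw [this]
    exact Polynomial.monic_X_pow_sub_C _ hd
  have hgm' : (Polynomial.C (Polynomial.C (Polynomial.C (κ (-(d : ℂ)⁻¹)))) *
      (Polynomial.C b' - Polynomial.C (Polynomial.C (Polynomial.C (κ d))) * Polynomial.X)).Monic := by
    refine Polynomial.monic_C_mul_C_sub_C_mul_X ?_ _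
    rw [← map_mul, ← map_mul, ← map_mul, neg_mul, inv_mul_cancel₀ (Nat.cast_ne_zero.2 hd)]
    simp only [map_neg, map_one]
  have hunit : IsUnit (Polynomial.C (Polynomial.C (κ (-c⁻¹))) : Polynomial (Polynomial B)) :=
    (((isUnit_iff_ne_zero.2 (neg_ne_zero.2 (inv_ne_zero hc))).map κ).map Polynomial.C).map
      Polynomial.C
  convert (hf.polynomial.cons_polynomial hunit hgm).snoc_polynomial hgm' using 2
  funext i
  induction i using Fin.cases <;> rfl

theorem isWeaklyRegularFamily_bernsteinSymbol_of_ringEquiv {n : ℕ} {B : Type*} [CommRing B]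
    (φ : MvPolynomial (Fin N) (MvPolynomial (Fin N) ℂ) ≃+* B) {p : Fin N → ℚ} {d : ℕ}
    {h : MvPolynomial (Fin N) ℂ} {c : ℂ}
    {δ : Fin n → Derivation ℂ (MvPolynomial (Fin N) ℂ) (MvPolynomial (Fin N) ℂ)}
    (hd : d ≠ 0) (hc : c ≠ 0) (hδ : IsWeaklyRegularFamily fun i => fieldSymbol (δ i)) :
    IsWeaklyRegularFamily (bernsteinSymbol p d h c δ) := by
  convert ((hδ.map_ringEquiv φ).adjoin_three
    (φ.toRingHom.comp ((C : MvPolynomial (Fin N) ℂ →+* _).comp C)) hd hc (φ (C h))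
    (φ (fieldSymbol (eulerField p)))).map_ringEquiv (grEquiv φ) using 1
  rw [bernsteinSymbol, Fin.cons_snoc_eq_snoc_cons]
  funext i
  induction i using Fin.lastCases with
  | last =>
    rw [Fin.snoc_last, Fin.snoc_last, RingEquiv.map_C_sub_C_mul_X,
      RingEquiv.map_C_C_add_X_mul_C, grEquiv_C_C_C, RingHom.comp_apply,
      RingEquiv.toRingHom_eq_coe, RingHom.coe_coe, grEquiv_C_C_C, grEquiv_X, grEquiv_C_X,
      grEquiv_C_C_X, grExtend_fieldSymbol, map_natCast, map_natCast]
  | cast i =>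
    rw [Fin.snoc_castSucc, Fin.snoc_castSucc]
    induction i using Fin.cases with
    | zero =>
      rw [Fin.cons_zero, Fin.cons_zero, map_sub, map_sub, map_mul, map_mul, map_pow, map_pow,
        grEquiv_C_C_C, RingHom.comp_apply, RingEquiv.toRingHom_eq_coe, RingHom.coe_coe,
        grEquiv_C_C_C, grEquiv_C_X, RingHom.comp_apply, grExtend_C, grExtend_C,
        hTilde, rename_C, map_sub, map_mul, map_pow]
    | succ i => rw [Fin.cons_succ, Fin.cons_succ, grEquiv_C_C_C, grExtend_fieldSymbol]

theorem isWeaklyRegularFamily_bernsteinSymbol {n : ℕ} {p : Fin N → ℚ} {d : ℕ}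
    {h : MvPolynomial (Fin N) ℂ} {c : ℂ}
    {δ : Fin n → Derivation ℂ (MvPolynomial (Fin N) ℂ) (MvPolynomial (Fin N) ℂ)}
    (hd : d ≠ 0) (hc : c ≠ 0) (hδ : IsWeaklyRegularFamily fun i => fieldSymbol (δ i)) :
    IsWeaklyRegularFamily (bernsteinSymbol p d h c δ) :=
  isWeaklyRegularFamily_bernsteinSymbol_of_ringEquiv (RingEquiv.refl _) hd hc hδ

end Symbols

/-! ### Vector fields as operators -/

section VectorFields

variable {N : ℕ}

/-- The polynomial vector fields on affine space. -/
abbrev VectorField (N : ℕ) : Type :=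
  Derivation ℂ (MvPolynomial (Fin N) ℂ) (MvPolynomial (Fin N) ℂ)

/-- A vector field as a differential operator. -/
def derOp (Δ : VectorField N) : WeylAlg N := ∑ j, mulOp N (Δ (X j)) * partialOp j

/-- Elements of the Weyl algebra are determined by their action on polynomials, so this reduces the
identities for `derOp` to identities of derivations. -/
theorem derOp_apply (Δ : VectorField N) (f : MvPolynomial (Fin N) ℂ) : (derOp Δ).1 f = Δ f := by
  have h : ∀ s : Finset (Fin N), (∑ j ∈ s, mulOp N (Δ (X j)) * partialOp j : WeylAlg N).1 f =
      ∑ j ∈ s, Δ (X j) * pderiv j f := by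
    classical
    intro s
    induction s using Finset.induction_on with
    | empty => rfl
    | insert a s ha ih =>
      rw [Finset.sum_insert ha, Finset.sum_insert ha, WeylAlg.add_apply, ih, WeylAlg.mul_apply,
        mulOp_apply, partialOp_apply]
  rw [derOp, h]
  conv_rhs => rw [Derivation.eq_sum_smul_pderiv Δ, derivation_sum_apply]
  rfl

theorem derOp_add (Δ Δ' : VectorField N) : derOp (Δ + Δ') = derOp Δ + derOp Δ' :=
  WeylAlg.ext_apply fun f => by
    rw [WeylAlg.add_apply, derOp_apply, derOp_apply, derOp_apply, Derivation.add_apply]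

theorem derOp_smul (a : MvPolynomial (Fin N) ℂ) (Δ : VectorField N) :
    derOp (a • Δ) = mulOp N a * derOp Δ :=
  WeylAlg.ext_apply fun f => by
    rw [WeylAlg.mul_apply, derOp_apply, derOp_apply, mulOp_apply, Derivation.smul_apply,
      smul_eq_mul]

theorem derOp_zero : derOp (0 : VectorField N) = 0 := by simp [derOp]

theorem derOp_sum_smul {κ : Type*} (s : Finset κ) (a : κ → MvPolynomial (Fin N) ℂ)
    (Δ : κ → VectorField N) : derOp (∑ i ∈ s, a i • Δ i) = ∑ i ∈ s, mulOp N (a i) * derOp (Δ i) := by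
  classical
  induction s using Finset.induction_on with
  | empty => exact derOp_zero
  | insert i s hi ih => rw [Finset.sum_insert hi, Finset.sum_insert hi, derOp_add, derOp_smul, ih]

theorem derOp_mul_mulOp (Δ : VectorField N) (a : MvPolynomial (Fin N) ℂ) :
    derOp Δ * mulOp N a = mulOp N a * derOp Δ + mulOp N (Δ a) := by
  refine WeylAlg.ext_apply fun f => ?_
  simp only [WeylAlg.mul_apply, WeylAlg.add_apply, mulOp_apply, derOp_apply, Derivation.leibniz,
    smul_eq_mul]
  ring

theorem derOp_commutator (Δ Δ' : VectorField N) :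
    derOp Δ * derOp Δ' = derOp Δ' * derOp Δ + derOp ⁅Δ, Δ'⁆ := by
  refine WeylAlg.ext_apply fun f => ?_
  simp only [WeylAlg.mul_apply, WeylAlg.add_apply, derOp_apply, Derivation.commutator_apply]
  ring

/-- A vector field on `V` as a vector field on `ℂ × V`. -/
def liftDer (δ : VectorField N) : VectorField (N + 1) :=
  ∑ j : Fin N, rename Fin.succ (δ (X j)) • (pderiv j.succ : VectorField (N + 1))

theorem liftDer_apply (δ : VectorField N) (f : MvPolynomial (Fin (N + 1)) ℂ) :
    liftDer δ f = ∑ j : Fin N, rename Fin.succ (δ (X j)) * pderiv j.succ f := by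
  rw [liftDer, derivation_sum_apply]; rfl

theorem liftDer_X_zero (δ : VectorField N) : liftDer δ (X 0) = 0 := by
  rw [liftDer_apply]
  refine Finset.sum_eq_zero fun j _ => ?_
  rw [pderiv_X_of_ne (Fin.succ_ne_zero j).symm, mul_zero]

theorem liftDer_X_succ (δ : VectorField N) (i : Fin N) :
    liftDer δ (X i.succ) = rename Fin.succ (δ (X i)) := by
  rw [liftDer_apply, Finset.sum_eq_single i]
  · rw [pderiv_X_self, mul_one]
  · intro j _ hj
    rw [pderiv_X_of_ne fun h => hj (Fin.succ_injective _ h).symm, mul_zero]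
  · simp

theorem liftDer_rename (δ : VectorField N) (f : MvPolynomial (Fin N) ℂ) :
    liftDer δ (rename Fin.succ f) = rename Fin.succ (δ f) := by
  induction f using MvPolynomial.induction_on with
  | C a => rw [rename_C, derivation_C, derivation_C, map_zero]
  | add p q hp hq => rw [map_add, map_add, map_add, map_add, hp, hq]
  | mul_X p i hp =>
    rw [map_mul, Derivation.leibniz, Derivation.leibniz, hp, rename_X, liftDer_X_succ, smul_eq_mul,
      smul_eq_mul, smul_eq_mul, smul_eq_mul, map_add, map_mul, map_mul, rename_X]

theorem liftDer_sum_smul {κ : Type*} (s : Finset κ) (a : κ → MvPolynomial (Fin N) ℂ)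
    (δ : κ → VectorField N) :
    liftDer (∑ i ∈ s, a i • δ i) = ∑ i ∈ s, rename Fin.succ (a i) • liftDer (δ i) := by
  refine derivation_ext fun i => ?_
  rw [derivation_sum_apply]
  induction i using Fin.cases with
  | zero =>
    rw [liftDer_X_zero]
    refine (Finset.sum_eq_zero fun i _ => ?_).symm
    rw [Derivation.smul_apply, liftDer_X_zero, smul_zero]
  | succ j =>
    rw [liftDer_X_succ, derivation_sum_apply, map_sum]
    refine Finset.sum_congr rfl fun i _ => ?_
    rw [Derivation.smul_apply, Derivation.smul_apply, liftDer_X_succ, smul_eq_mul, smul_eq_mul,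
      map_mul]

theorem liftField_eq_derOp (δ : VectorField N) : liftField δ = derOp (liftDer δ) := by
  rw [liftField, derOp, Fin.sum_univ_succ, liftDer_X_zero, map_zero, zero_mul, zero_add]
  exact Finset.sum_congr rfl fun j _ => by rw [liftDer_X_succ]

/-- The vector field `χ + w_0 ∂_{w_0}`. -/
def eulerLift (p : Fin N → ℚ) : VectorField (N + 1) :=
  liftDer (eulerField p) + (X 0 : MvPolynomial (Fin (N + 1)) ℂ) • (pderiv 0 : VectorField (N + 1))

theorem derOp_pderiv (i : Fin N) : derOp (pderiv i : VectorField N) = partialOp i :=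
  WeylAlg.ext_apply fun f => by rw [derOp_apply, partialOp_apply]

theorem chiTilde_eq_derOp (p : Fin N → ℚ) : chiTilde p = derOp (eulerLift p) := by
  rw [chiTilde, eulerLift, derOp_add, derOp_smul, derOp_pderiv, liftField_eq_derOp]

theorem liftDer_commutator (δ δ' : VectorField N) : ⁅liftDer δ, liftDer δ'⁆ = liftDer ⁅δ, δ'⁆ := by
  refine derivation_ext fun i => ?_
  rw [Derivation.commutator_apply]
  induction i using Fin.cases with
  | zero => simp only [liftDer_X_zero, map_zero, sub_zero]
  | succ j =>
    simp only [liftDer_X_succ, liftDer_rename, Derivation.commutator_apply, map_sub]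

theorem pderiv_zero_rename_succ (f : MvPolynomial (Fin N) ℂ) :
    pderiv (0 : Fin (N + 1)) (rename Fin.succ f) = 0 := by
  induction f using MvPolynomial.induction_on with
  | C a => rw [rename_C, pderiv_C]
  | add p q hp hq => rw [map_add, map_add, hp, hq, add_zero]
  | mul_X p i hp =>
    rw [map_mul, pderiv_mul, hp, rename_X, pderiv_X_of_ne (Fin.succ_ne_zero i), mul_zero, zero_mul,
      add_zero]

theorem eulerLift_X_zero (p : Fin N → ℚ) : eulerLift p (X 0) = X 0 := by
  rw [eulerLift, Derivation.add_apply, liftDer_X_zero, Derivation.smul_apply, pderiv_X_self,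
    zero_add, smul_eq_mul, mul_one]

theorem eulerLift_rename (p : Fin N → ℚ) (f : MvPolynomial (Fin N) ℂ) :
    eulerLift p (rename Fin.succ f) = rename Fin.succ (eulerField p f) := by
  rw [eulerLift, Derivation.add_apply, Derivation.smul_apply, pderiv_zero_rename_succ, smul_zero,
    add_zero, liftDer_rename]

theorem eulerLift_X_succ (p : Fin N → ℚ) (i : Fin N) :
    eulerLift p (X i.succ) = rename Fin.succ (eulerField p (X i)) := by
  rw [← rename_X, eulerLift_rename]

/-- The summand `w_0 ∂_{w_0}` commutes with lifted fields, as neither their coefficients nor their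
derivatives involve `w_0`. -/
theorem eulerLift_commutator (p : Fin N → ℚ) (δ : VectorField N) :
    ⁅eulerLift p, liftDer δ⁆ = liftDer ⁅eulerField p, δ⁆ := by
  refine derivation_ext fun i => ?_
  rw [Derivation.commutator_apply]
  induction i using Fin.cases with
  | zero => simp only [liftDer_X_zero, eulerLift_X_zero, map_zero, sub_zero]
  | succ j =>
    simp only [liftDer_X_succ, eulerLift_X_succ, eulerLift_rename, liftDer_rename,
      Derivation.commutator_apply, map_sub]

/-- The operator `Δ - e s` for a vector field `Δ`. -/
def fieldOp (Δ : VectorField N) (e : ℕ) : WeylAlgS N :=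
  Polynomial.C (derOp Δ) - (e : WeylAlgS N) * Polynomial.X

/-- As `s` is central, it disappears from the bracket of the operators. -/
theorem fieldOp_commutator (Δ Δ' : VectorField N) (e e' : ℕ) :
    fieldOp Δ e * fieldOp Δ' e' - fieldOp Δ' e' * fieldOp Δ e = fieldOp ⁅Δ, Δ'⁆ 0 := by
  have h : (Polynomial.C (derOp Δ) * Polynomial.C (derOp Δ') : WeylAlgS N) =
      Polynomial.C (derOp Δ') * Polynomial.C (derOp Δ) + Polynomial.C (derOp ⁅Δ, Δ'⁆) := by
    rw [← map_mul, derOp_commutator, map_add, map_mul]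
  have hX : ∀ (P : WeylAlgS N) (e : ℕ), P * ((e : WeylAlgS N) * Polynomial.X) =
      (e : WeylAlgS N) * Polynomial.X * P := fun P e => by
    rw [mul_assoc, Polynomial.X_mul, ← mul_assoc, ← mul_assoc, (Nat.cast_commute e P).eq]
  rw [fieldOp, fieldOp, fieldOp, Nat.cast_zero, zero_mul, sub_zero, sub_mul, sub_mul, mul_sub,
    mul_sub, mul_sub, mul_sub, h, hX (Polynomial.C (derOp Δ)) e', hX (Polynomial.C (derOp Δ')) e,
    hX ((e : WeylAlgS N) * Polynomial.X) e']
  abel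

theorem fieldOp_mul_coeffOp (Δ : VectorField N) (e : ℕ) (a : MvPolynomial (Fin N) ℂ) :
    fieldOp Δ e * coeffOp N a - coeffOp N a * fieldOp Δ e = coeffOp N (Δ a) := by
  have h : (Polynomial.C (derOp Δ) * coeffOp N a : WeylAlgS N) =
      coeffOp N a * Polynomial.C (derOp Δ) + coeffOp N (Δ a) := by
    simp only [coeffOp, RingHom.comp_apply]
    rw [← map_mul, derOp_mul_mulOp, map_add, map_mul]
  have hX : coeffOp N a * ((e : WeylAlgS N) * Polynomial.X) =
      (e : WeylAlgS N) * Polynomial.X * coeffOp N a := by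
    rw [mul_assoc, Polynomial.X_mul, ← mul_assoc, ← mul_assoc, (Nat.cast_commute e _).eq]
  rw [fieldOp, sub_mul, mul_sub, h, hX]
  abel

theorem fieldOp_sum_smul {κ : Type*} (s : Finset κ) (a : κ → MvPolynomial (Fin N) ℂ)
    (Δ : κ → VectorField N) :
    fieldOp (∑ i ∈ s, a i • Δ i) 0 = ∑ i ∈ s, coeffOp N (a i) * fieldOp (Δ i) 0 := by
  simp only [fieldOp, Nat.cast_zero, zero_mul, sub_zero, derOp_sum_smul, map_sum, map_mul, coeffOp,
    RingHom.comp_apply]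

end VectorFields

/-! ### Logarithmic vector fields of a quasi-homogeneous free divisor -/

section Logarithmic

variable {N : ℕ}

theorem eulerField_apply_of_isWeightedHomogeneous {p : Fin N → ℚ} {h : MvPolynomial (Fin N) ℂ}
    {q : ℚ} (hqh : IsWeightedHomogeneous p h q) : eulerField p h = C (q : ℂ) * h := by
  have hmon : ∀ β ∈ h.support,
      eulerField p (monomial β (coeff β h)) = C (q : ℂ) * monomial β (coeff β h) := by
    intro β hβ
    have hw := hqh (mem_support_iff.1 hβ)
    have h1 : ∀ j, (C (p j : ℂ) * X j) * pderiv j (monomial β (coeff β h)) =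
        C ((β j : ℂ) * (p j : ℂ)) * monomial β (coeff β h) := by
      intro j
      rw [mul_assoc, X_mul_pderiv_monomial, nsmul_eq_mul, ← map_natCast (C : ℂ →+* _), ← mul_assoc,
        ← map_mul, mul_comm (p j : ℂ)]
    rw [eulerField, derivation_sum_apply]
    simp only [Derivation.smul_apply, smul_eq_mul, h1]
    rw [← Finset.sum_mul, ← map_sum]
    congr 2
    rw [← hw, Finsupp.weight_apply, Finsupp.sum_fintype β (fun i c => c • p i) fun _ => zero_nsmul _]
    simp
  conv_lhs => rw [h.as_sum, map_sum]
  conv_rhs => rw [h.as_sum, Finset.mul_sum]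
  exact Finset.sum_congr rfl hmon

theorem smul_pderiv_mem_logDer (h : MvPolynomial (Fin N) ℂ) (j : Fin N) :
    h • (pderiv j : VectorField N) ∈ logDer h := ⟨pderiv j h, rfl⟩

theorem eq_C_of_pderiv_eq_zero {f : MvPolynomial (Fin N) ℂ} (hf : ∀ j, pderiv j f = 0) :
    f = C (coeff 0 f) := by
  classical
  ext1 β
  rw [coeff_C]
  split_ifs with h
  · rw [h]
  · by_contra h0
    obtain ⟨j, hj⟩ : ∃ j, β j ≠ 0 := by
      by_contra hcon
      push Not at hcon
      exact h (Finsupp.ext fun j => (hcon j).symm)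
    have h1 := congrArg (coeff (β - Finsupp.single j 1)) (hf j)
    rw [coeff_pderiv, coeff_zero, tsub_add_cancel_of_le
      (Finsupp.single_le_iff.2 (Nat.one_le_iff_ne_zero.2 hj))] at h1
    rcases mul_eq_zero.1 h1 with h2 | h2
    · exact h0 h2
    · exact Nat.cast_add_one_ne_zero _ h2

end Logarithmic

/-! ### Lie–Rinehart families -/

section LieRinehart

variable {A R : Type*} [CommRing A] [Ring R] {ι : A →+* R} {m : ℕ} {r : Fin m → R}

theorem add_mem_lieSpan {x y : R} (hx : x ∈ lieSpan ι r) (hy : y ∈ lieSpan ι r) :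
    x + y ∈ lieSpan ι r := by
  obtain ⟨a, rfl⟩ := hx
  obtain ⟨b, rfl⟩ := hy
  exact ⟨a + b, by simp only [Pi.add_apply, map_add, add_mul, Finset.sum_add_distrib]⟩

theorem mul_mem_lieSpan (a : A) {x : R} (hx : x ∈ lieSpan ι r) : ι a * x ∈ lieSpan ι r := by
  obtain ⟨b, rfl⟩ := hx
  exact ⟨fun i => a * b i, by simp only [Finset.mul_sum, map_mul, mul_assoc]⟩

theorem neg_mem_lieSpan {x : R} (hx : x ∈ lieSpan ι r) : -x ∈ lieSpan ι r := by
  have := mul_mem_lieSpan (-1) hx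
  rwa [map_neg, map_one, neg_one_mul] at this

theorem zero_mem_lieSpan : (0 : R) ∈ lieSpan ι r := ⟨0, by simp⟩

theorem sum_mem_lieSpan {κ : Type*} (s : Finset κ) {x : κ → R} (hx : ∀ i ∈ s, x i ∈ lieSpan ι r) :
    ∑ i ∈ s, x i ∈ lieSpan ι r :=
  Finset.sum_induction x (· ∈ lieSpan ι r) (fun _ _ => add_mem_lieSpan) zero_mem_lieSpan hx

theorem mem_lieSpan (i : Fin m) : r i ∈ lieSpan ι r :=
  ⟨Pi.single i 1, by
    rw [Finset.sum_eq_single i]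
    · simp
    · intro b _ hb
      simp [Pi.single_eq_of_ne hb]
    · simp⟩

/-- Closedness under brackets may be checked on the generators. -/
theorem IsLieRinehartFamily.of_generators
    (hindep : ∀ a : Fin m → A, ∑ i, ι (a i) * r i = 0 → ∀ i, a i = 0)
    (hanchor : ∀ i a, ∃ b, r i * ι a - ι a * r i = ι b)
    (hbr : ∀ i j, r i * r j - r j * r i ∈ lieSpan ι r) : IsLieRinehartFamily ι r := by
  refine ⟨hindep, ?_⟩
  rintro _ ⟨a, rfl⟩ _ ⟨b, rfl⟩
  rw [Finset.sum_mul_sum, Finset.sum_mul_sum, Finset.sum_comm, ← Finset.sum_sub_distrib]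
  refine sum_mem_lieSpan _ fun j _ => ?_
  rw [← Finset.sum_sub_distrib]
  refine sum_mem_lieSpan _ fun i _ => ?_
  obtain ⟨β, hβ⟩ := hanchor i (b j)
  obtain ⟨α, hα⟩ := hanchor j (a i)
  have hcomm : ι (a i) * ι (b j) = ι (b j) * ι (a i) := by rw [← map_mul, mul_comm, map_mul]
  have key : ι (a i) * r i * (ι (b j) * r j) - ι (b j) * r j * (ι (a i) * r i) =
      ι (a i * b j) * (r i * r j - r j * r i) + ι (a i * β) * r j + -(ι (b j * α) * r i) := by
    rw [map_mul, map_mul, map_mul, ← hβ, ← hα]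
    have : ι (a i) * ι (b j) * (r j * r i) = ι (b j) * ι (a i) * (r j * r i) := by rw [hcomm]
    rw [mul_sub (ι (a i) * ι (b j)), this]
    noncomm_ring
  rw [key]
  exact add_mem_lieSpan (add_mem_lieSpan (mul_mem_lieSpan _ (hbr i j))
    (mul_mem_lieSpan _ (mem_lieSpan j))) (neg_mem_lieSpan (mul_mem_lieSpan _ (mem_lieSpan i)))

variable (hr : IsLieRinehartFamily ι r)

theorem structureConst_spec (i j : Fin m) :
    r i * r j - r j * r i = ∑ k, ι (structureConst hr i j k) * r k :=
  Classical.choose_spec (hr.exists_structureConst i j)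

theorem IsLieRinehartFamily.eq_of_sum_eq (hr : IsLieRinehartFamily ι r) {a b : Fin m → A}
    (h : ∑ i, ι (a i) * r i = ∑ i, ι (b i) * r i) (i : Fin m) : a i = b i := by
  refine sub_eq_zero.1 (hr.indep (fun i => a i - b i) ?_ i)
  simp only [map_sub, sub_mul, Finset.sum_sub_distrib, h, sub_self]

theorem structureConst_eq {i j : Fin m} {a : Fin m → A}
    (h : r i * r j - r j * r i = ∑ k, ι (a k) * r k) (k : Fin m) : structureConst hr i j k = a k :=
  hr.eq_of_sum_eq ((structureConst_spec hr i j).symm.trans h) k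

theorem structureConst_antisymm (i j k : Fin m) :
    structureConst hr i j k = -structureConst hr j i k := by
  refine structureConst_eq hr (a := fun k => -structureConst hr j i k) ?_ k
  simp only [map_neg, neg_mul, Finset.sum_neg_distrib, ← structureConst_spec hr j i, neg_sub]

/-- The Jacobi identity of commutators in `R`, expanded in the `r k` and compared by independence.
The comparison requires coefficients in `A`, which `hanchor` provides: bracketing `r i` with an
element of `A` stays in `A`. -/
theorem structureConst_jacobi (hanchor : ∀ i a, ∃ b, r i * ι a - ι a * r i = ι b)
    (l i j k : Fin m) :
    (r l * ι (structureConst hr i j k) - ι (structureConst hr i j k) * r l +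
        ∑ a, ι (structureConst hr i j a) * ι (structureConst hr l a k)) +
      (r i * ι (structureConst hr j l k) - ι (structureConst hr j l k) * r i +
        ∑ a, ι (structureConst hr j l a) * ι (structureConst hr i a k)) +
      (r j * ι (structureConst hr l i k) - ι (structureConst hr l i k) * r j +
        ∑ a, ι (structureConst hr l i a) * ι (structureConst hr j a k)) = 0 := by
  choose D hD using hanchor
  set c := structureConst hr with hc
  set t : Fin m → Fin m → Fin m → Fin m → A := fun l i j k =>
    D l (c i j k) + ∑ a, c i j a * c l a k with ht
  have hT : ∀ l i j k, r l * ι (c i j k) - ι (c i j k) * r l + ∑ a, ι (c i j a) * ι (c l a k) =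
      ι (t l i j k) := fun l i j k => by simp only [ht, hD, map_add, map_sum, map_mul]
  have hbr : ∀ l i j, r l * (r i * r j - r j * r i) - (r i * r j - r j * r i) * r l =
      ∑ k, ι (t l i j k) * r k := by
    intro l i j
    have h1 : ∀ a, r l * (ι (c i j a) * r a) - ι (c i j a) * r a * r l =
        ι (D l (c i j a)) * r a + ι (c i j a) * ∑ k, ι (c l a k) * r k := by
      intro a
      rw [← hD, hc, ← structureConst_spec hr l a]
      noncomm_ring
    rw [structureConst_spec hr i j, Finset.mul_sum, Finset.sum_mul, ← Finset.sum_sub_distrib,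
      Finset.sum_congr rfl fun a _ => h1 a]
    simp only [ht, map_add, map_sum, map_mul, add_mul, Finset.sum_add_distrib,
      Finset.mul_sum, Finset.sum_mul, mul_assoc]
    rw [Finset.sum_comm]
  rw [hT, hT, hT, ← map_add, ← map_add]
  have h0 := hr.indep (fun k => t l i j k + t i j l k + t j l i k) (by
    simp only [map_add, add_mul, Finset.sum_add_distrib, ← hbr]
    noncomm_ring) k
  rw [h0, map_zero]

theorem totalD_structureConst_mul_self (htors : ∀ x : R, (24 : ℕ) • x = 0 → x = 0)
    (hanchor : ∀ i a, ∃ b, r i * ι a - ι a * r i = ι b) :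
    totalD r (fun i j k => ι (structureConst hr i j k)) *
      totalD r (fun i j k => ι (structureConst hr i j k)) = 0 :=
  totalD_mul_self htors r _ (fun _ _ _ _ _ _ => by rw [← map_mul, mul_comm, map_mul])
    (fun i j k => by rw [structureConst_antisymm, map_neg]) (structureConst_spec hr)
    (structureConst_jacobi hr hanchor)

end LieRinehart

/-! ### The free divisor and the lifted vector fields -/

section FreeDivisor

variable {n : ℕ} {p : Fin (n + 1) → ℚ} {d : ℕ} {h : MvPolynomial (Fin (n + 1)) ℂ} {c : ℂ}
  {δ : Fin n → VectorField (n + 1)}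

theorem isUnit_notMem_of_isRegular {G : Type*} [CommRing G] {rs : List G}
    (hrs : RingTheory.Sequence.IsRegular G rs) {x : G} (hx : x ∈ rs) : ¬ IsUnit x := by
  intro hu
  refine hrs.top_ne_smul ?_
  rw [smul_eq_mul, Ideal.mul_top]
  exact (Ideal.eq_top_of_isUnit_mem (Ideal.ofList rs) (Ideal.subset_span hx) hu).symm

/-- If `d = 0`, every logarithmic field annihilates `h`. As each `h ∂_j` is logarithmic, `h` is a
nonzero constant, which cannot be a member of a regular sequence. -/
theorem degree_ne_zero (hred : Squarefree h) (hqh : IsWeightedHomogeneous p h (d : ℚ))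
    (hδ : ∀ i, δ i h = 0)
    (hspan : Submodule.span (MvPolynomial (Fin (n + 1)) ℂ)
      (Set.range (Fin.snoc δ (eulerField p) : Fin (n + 1) → VectorField (n + 1))) = logDer h)
    (hSK : StronglyKoszul h δ) : d ≠ 0 := by
  rintro rfl
  have hD : ∀ i, (Fin.snoc δ (eulerField p) : Fin (n + 1) → VectorField (n + 1)) i h = 0 := by
    intro i
    induction i using Fin.lastCases with
    | last =>
      rw [Fin.snoc_last, eulerField_apply_of_isWeightedHomogeneous hqh]; simp
    | cast i => rw [Fin.snoc_castSucc, hδ]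
  have hh : ∀ j, pderiv j h = 0 := by
    intro j
    obtain ⟨a, ha⟩ := (Submodule.mem_span_range_iff_exists_fun _).1
      (hspan.symm ▸ smul_pderiv_mem_logDer h j)
    have h1 := congrArg (fun η : VectorField (n + 1) => η h) ha
    simp only [derivation_sum_apply, Derivation.smul_apply, hD, smul_eq_mul, mul_zero,
      Finset.sum_const_zero] at h1
    exact (mul_eq_zero.1 h1.symm).resolve_left hred.ne_zero
  have h0 := eq_C_of_pderiv_eq_zero hh
  have h1 : coeff 0 h ≠ 0 := fun h2 => hred.ne_zero (by rw [h0, h2, map_zero])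
  refine isUnit_notMem_of_isRegular hSK List.mem_cons_self ?_
  rw [h0]
  exact ((isUnit_iff_ne_zero.2 h1).map C).map C

/-- The vector fields which annihilate `h` are spanned by the `δ_i`. -/
theorem exists_eq_sum_smul_of_apply_eq_zero (hh : h ≠ 0) (hd : d ≠ 0)
    (hqh : IsWeightedHomogeneous p h (d : ℚ)) (hδ : ∀ i, δ i h = 0)
    (hspan : Submodule.span (MvPolynomial (Fin (n + 1)) ℂ)
      (Set.range (Fin.snoc δ (eulerField p) : Fin (n + 1) → VectorField (n + 1))) = logDer h)
    {η : VectorField (n + 1)} (hη : η h = 0) :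
    ∃ b : Fin n → MvPolynomial (Fin (n + 1)) ℂ, η = ∑ k, b k • δ k := by
  have hmem : η ∈ logDer h := by
    change h ∣ η h
    rw [hη]
    exact dvd_zero h
  obtain ⟨a, rfl⟩ := (Submodule.mem_span_range_iff_exists_fun _).1 (hspan.symm ▸ hmem)
  rw [Fin.sum_univ_castSucc] at hη ⊢
  simp only [Fin.snoc_castSucc, Fin.snoc_last] at hη ⊢
  rw [Derivation.add_apply, derivation_sum_apply, Finset.sum_eq_zero fun i _ => by
    rw [Derivation.smul_apply, hδ, smul_zero], zero_add, Derivation.smul_apply,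
    eulerField_apply_of_isWeightedHomogeneous hqh, smul_eq_mul] at hη
  have hC : (C (((d : ℚ) : ℂ)) : MvPolynomial (Fin (n + 1)) ℂ) ≠ 0 := by
    rw [Ne, map_eq_zero_iff _ (C_injective _ _)]
    simpa using hd
  have h0 := (mul_eq_zero.1 hη).resolve_right (mul_ne_zero hC hh)
  exact ⟨fun i => a i.castSucc, by rw [h0, zero_smul, add_zero]⟩

/-- The leading `h` of the strong Koszul sequence is dropped with `of_cons`. The condition after
inverting `h` holds because the basis of logarithmic fields spans all `h ∂_j`. -/
theorem isWeaklyRegularFamily_fieldSymbol (hh : h ≠ 0)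
    (hindep : LinearIndependent (MvPolynomial (Fin (n + 1)) ℂ)
      (Fin.snoc δ (eulerField p) : Fin (n + 1) → VectorField (n + 1)))
    (hspan : Submodule.span (MvPolynomial (Fin (n + 1)) ℂ)
      (Set.range (Fin.snoc δ (eulerField p) : Fin (n + 1) → VectorField (n + 1))) = logDer h)
    (hSK : StronglyKoszul h δ) : IsWeaklyRegularFamily fun i => fieldSymbol (δ i) := by
  have h1 : RingTheory.Sequence.IsWeaklyRegular
      (MvPolynomial (Fin (n + 1)) (MvPolynomial (Fin (n + 1)) ℂ))
      (List.ofFn (Fin.cons (C h) fun i => fieldSymbol (δ i) : Fin (n + 1) → _)) := by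
    rw [List.ofFn_cons]
    exact hSK.toIsWeaklyRegular
  refine (isWeaklyRegular_ofFn_iff.1 h1).of_cons fun i x hx => ?_
  have key := exists_pow_mul_mem_of_fieldSymbol_mul_mem hh hindep
    (fun j => hspan.symm ▸ smul_pderiv_mem_logDer h j) i.castSucc x
  have himg : (fun j => fieldSymbol ((Fin.snoc δ (eulerField p) :
      Fin (n + 1) → VectorField (n + 1)) j)) '' Set.Iio i.castSucc =
      (fun j => fieldSymbol (δ j)) '' Set.Iio i := by
    have h2 := congrArg (fieldSymbol '' ·) (snoc_image_Iio_castSucc δ (eulerField p) i)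
    simpa only [Set.image_image] using h2
  rw [himg, Fin.snoc_castSucc] at key
  exact key hx

theorem hTilde_ne_zero (hd : d ≠ 0) (hc : c ≠ 0) : hTilde h c d ≠ 0 := by
  intro h0
  have key : ∀ t : ℂ, eval (0 : Fin (n + 1) → ℂ) h = c * t ^ d := by
    intro t
    have h1 := congrArg (eval (Fin.cons t 0 : Fin (n + 2) → ℂ)) h0
    rw [hTilde, map_sub, eval_rename, map_mul, map_pow, eval_C, eval_X, Fin.cons_zero, map_zero,
      sub_eq_zero] at h1
    rw [← h1]
    rfl
  have h1 := (key 0).symm.trans (key 1)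
  rw [zero_pow hd, mul_zero, one_pow, mul_one] at h1
  exact hc h1.symm

/-- The vector fields `δ_1, …, δ_n, χ + w_0 ∂_{w_0}`. -/
def liftFamily (p : Fin (n + 1) → ℚ) (δ : Fin n → VectorField (n + 1)) :
    Fin (n + 1) → VectorField (n + 2) :=
  Fin.snoc (fun i => liftDer (δ i)) (eulerLift p)

/-- The integers `e_i` with `Δ_i (h̃) = e_i h̃` for the fields `Δ_i` of `liftFamily`. -/
def liftEigenvalue (n d : ℕ) : Fin (n + 1) → ℕ := Fin.snoc (fun _ => 0) d

theorem bernsteinFamily_zero : bernsteinFamily p d h c δ 0 = coeffOp (n + 2) (hTilde h c d) := rfl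

theorem bernsteinFamily_succ (i : Fin (n + 1)) :
    bernsteinFamily p d h c δ i.succ = fieldOp (liftFamily p δ i) (liftEigenvalue n d i) := by
  rw [bernsteinFamily, Fin.cons_succ, liftFamily, liftEigenvalue, fieldOp]
  induction i using Fin.lastCases with
  | last => rw [Fin.snoc_last, Fin.snoc_last, Fin.snoc_last, chiTilde_eq_derOp]
  | cast i =>
    rw [Fin.snoc_castSucc, Fin.snoc_castSucc, Fin.snoc_castSucc, liftField_eq_derOp, Nat.cast_zero,
      zero_mul, sub_zero]

/-- The coordinate `w_0` has weight 1 for `χ̃`, so `w_0 ^ d` has the same weight `d` as `h`; the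
lifted `δ_i` annihilate both terms. -/
theorem liftFamily_hTilde (hqh : IsWeightedHomogeneous p h (d : ℚ)) (hδ : ∀ i, δ i h = 0)
    (i : Fin (n + 1)) :
    liftFamily p δ i (hTilde h c d) = (liftEigenvalue n d i : MvPolynomial (Fin (n + 2)) ℂ) *
      hTilde h c d := by
  rw [liftFamily, liftEigenvalue, hTilde, map_sub]
  induction i using Fin.lastCases with
  | last =>
    rw [Fin.snoc_last, Fin.snoc_last, eulerLift_rename,
      eulerField_apply_of_isWeightedHomogeneous hqh, Derivation.leibniz, Derivation.leibniz_pow,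
      eulerLift_X_zero, derivation_C, map_mul, rename_C, smul_zero, add_zero, smul_eq_mul,
      nsmul_eq_mul, Rat.cast_natCast, map_natCast]
    -- The case distinction resolves the truncated exponent `d - 1` of the Leibniz rule.
    rcases d with _ | d
    · simp
    · rw [Nat.add_sub_cancel]
      simp only [smul_eq_mul]
      ring
  | cast i =>
    rw [Fin.snoc_castSucc, Fin.snoc_castSucc, liftDer_rename, hδ, Derivation.leibniz,
      Derivation.leibniz_pow, liftDer_X_zero, derivation_C]
    simp

theorem bernsteinFamily_anchor (i : Fin (n + 2)) (a : MvPolynomial (Fin (n + 2)) ℂ) :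
    ∃ b, bernsteinFamily p d h c δ i * coeffOp (n + 2) a -
      coeffOp (n + 2) a * bernsteinFamily p d h c δ i = coeffOp (n + 2) b := by
  induction i using Fin.cases with
  | zero =>
    exact ⟨0, by rw [bernsteinFamily_zero, ← map_mul, ← map_mul, mul_comm, sub_self, map_zero]⟩
  | succ i => exact ⟨liftFamily p δ i a, by rw [bernsteinFamily_succ, fieldOp_mul_coeffOp]⟩

/-- Brackets of the fields annihilate `h`, so they involve the lifted `δ_k` only and never the Euler
field. This is needed because the Euler field occurs in the family only together with `-d s`, and
brackets contain no `s`. -/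
theorem exists_liftFamily_bracket (hh : h ≠ 0) (hd : d ≠ 0)
    (hqh : IsWeightedHomogeneous p h (d : ℚ)) (hδ : ∀ i, δ i h = 0)
    (hspan : Submodule.span (MvPolynomial (Fin (n + 1)) ℂ)
      (Set.range (Fin.snoc δ (eulerField p) : Fin (n + 1) → VectorField (n + 1))) = logDer h)
    (i j : Fin (n + 1)) : ∃ b : Fin n → MvPolynomial (Fin (n + 2)) ℂ,
      ⁅liftFamily p δ i, liftFamily p δ j⁆ = ∑ k, b k • liftDer (δ k) := by
  have key : ∀ η : VectorField (n + 1), η h = 0 → ∃ b : Fin n → MvPolynomial (Fin (n + 2)) ℂ,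
      liftDer η = ∑ k, b k • liftDer (δ k) := by
    intro η hη
    obtain ⟨b, rfl⟩ := exists_eq_sum_smul_of_apply_eq_zero hh hd hqh hδ hspan hη
    exact ⟨fun k => rename Fin.succ (b k), liftDer_sum_smul _ _ _⟩
  -- From `χ(δ_i h) = 0` and `δ_i(χ h) = d δ_i(h) = 0`.
  have hχ : ∀ i, ⁅eulerField p, δ i⁆ h = 0 := fun i => by
    rw [Derivation.commutator_apply, hδ, eulerField_apply_of_isWeightedHomogeneous hqh,
      Derivation.leibniz, derivation_C, hδ]
    simp
  rw [liftFamily]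
  induction i using Fin.lastCases with
  | last =>
    rw [Fin.snoc_last]
    induction j using Fin.lastCases with
    | last => rw [Fin.snoc_last, lie_self]; exact ⟨0, by simp⟩
    | cast j =>
      rw [Fin.snoc_castSucc, eulerLift_commutator]
      exact key _ (hχ j)
  | cast i =>
    rw [Fin.snoc_castSucc]
    induction j using Fin.lastCases with
    | last =>
      rw [Fin.snoc_last, ← lie_skew, eulerLift_commutator]
      obtain ⟨b, hb⟩ := key _ (hχ i)
      refine ⟨fun k => -b k, ?_⟩
      rw [hb, ← Finset.sum_neg_distrib]
      exact Finset.sum_congr rfl fun k _ => (neg_smul _ _).symm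
    | cast j =>
      rw [Fin.snoc_castSucc, liftDer_commutator]
      exact key _ (by rw [Derivation.commutator_apply, hδ, hδ, map_zero, map_zero, sub_zero])

end FreeDivisor

/-! ### Brackets, independence and symbols of the family -/

section BernsteinFamily

variable {n : ℕ} {p : Fin (n + 1) → ℚ} {d : ℕ} {h : MvPolynomial (Fin (n + 1)) ℂ} {c : ℂ}
  {δ : Fin n → VectorField (n + 1)}

/-- The bracket with `h̃` is `-Δ_j(h̃)`, a multiple of `h̃` itself. That no other generator occurs
is also what the bound on the orders requires. -/
theorem bernsteinFamily_bracket_zero (hqh : IsWeightedHomogeneous p h (d : ℚ))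
    (hδ : ∀ i, δ i h = 0) (j : Fin (n + 2)) :
    ∃ b, bernsteinFamily p d h c δ 0 * bernsteinFamily p d h c δ j -
      bernsteinFamily p d h c δ j * bernsteinFamily p d h c δ 0 =
        ∑ k, coeffOp (n + 2) ((Pi.single 0 b : Fin (n + 2) → MvPolynomial (Fin (n + 2)) ℂ) k) *
          bernsteinFamily p d h c δ k := by
  have hsum : ∀ b, ∑ k, coeffOp (n + 2)
      ((Pi.single 0 b : Fin (n + 2) → MvPolynomial (Fin (n + 2)) ℂ) k) *
        bernsteinFamily p d h c δ k = coeffOp (n + 2) b * bernsteinFamily p d h c δ 0 := by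
    intro b
    rw [Finset.sum_eq_single 0, Pi.single_eq_same]
    · intro k _ hk
      rw [Pi.single_eq_of_ne hk, map_zero, zero_mul]
    · simp
  simp only [hsum]
  induction j using Fin.cases with
  | zero => exact ⟨0, by rw [map_zero, zero_mul, sub_self]⟩
  | succ j =>
    refine ⟨-(liftEigenvalue n d j : MvPolynomial (Fin (n + 2)) ℂ), ?_⟩
    rw [bernsteinFamily_succ, bernsteinFamily_zero, ← neg_sub, fieldOp_mul_coeffOp,
      liftFamily_hTilde hqh hδ, map_neg, map_mul, neg_mul]

theorem bernsteinFamily_bracket_mem (hh : h ≠ 0) (hd : d ≠ 0)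
    (hqh : IsWeightedHomogeneous p h (d : ℚ)) (hδ : ∀ i, δ i h = 0)
    (hspan : Submodule.span (MvPolynomial (Fin (n + 1)) ℂ)
      (Set.range (Fin.snoc δ (eulerField p) : Fin (n + 1) → VectorField (n + 1))) = logDer h)
    (i j : Fin (n + 2)) :
    bernsteinFamily p d h c δ i * bernsteinFamily p d h c δ j -
      bernsteinFamily p d h c δ j * bernsteinFamily p d h c δ i ∈
        lieSpan (coeffOp (n + 2)) (bernsteinFamily p d h c δ) := by
  induction i using Fin.cases with
  | zero =>
    obtain ⟨b, hb⟩ := bernsteinFamily_bracket_zero (c := c) hqh hδ j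
    exact ⟨_, hb⟩
  | succ i =>
    induction j using Fin.cases with
    | zero =>
      obtain ⟨b, hb⟩ := bernsteinFamily_bracket_zero (c := c) hqh hδ i.succ
      rw [← neg_sub]
      exact neg_mem_lieSpan ⟨_, hb⟩
    | succ j =>
      obtain ⟨b, hb⟩ := exists_liftFamily_bracket hh hd hqh hδ hspan i j
      rw [bernsteinFamily_succ, bernsteinFamily_succ, fieldOp_commutator, hb, fieldOp_sum_smul]
      refine sum_mem_lieSpan _ fun k _ => mul_mem_lieSpan _ ?_
      have hk : bernsteinFamily p d h c δ k.castSucc.succ = fieldOp (liftDer (δ k)) 0 := by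
        rw [bernsteinFamily_succ, liftFamily, liftEigenvalue, Fin.snoc_castSucc, Fin.snoc_castSucc]
      rw [← hk]
      exact mem_lieSpan _

theorem eval_liftSymbol (δ : VectorField (n + 1))
    (v : Option (Fin (n + 2)) → MvPolynomial (Fin (n + 2)) ℂ) :
    eval v (liftSymbol δ) = ∑ j, rename Fin.succ (δ (X j)) * v (some j.succ) := by
  simp only [liftSymbol, map_sum, map_mul, eval_C, eval_X]

/-- A relation is evaluated at special values of `ξ` and `s`: zero isolates `h̃`, the unit vector of
`s` isolates the last coefficient, and those of the `ξ_j` leave a linear system for the remaining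
ones. -/
theorem bernsteinSymbol_indep (hd : d ≠ 0) (hc : c ≠ 0) (hh : h ≠ 0)
    (hindep : LinearIndependent (MvPolynomial (Fin (n + 1)) ℂ)
      (Fin.snoc δ (eulerField p) : Fin (n + 1) → VectorField (n + 1)))
    (hspan : Submodule.span (MvPolynomial (Fin (n + 1)) ℂ)
      (Set.range (Fin.snoc δ (eulerField p) : Fin (n + 1) → VectorField (n + 1))) = logDer h)
    {a : Fin (n + 2) → MvPolynomial (Fin (n + 2)) ℂ}
    (ha : ∑ i, C (a i) * bernsteinSymbol p d h c δ i = 0) (i : Fin (n + 2)) : a i = 0 := by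
  have hev : ∀ v : Option (Fin (n + 2)) → MvPolynomial (Fin (n + 2)) ℂ,
      a 0 * hTilde h c d + ((∑ i : Fin n, a i.castSucc.succ *
        ∑ j, rename Fin.succ (δ i (X j)) * v (some j.succ)) + a (Fin.last n).succ *
          (∑ j, rename Fin.succ (eulerField p (X j)) * v (some j.succ) + X 0 * v (some 0) -
            (d : MvPolynomial (Fin (n + 2)) ℂ) * v none)) = 0 := by
    intro v
    have h1 := congrArg (eval v) ha
    rw [Fin.sum_univ_succ, Fin.sum_univ_castSucc] at h1
    simpa only [bernsteinSymbol, Fin.cons_zero, Fin.cons_succ, Fin.snoc_castSucc, Fin.snoc_last,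
      map_add, map_sub, map_sum, map_mul, eval_C, eval_X, map_natCast, eval_liftSymbol,
      map_zero] using h1
  have h0 : a 0 * hTilde h c d = 0 := by simpa using hev 0
  have hlast : a (Fin.last n).succ = 0 := by
    have h1 := hev (Pi.single none 1)
    rw [h0, zero_add] at h1
    simpa [hd] using h1
  have hj : ∀ j, ∑ i : Fin n, a i.castSucc.succ * rename Fin.succ (δ i (X j)) = 0 := by
    intro j
    have h1 := hev (Pi.single (some j.succ) 1)
    rw [h0, hlast, zero_mul, add_zero, zero_add] at h1
    rw [← h1]
    refine Finset.sum_congr rfl fun i _ => ?_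
    rw [Finset.sum_eq_single j, Pi.single_eq_same, mul_one]
    · intro k _ hk
      rw [Pi.single_eq_of_ne (fun h => hk (Fin.succ_injective _ (Option.some_injective _ h))),
        mul_zero]
    · simp
  -- Multiplying the linear system by the dual coefficients leaves `a_k h = 0` for each remaining
  -- coefficient.
  obtain ⟨b, -, hb⟩ := exists_dual_coefficients hindep
    fun j => hspan.symm ▸ smul_pderiv_mem_logDer h j
  induction i using Fin.cases with
  | zero => exact (mul_eq_zero.1 h0).resolve_right (hTilde_ne_zero hd hc)
  | succ i =>
    induction i using Fin.lastCases with
    | last => exact hlast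
    | cast k =>
      have h1 : ∑ j, (∑ i : Fin n, a i.castSucc.succ * rename Fin.succ (δ i (X j))) *
          rename Fin.succ (b j k.castSucc) = 0 :=
        Finset.sum_eq_zero fun j _ => by rw [hj, zero_mul]
      have h2 : ∀ i : Fin n, ∑ j, rename Fin.succ (δ i (X j)) * rename Fin.succ (b j k.castSucc) =
          if k = i then rename Fin.succ h else 0 := by
        intro i
        have h3 := congrArg (rename Fin.succ : MvPolynomial (Fin (n + 1)) ℂ →ₐ[ℂ]
          MvPolynomial (Fin (n + 2)) ℂ) (hb i.castSucc k.castSucc)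
        simp only [Fin.snoc_castSucc, map_sum, map_mul, Fin.castSucc_inj] at h3
        rw [h3]
        split_ifs
        · rfl
        · exact map_zero _
      simp only [Finset.sum_mul] at h1
      rw [Finset.sum_comm] at h1
      simp only [mul_assoc, ← Finset.mul_sum, h2, mul_ite, mul_zero, Finset.sum_ite_eq,
        Finset.mem_univ, if_true] at h1
      refine (mul_eq_zero.1 h1).resolve_right ?_
      exact fun h3 => hh (rename_injective _ (Fin.succ_injective _) (h3.trans (map_zero _).symm))

theorem normalHom_liftSymbol (δ : VectorField (n + 1)) :
    normalHom (n + 2) (liftSymbol δ) = Polynomial.C (liftField δ) := by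
  simp only [liftSymbol, liftField, map_sum, normalHom_C_mul, normalHom_X, map_mul, coeffOp,
    RingHom.comp_apply, genOp]

theorem normalHom_bernsteinSymbol (i : Fin (n + 2)) :
    normalHom (n + 2) (bernsteinSymbol p d h c δ i) = bernsteinFamily p d h c δ i := by
  rw [bernsteinSymbol, bernsteinFamily]
  induction i using Fin.cases with
  | zero => rw [Fin.cons_zero, Fin.cons_zero, normalHom_C]
  | succ i =>
    rw [Fin.cons_succ, Fin.cons_succ]
    induction i using Fin.lastCases with
    | last =>
      rw [Fin.snoc_last, Fin.snoc_last, map_sub, map_add, normalHom_liftSymbol, normalHom_C_mul,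
        normalHom_X, ← map_natCast (C : MvPolynomial (Fin (n + 2)) ℂ →+* GrS (n + 2)),
        normalHom_C_mul, normalHom_X, chiTilde, map_add, map_mul, map_natCast]
      rfl
    | cast i => rw [Fin.snoc_castSucc, Fin.snoc_castSucc, normalHom_liftSymbol]

theorem liftSymbol_isHomogeneous (δ : VectorField (n + 1)) : (liftSymbol δ).IsHomogeneous 1 :=
  IsHomogeneous.sum _ _ _ fun j _ => by
    simpa using (isHomogeneous_C _ _).mul (isHomogeneous_X _ (some j.succ))

/-- The orders of the operators in the family. -/
def bernsteinOrder (n : ℕ) : Fin (n + 2) → ℕ := Fin.cons 0 fun _ => 1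

theorem bernsteinSymbol_isHomogeneous (i : Fin (n + 2)) :
    (bernsteinSymbol p d h c δ i).IsHomogeneous (bernsteinOrder n i) := by
  rw [bernsteinSymbol, bernsteinOrder]
  induction i using Fin.cases with
  | zero => exact isHomogeneous_C _ _
  | succ i =>
    rw [Fin.cons_succ, Fin.cons_succ]
    induction i using Fin.lastCases with
    | last =>
      rw [Fin.snoc_last]
      refine ((liftSymbol_isHomogeneous _).add ?_).sub ?_
      · simpa using (isHomogeneous_C _ _).mul (isHomogeneous_X _ (some (0 : Fin (n + 2))))
      · rw [← map_natCast (C : MvPolynomial (Fin (n + 2)) ℂ →+* GrS (n + 2))]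
        exact (zero_add 1).subst (motive := IsHomogeneous _) ((isHomogeneous_C _ _).mul
          (isHomogeneous_X _ (none : Option (Fin (n + 2)))))
    | cast i =>
      rw [Fin.snoc_castSucc]
      exact liftSymbol_isHomogeneous _

theorem isSymbol_bernsteinSymbol (i : Fin (n + 2)) :
    IsSymbol (bernsteinOrder n i) (bernsteinFamily p d h c δ i) (bernsteinSymbol p d h c δ i) := by
  refine ⟨bernsteinSymbol_isHomogeneous i, 0, by simp, ?_⟩
  rw [← normalHom_apply, ← normalHom_apply, normalHom_bernsteinSymbol, sub_self, map_zero]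

theorem isLieRinehartFamily_bernsteinFamily (hd : d ≠ 0) (hc : c ≠ 0) (hh : h ≠ 0)
    (hqh : IsWeightedHomogeneous p h (d : ℚ)) (hδ : ∀ i, δ i h = 0)
    (hindep : LinearIndependent (MvPolynomial (Fin (n + 1)) ℂ)
      (Fin.snoc δ (eulerField p) : Fin (n + 1) → VectorField (n + 1)))
    (hspan : Submodule.span (MvPolynomial (Fin (n + 1)) ℂ)
      (Set.range (Fin.snoc δ (eulerField p) : Fin (n + 1) → VectorField (n + 1))) = logDer h) :
    IsLieRinehartFamily (coeffOp (n + 2)) (bernsteinFamily p d h c δ) := by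
  refine .of_generators (fun a ha => bernsteinSymbol_indep hd hc hh hindep hspan ?_)
    bernsteinFamily_anchor (bernsteinFamily_bracket_mem hh hd hqh hδ hspan)
  refine normalHom_injective ?_
  rw [map_zero, map_sum, ← ha]
  exact Finset.sum_congr rfl fun i _ => by rw [normalHom_C_mul, normalHom_bernsteinSymbol]

/-- The bound on brackets is automatic between two fields, of order 1 each. A bracket of `h̃` with a
field has total order 1, and the bound holds because only `h̃`, of order 0, occurs in it. -/
theorem hasHomogeneousSymbols_bernsteinFamily (hqh : IsWeightedHomogeneous p h (d : ℚ))
    (hδ : ∀ i, δ i h = 0)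
    (hr : IsLieRinehartFamily (coeffOp (n + 2)) (bernsteinFamily p d h c δ)) :
    HasHomogeneousSymbols (bernsteinFamily p d h c δ) (structureConst hr)
      (bernsteinSymbol p d h c δ) (bernsteinOrder n) where
  eq_normalHom i := (normalHom_bernsteinSymbol i).symm
  homogeneous := bernsteinSymbol_isHomogeneous
  bracket i j k hij hk := by
    have hle : ∀ k, bernsteinOrder n k ≤ 1 := fun k => by
      induction k using Fin.cases with
      | zero => exact Nat.zero_le _
      | succ k => exact le_rfl
    have hj : bernsteinOrder n j = 1 := by
      obtain ⟨j, rfl⟩ := Fin.exists_succ_eq.2 (((Fin.zero_le i).trans_lt hij).ne')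
      rfl
    induction i using Fin.cases with
    | zero =>
      obtain ⟨b, hb⟩ := bernsteinFamily_bracket_zero (c := c) hqh hδ j
      rw [structureConst_eq hr hb] at hk
      have hk0 : k = 0 := by
        by_contra h0
        exact hk (Pi.single_eq_of_ne h0 _)
      rw [hk0, hj, add_comm]
    | succ i =>
      have h1 := hle k
      have h2 : bernsteinOrder n i.succ = 1 := rfl
      omega

end BernsteinFamily

/-! ### The Spencer complex -/

section Resolution

variable {N m : ℕ} {r : Fin m → WeylAlgS N} {σ : Fin m → GrS N} {wt : Fin m → ℕ}

theorem weylAlgS_torsion (x : WeylAlgS N) (hx : (24 : ℕ) • x = 0) : x = 0 := by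
  refine normalForm_injective ?_
  rw [map_zero]
  exact grS_torsion _ (by rw [← map_nsmul, hx, map_zero])

theorem spencerEmb_apply_eq_zero (R : Type*) [Ring R] {e : ℕ} (x : Spencer R m e)
    {S : Finset (Fin m)} (hS : S.card ≠ e) : spencerEmb R m e x S = 0 := by
  rw [spencerEmb_apply, dif_neg hS]

/-- The filtered argument gives exactness in negative degrees. In degree 0 the image of the
differential consists of the combinations of the `r i`, which form the left ideal. -/
theorem isFreeResolution_spencerD (hr : IsLieRinehartFamily (coeffOp N) r)
    (H : HasHomogeneousSymbols r (structureConst hr) σ wt) (hσ : IsWeaklyRegularFamily σ)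
    (hsq : totalD r (fun i j k => coeffOp N (structureConst hr i j k)) *
      totalD r (fun i j k => coeffOp N (structureConst hr i j k)) = 0) :
    IsFreeResolution (fun e => spencerD hr e)
      (spencerAug m (Submodule.span (WeylAlgS N) (Set.range r))) where
  free e := inferInstance
  exact e x := by
    constructor
    · intro hx
      obtain ⟨y, hy, hyx⟩ := H.exact hσ hsq (e := e)
        (fun S hS => spencerEmb_apply_eq_zero _ x hS) (by rw [← spencerEmb_spencerD, hx, map_zero])
      obtain ⟨y, rfl⟩ := exists_spencerEmb_eq hy
      exact ⟨y, spencerEmb_injective _ (by rw [spencerEmb_spencerD, hyx])⟩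
    · rintro ⟨y, rfl⟩
      refine spencerEmb_injective _ ?_
      rw [spencerEmb_spencerD, spencerEmb_spencerD, ← Module.End.mul_apply, hsq, map_zero]
      rfl
  exact_zero x := by
    have haug : spencerAug m (Submodule.span (WeylAlgS N) (Set.range r)) x =
        Submodule.mkQ _ (spencerEmb (WeylAlgS N) m 0 x ∅) := by
      induction x using Finsupp.induction_linear with
      | zero => rw [map_zero, map_zero, Pi.zero_apply, map_zero]
      | add x y hx hy => rw [map_add, map_add, Pi.add_apply, map_add, hx, hy]
      | single S P =>
        obtain ⟨S, hS⟩ := S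
        obtain rfl := Finset.card_eq_zero.1 hS
        rw [spencerAug, Finsupp.linearCombination_single, ← map_smul, smul_eq_mul, mul_one,
          spencerEmb_apply, dif_pos hS, Finsupp.single_eq_same]
    rw [haug, Submodule.mkQ_apply, Submodule.Quotient.mk_eq_zero,
      Submodule.mem_span_range_iff_exists_fun]
    constructor
    · rintro ⟨a, ha⟩
      have hy : ∀ S : Finset (Fin m), S.card ≠ 1 → (∑ i, if S = {i} then a i else 0) = 0 :=
        fun S hS => Finset.sum_eq_zero fun i _ => if_neg fun h =>
          hS (by rw [h, Finset.card_singleton])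
      obtain ⟨y, hy⟩ := exists_spencerEmb_eq hy
      refine ⟨y, spencerEmb_injective _ (funext fun S => ?_)⟩
      rcases eq_or_ne S ∅ with rfl | hS
      · rw [spencerEmb_spencerD, totalD_apply_empty, ← ha, hy]
        simp
      · rw [spencerEmb_apply_eq_zero _ _ (mt Finset.card_eq_zero.1 hS),
          spencerEmb_apply_eq_zero _ _ (mt Finset.card_eq_zero.1 hS)]
    · rintro ⟨y, rfl⟩
      exact ⟨_, by rw [spencerEmb_spencerD, totalD_apply_empty]; rfl⟩
  surjective := by
    intro y
    obtain ⟨P, rfl⟩ := Submodule.mkQ_surjective _ y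
    refine ⟨Finsupp.single ⟨∅, Finset.card_empty⟩ P, ?_⟩
    rw [spencerAug, Finsupp.linearCombination_single, ← map_smul, smul_eq_mul, mul_one]

/-- The nontrivial inclusion is `mem_span_of_isSymbol`, as each `σ i` is itself a symbol class of `r
i`. -/
theorem isInvolutiveBasis_span {c : Fin m → Fin m → Fin m → MvPolynomial (Fin N) ℂ}
    (H : HasHomogeneousSymbols r c σ wt) (hσ : IsWeaklyRegularFamily σ)
    (hsq : totalD r (fun i j k => coeffOp N (c i j k)) *
      totalD r (fun i j k => coeffOp N (c i j k)) = 0) :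
    IsInvolutiveBasis r (Submodule.span (WeylAlgS N) (Set.range r)) where
  span_eq := rfl
  symbolIdeal_eq := by
    refine le_antisymm (Ideal.span_le.2 ?_)
      (Ideal.span_mono fun q ⟨P, hP, h⟩ => ⟨P, Submodule.subset_span hP, h⟩)
    rintro q ⟨P, hP, k, hk⟩
    refine Ideal.span_le.2 ?_ (H.mem_span_of_isSymbol hσ hsq hP hk)
    rintro _ ⟨i, rfl⟩
    refine Ideal.subset_span ⟨r i, ⟨i, rfl⟩, wt i, H.homogeneous i, 0, by simp, ?_⟩
    rw [← normalHom_apply, ← normalHom_apply, map_zero, H.eq_normalHom, sub_self]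

end Resolution

/-! ### Properness of the ideal of symbols and the main theorem -/

theorem coeff_zero_eq_zero_of_isWeightedHomogeneous {N : ℕ} {p : Fin N → ℚ}
    {h : MvPolynomial (Fin N) ℂ} {q : ℚ} (hqh : IsWeightedHomogeneous p h q) (hq : q ≠ 0) :
    coeff 0 h = 0 := by
  by_contra h0
  exact hq ((hqh h0).symm.trans (map_zero _))

/-- Beyond weak regularity, the ideal must be proper: all the symbols vanish at the origin, `h̃`
because a quasi-homogeneous polynomial of nonzero degree has no constant term. -/
theorem isRegular_bernsteinSymbol {n : ℕ} {p : Fin (n + 1) → ℚ} {d : ℕ}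
    {h : MvPolynomial (Fin (n + 1)) ℂ} {c : ℂ} {δ : Fin n → VectorField (n + 1)} (hd : d ≠ 0)
    (hqh : IsWeightedHomogeneous p h (d : ℚ))
    (hσ : IsWeaklyRegularFamily (bernsteinSymbol p d h c δ)) :
    RingTheory.Sequence.IsRegular (GrS (n + 2)) (List.ofFn (bernsteinSymbol p d h c δ)) := by
  refine ⟨isWeaklyRegular_ofFn_iff.2 hσ, ?_⟩
  set φ : GrS (n + 2) →+* ℂ := (constantCoeff : MvPolynomial (Fin (n + 2)) ℂ →+* ℂ).comp
    constantCoeff with hφ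
  have hker : ∀ i, φ (bernsteinSymbol p d h c δ i) = 0 := by
    intro i
    induction i using Fin.cases with
    | zero =>
      have h0 : constantCoeff h = 0 :=
        coeff_zero_eq_zero_of_isWeightedHomogeneous hqh (Nat.cast_ne_zero.2 hd)
      have h1 : constantCoeff (rename Fin.succ h : MvPolynomial (Fin (n + 2)) ℂ) = 0 := by
        rw [constantCoeff_rename, h0]
      rw [bernsteinSymbol, Fin.cons_zero, hφ, RingHom.comp_apply, constantCoeff_C, hTilde, map_sub,
        map_mul, map_pow, constantCoeff_X, zero_pow hd, mul_zero, h1, sub_zero]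
    | succ i =>
      have h1 : constantCoeff (bernsteinSymbol p d h c δ i.succ) = 0 :=
        (bernsteinSymbol_isHomogeneous i.succ).coeff_eq_zero (by rw [map_zero]; exact zero_ne_one)
      rw [hφ, RingHom.comp_apply, h1, map_zero]
  have hle : Ideal.ofList (List.ofFn (bernsteinSymbol p d h c δ)) ≤ RingHom.ker φ := by
    refine Ideal.span_le.2 fun x hx => ?_
    obtain ⟨i, rfl⟩ := (List.mem_ofFn' _ _).1 hx
    exact hker i
  intro htop
  rw [smul_eq_mul, Ideal.mul_top] at htop
  have h1 : (1 : GrS (n + 2)) ∈ RingHom.ker φ := hle (htop ▸ Submodule.mem_top)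
  exact one_ne_zero ((map_one φ).symm.trans h1)

end

theorem mainTheorem9 (n : ℕ) (p : Fin (n + 1) → ℚ) (d : ℕ) (h : MvPolynomial (Fin (n + 1)) ℂ)
    (c : ℂ)
    (δ : Fin n → Derivation ℂ (MvPolynomial (Fin (n + 1)) ℂ) (MvPolynomial (Fin (n + 1)) ℂ))
    (hred : Squarefree h)
    (hqh : MvPolynomial.IsWeightedHomogeneous p h (d : ℚ))
    (hδ : ∀ i, δ i h = 0)
    (hindep : LinearIndependent (MvPolynomial (Fin (n + 1)) ℂ)
      (Fin.snoc δ (eulerField p) : Fin (n + 1) →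
        Derivation ℂ (MvPolynomial (Fin (n + 1)) ℂ) (MvPolynomial (Fin (n + 1)) ℂ)))
    (hspan : Submodule.span (MvPolynomial (Fin (n + 1)) ℂ)
      (Set.range (Fin.snoc δ (eulerField p) : Fin (n + 1) →
        Derivation ℂ (MvPolynomial (Fin (n + 1)) ℂ) (MvPolynomial (Fin (n + 1)) ℂ))) = logDer h)
    (hSK : StronglyKoszul h δ)
    (hc : c ≠ 0) :
    (∃ hr : IsLieRinehartFamily (coeffOp (n + 2)) (bernsteinFamily p d h c δ),
      IsFreeResolution (fun e => spencerD hr e) (spencerAug (n + 2) (bernsteinIdeal p d h c δ))) ∧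
    IsInvolutiveBasis (bernsteinFamily p d h c δ) (bernsteinIdeal p d h c δ) ∧
    (∃ σ : Fin (n + 2) → GrS (n + 2),
      (∀ i, σ i ≠ 0 ∧ ∃ k, IsSymbol k (bernsteinFamily p d h c δ i) (σ i)) ∧
      RingTheory.Sequence.IsRegular (GrS (n + 2)) (List.ofFn σ)) := by
  have hh := hred.ne_zero
  have hd := degree_ne_zero hred hqh hδ hspan hSK
  have hr := isLieRinehartFamily_bernsteinFamily hd hc hh hqh hδ hindep hspan
  have H := hasHomogeneousSymbols_bernsteinFamily hqh hδ hr
  have hσ := isWeaklyRegularFamily_bernsteinSymbol (p := p) (h := h) hd hc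
    (isWeaklyRegularFamily_fieldSymbol hh hindep hspan hSK)
  have hsq := totalD_structureConst_mul_self hr weylAlgS_torsion bernsteinFamily_anchor
  refine ⟨⟨hr, isFreeResolution_spencerD hr H hσ hsq⟩, isInvolutiveBasis_span H hσ hsq,
    bernsteinSymbol p d h c δ, fun i => ⟨fun h0 => ?_, _, isSymbol_bernsteinSymbol i⟩,
    isRegular_bernsteinSymbol hd hqh hσ⟩
  -- The class in `IsSymbol` is a true symbol only if it is nonzero; a vanishing one would be a
  -- relation with a unit vector of coefficients.
  have h1 : (Pi.single i 1 : Fin (n + 2) → MvPolynomial (Fin (n + 2)) ℂ) i = 0 := by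
    refine bernsteinSymbol_indep hd hc hh hindep hspan (Finset.sum_eq_zero fun k _ => ?_) i
    rcases eq_or_ne k i with rfl | hk
    · rw [h0, mul_zero]
    · rw [Pi.single_eq_of_ne hk, map_zero, zero_mul]
  rw [Pi.single_eq_same] at h1
  exact one_ne_zero h1
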